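/- Let $(\mathcal M,g)$ be a smooth four-dimensional spacetime of signature $(-,+,+,+)$ with Weyl tensor $W$, and let $p\in\mathcal M$ be a point at which $W$ is of Petrov–Bel type I, i.e. the self-dual Weyl tensor $\mathcal W=\frac12(W-\mathrm i\,{*W})$, acting on the complex three-dimensional space of self-dual bivectors, has three different eigenvalues. The Bel–Robinson tensor is $$T_{\alpha\mu\beta\nu}=\tfrac14\big(W_\alpha{}^{\rho}{}_\beta{}^{\sigma}W_{\mu\rho\nu\sigma}+{*W}_\alpha{}^{\rho}{}_\beta{}^{\sigma}\,{*W}_{\mu\rho\nu\sigma}\big).$$ For an observer $u$ (a vector with $g(u,u)=-1$) the stress flux tensor $Q_\perp=-T(u)_\perp$ is the projection, by $\gamma=g+u\otimes u$, of $-T(u,\cdot,\cdot,\cdot)$; the field is *super-energy radiative* at $p$ if $Q_\perp\neq0$ for every observer $u$. Put $a=\operatorname{tr}\mathcal W^2$, $b=\operatorname{tr}\mathcal W^3$ and $M=a^3/b^2-6$ (with $M=\infty$ if $b=0$). The type I field is of type $IM^{-6}$ if $M=-6$; of type $IM^-$ if $M$ is a negative real number different from $-6$; and of regular type $I_r$ if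 $M$ is finite and not real and $T$, as an endomorphism of the nine-dimensional space of traceless symmetric tensors, has nine different eigenvalues, three real ones and three pairs of complex conjugates. A null Debever vector is a null vector $k\ne0$ with $k_{[\alpha}W_{\beta]\gamma\delta[\epsilon}k_{\phi]}k^\gamma k^\delta=0$. **Proposition.** There are exactly four null Debever directions at $p$. Let $k_1,\dots,k_4$ be vectors representing them. Then: 1. the field is super-energy radiative at $p$ if and only if $k_1,\dots,k_4$ form a frame (a basis of the tangent space at $p$); 2. if the field is of type $IM^{-6}$ at $p$, then the $k_i$ form a frame and, after multiplying each $k_i$ by a suitable nonzero real number, this frame is symmetric: the matrix of metric products $g(k_i,k_j)$ is invariant under every permutation of the four vectors; 3. if the field is of type $IM^{-}$ at $p$, then the $k_i$ form a frame and, after multiplying each $k_i$ by a suitable nonzero real number, this frame is partially symmetric (symmetric by pairs): it splits into two pairs such that the product inside both pairs is the same number $q$, and all four products of a vector of one pair with a vector of the other are the same number $r\neq q$; 4. if the field is super-energy radiative at $p$ and is neither of type $IM^{-6}$ nor of type $IM^{-}$ at $p$, then it is of regular type $I_r$ at $p$. -/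

import Mathlib

open scoped Manifold ContDiff

noncomputable section

namespace SuperEnergy

/-! ### Lorentzian metrics on a four-dimensional manifold and their curvature in a chart -/

/-- The model space of coordinates `(x⁰, x¹, x², x³)`. -/
abbrev Coord : Type := EuclideanSpace ℝ (Fin 4)

/-- Components of a covariant tensor with four indices, in some basis of a
four-dimensional vector space. -/
abbrev Tensor4 : Type := Fin 4 → Fin 4 → Fin 4 → Fin 4 → ℝ

/-- The components `g(∂ᵢ, ∂ⱼ)` at the point of coordinates `x` of a field of bilinear forms, in the
coordinate frame `∂ᵢ = d(φ⁻¹)(eᵢ)` of the chart `φ`. -/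
def chartComponents {M : Type*} [TopologicalSpace M] [ChartedSpace Coord M]
    (g : (p : M) → LinearMap.BilinForm ℝ (TangentSpace (𝓡 4) p))
    (φ : OpenPartialHomeomorph M Coord) (x : Coord) : Matrix (Fin 4) (Fin 4) ℝ :=
  Matrix.of fun i j =>
    g (φ.symm x)
      (mfderiv (𝓡 4) (𝓡 4) φ.symm x (EuclideanSpace.single i (1 : ℝ) : Coord))
      (mfderiv (𝓡 4) (𝓡 4) φ.symm x (EuclideanSpace.single j (1 : ℝ) : Coord))

/-- A smooth Lorentzian metric, of signature `(-,+,+,+)`, on a smooth four-dimensional manifold. -/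
structure LorentzianMetric (M : Type*) [TopologicalSpace M] [ChartedSpace Coord M]
    [IsManifold (𝓡 4) ∞ M] where
  /-- the metric on each tangent space -/
  val : (p : M) → LinearMap.BilinForm ℝ (TangentSpace (𝓡 4) p)
  symm : ∀ (p : M) (v w : TangentSpace (𝓡 4) p), val p v w = val p w v
  /-- each tangent space has an orthonormal basis with one timelike and three spacelike vectors -/
  signature : ∀ p : M, ∃ e : Module.Basis (Fin 4) ℝ (TangentSpace (𝓡 4) p), ∀ i j : Fin 4,
    val p (e i) (e j) = if i = j then (if i = 0 then -1 else 1) else 0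
  /-- the components are smooth functions of the coordinates, in every smooth chart -/
  smooth : ∀ φ ∈ IsManifold.maximalAtlas (𝓡 4) ∞ M, ∀ i j : Fin 4,
    ContDiffOn ℝ ∞ (fun x => chartComponents val φ x i j) φ.target

/-- Partial derivative with respect to the `i`-th coordinate. -/
def pderiv (i : Fin 4) (f : Coord → ℝ) (x : Coord) : ℝ :=
  fderiv ℝ f x (EuclideanSpace.single i 1)

/-- Christoffel symbols `Γ^a_{bc} = ½ g^{ad} (∂_b g_{dc} + ∂_c g_{db} - ∂_d g_{bc})` of a matrix
field of metric components. -/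
def christoffel (G : Coord → Matrix (Fin 4) (Fin 4) ℝ) (a b c : Fin 4) (x : Coord) : ℝ :=
  (1 / 2) * ∑ d, (G x)⁻¹ a d *
    (pderiv b (fun y => G y d c) x + pderiv c (fun y => G y d b) x - pderiv d (fun y => G y b c) x)

/-- The covariant Riemann tensor
`R_{abcd} = ½ (∂_b∂_c g_{ad} + ∂_a∂_d g_{bc} - ∂_b∂_d g_{ac} - ∂_a∂_c g_{bd})
  + g_{ef} (Γ^e_{bc} Γ^f_{ad} - Γ^e_{bd} Γ^f_{ac})`,
that is, `g_{ae}` times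
`R^e_{bcd} = ∂_c Γ^e_{bd} - ∂_d Γ^e_{bc} + Γ^e_{cf} Γ^f_{bd} - Γ^e_{df} Γ^f_{bc}`. -/
def riemann (G : Coord → Matrix (Fin 4) (Fin 4) ℝ) (x : Coord) : Tensor4 := fun a b c d =>
  (1 / 2) *
    (pderiv b (pderiv c fun y => G y a d) x + pderiv a (pderiv d fun y => G y b c) x
      - pderiv b (pderiv d fun y => G y a c) x - pderiv a (pderiv c fun y => G y b d) x)
  + ∑ e, ∑ f, G x e f *
    (christoffel G e b c x * christoffel G f a d x - christoffel G e b d x * christoffel G f a c x)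

/-- The Ricci tensor `R_{bd} = g^{ac} R_{abcd}`. -/
def ricci (G : Coord → Matrix (Fin 4) (Fin 4) ℝ) (x : Coord) (b d : Fin 4) : ℝ :=
  ∑ a, ∑ c, (G x)⁻¹ a c * riemann G x a b c d

/-- The scalar curvature `R = g^{bd} R_{bd}`. -/
def scalarCurvature (G : Coord → Matrix (Fin 4) (Fin 4) ℝ) (x : Coord) : ℝ :=
  ∑ b, ∑ d, (G x)⁻¹ b d * ricci G x b d

/-- The covariant Weyl tensor (dimension four). -/
def weyl (G : Coord → Matrix (Fin 4) (Fin 4) ℝ) (x : Coord) : Tensor4 := fun a b c d =>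
  riemann G x a b c d
  - (1 / 2) * (G x a c * ricci G x b d - G x a d * ricci G x b c
      - G x b c * ricci G x a d + G x b d * ricci G x a c)
  + (scalarCurvature G x / 6) * (G x a c * G x b d - G x a d * G x b c)

/-- The components of the metric at the point `p`, in the coordinate frame of the chart `φ`. -/
def LorentzianMetric.metricAt {M : Type*} [TopologicalSpace M] [ChartedSpace Coord M]
    [IsManifold (𝓡 4) ∞ M] (g : LorentzianMetric M) (φ : OpenPartialHomeomorph M Coord) (p : M) :
    Matrix (Fin 4) (Fin 4) ℝ :=
  chartComponents g.val φ (φ p)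

/-- The components of the Weyl tensor at the point `p`, in the coordinate frame of the
chart `φ`. -/
def LorentzianMetric.weylAt {M : Type*} [TopologicalSpace M] [ChartedSpace Coord M]
    [IsManifold (𝓡 4) ∞ M] (g : LorentzianMetric M) (φ : OpenPartialHomeomorph M Coord) (p : M) :
    Tensor4 :=
  weyl (chartComponents g.val φ) (φ p)

/-! ### Algebra of the Weyl tensor at a point

Below, `G` is the matrix of the metric and `W` are the covariant components of the Weyl tensor at a
point, in a basis of the tangent space (a coordinate frame); a tangent vector is given by its
components in that basis. -/

/-- The metric product of two vectors. -/
def metricProduct (G : Matrix (Fin 4) (Fin 4) ℝ) (v w : Fin 4 → ℝ) : ℝ :=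
  ∑ a, ∑ b, G a b * v a * w b

/-- The covector `v_a = g_{ab} v^b`. -/
def lower (G : Matrix (Fin 4) (Fin 4) ℝ) (v : Fin 4 → ℝ) (a : Fin 4) : ℝ :=
  ∑ b, G a b * v b

/-- The Levi-Civita symbol, with `levi 0 1 2 3 = 1`. -/
def levi (a b c d : Fin 4) : ℝ :=
  Matrix.det (Matrix.of fun i j : Fin 4 => if ![a, b, c, d] i = j then (1 : ℝ) else 0)

/-- The metric volume element `η_{abcd}`, for the orientation of the basis. (The opposite orientation
changes the sign of the dual, which leaves the Bel-Robinson tensor unchanged and replaces the Weyl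
eigenvalues and the scalar `M` by their complex conjugates.) -/
def volumeElement (G : Matrix (Fin 4) (Fin 4) ℝ) : Tensor4 := fun a b c d =>
  Real.sqrt |G.det| * levi a b c d

/-- The mixed components `½ η_{ab}^{cd}` of the Hodge dual of bivectors. -/
def hodge (G : Matrix (Fin 4) (Fin 4) ℝ) : Tensor4 := fun a b c d =>
  (1 / 2) * ∑ e, ∑ f, volumeElement G a b e f * G⁻¹ e c * G⁻¹ f d

/-- The dual Weyl tensor `*W_{abcd} = ½ η_{ab}^{ef} W_{efcd}`. -/
def dualWeyl (G : Matrix (Fin 4) (Fin 4) ℝ) (W : Tensor4) : Tensor4 := fun a b c d =>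
  ∑ e, ∑ f, hodge G a b e f * W e f c d

/-- The Bel-Robinson tensor
`T_{ambn} = ¼ (W_a^r_b^s W_{mrns} + *W_a^r_b^s *W_{mrns})`, with arguments `a m b n`. -/
def belRobinson (G : Matrix (Fin 4) (Fin 4) ℝ) (W : Tensor4) : Tensor4 := fun a m b n =>
  (1 / 4) * ∑ r, ∑ s, ∑ r', ∑ s', G⁻¹ r' r * G⁻¹ s' s *
    (W a r' b s' * W m r n s + dualWeyl G W a r' b s' * dualWeyl G W m r n s)

/-- An observer: a unit timelike vector. -/
def IsObserver (G : Matrix (Fin 4) (Fin 4) ℝ) (u : Fin 4 → ℝ) : Prop :=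
  metricProduct G u u = -1

/-- The mixed components `γ^a_b = δ^a_b + u^a u_b` of the projector orthogonal to `u`. -/
def projector (G : Matrix (Fin 4) (Fin 4) ℝ) (u : Fin 4 → ℝ) (a b : Fin 4) : ℝ :=
  (if a = b then 1 else 0) + u a * lower G u b

/-- The stress flux tensor `Q_⊥ = -T(u)_⊥` relative to the observer `u`. -/
def stressFlux (G : Matrix (Fin 4) (Fin 4) ℝ) (W : Tensor4) (u : Fin 4 → ℝ) :
    Fin 4 → Fin 4 → Fin 4 → ℝ := fun a b c =>
  -∑ a', ∑ b', ∑ c', projector G u a' a * projector G u b' b * projector G u c' c *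
    ∑ d, belRobinson G W a' b' c' d * u d

/-- Intrinsic super-energy radiation at the point: the stress flux tensor does not vanish for any
observer. -/
def IsSuperEnergyRadiative (G : Matrix (Fin 4) (Fin 4) ℝ) (W : Tensor4) : Prop :=
  ∀ u : Fin 4 → ℝ, IsObserver G u → stressFlux G W u ≠ 0

/-- The self-dual Weyl tensor `𝒲 = ½ (W - i *W)` as the endomorphism
`F_{ab} ↦ ½ 𝒲_{ab}^{cd} F_{cd}` of complex bivectors. -/
def weylEndo (G : Matrix (Fin 4) (Fin 4) ℝ) (W : Tensor4) :
    Matrix (Fin 4 × Fin 4) (Fin 4 × Fin 4) ℂ :=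
  Matrix.of fun P S => (1 / 2) * ∑ e, ∑ f,
    (1 / 2) * ((W P.1 P.2 e f : ℂ) - Complex.I * (dualWeyl G W P.1 P.2 e f : ℂ)) *
      (G⁻¹ e S.1 : ℂ) * (G⁻¹ f S.2 : ℂ)

/-- A complex bivector which is self-dual, `*F = i F`. -/
def IsSelfDualBivector (G : Matrix (Fin 4) (Fin 4) ℝ) (F : Fin 4 × Fin 4 → ℂ) : Prop :=
  (∀ a b, F (a, b) = -F (b, a)) ∧
    ∀ a b, ∑ c, ∑ d, (hodge G a b c d : ℂ) * F (c, d) = Complex.I * F (a, b)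

/-- A Weyl eigenvalue: an eigenvalue of the self-dual Weyl tensor on the (complex
three-dimensional) space of self-dual bivectors. -/
def IsWeylEigenvalue (G : Matrix (Fin 4) (Fin 4) ℝ) (W : Tensor4) (ρ : ℂ) : Prop :=
  ∃ F : Fin 4 × Fin 4 → ℂ, F ≠ 0 ∧ IsSelfDualBivector G F ∧ (weylEndo G W).mulVec F = ρ • F

/-- Petrov-Bel type `I`: three different Weyl eigenvalues. -/
def IsTypeI (G : Matrix (Fin 4) (Fin 4) ℝ) (W : Tensor4) : Prop :=
  ∃ ρ : Fin 3 → ℂ, Function.Injective ρ ∧ ∀ i, IsWeylEigenvalue G W (ρ i)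

/-- The quadratic complex Weyl scalar `a = tr 𝒲²` (the sum of the squares of the three
eigenvalues). -/
def weylA (G : Matrix (Fin 4) (Fin 4) ℝ) (W : Tensor4) : ℂ := (weylEndo G W ^ 2).trace

/-- The cubic complex Weyl scalar `b = tr 𝒲³`. -/
def weylB (G : Matrix (Fin 4) (Fin 4) ℝ) (W : Tensor4) : ℂ := (weylEndo G W ^ 3).trace

/-- The scalar `M = a³/b² - 6`; meaningful when `b ≠ 0` (one has `M = ∞` when `b = 0 ≠ a`). -/
def weylM (G : Matrix (Fin 4) (Fin 4) ℝ) (W : Tensor4) : ℂ := weylA G W ^ 3 / weylB G W ^ 2 - 6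

/-- Type `IM^{-6}`: type `I` with `M = -6`. -/
def IsTypeIM6 (G : Matrix (Fin 4) (Fin 4) ℝ) (W : Tensor4) : Prop :=
  IsTypeI G W ∧ weylB G W ≠ 0 ∧ weylM G W = -6

/-- Type `IM^-`: type `I` with `M` a negative real number different from `-6`. -/
def IsTypeIMneg (G : Matrix (Fin 4) (Fin 4) ℝ) (W : Tensor4) : Prop :=
  IsTypeI G W ∧ weylB G W ≠ 0 ∧ ∃ m : ℝ, m < 0 ∧ m ≠ -6 ∧ weylM G W = (m : ℂ)

/-- The eigenvalues of the Bel-Robinson tensor as the endomorphism `A_{ab} ↦ T_{ab}^{cd} A_{cd}` of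
the nine-dimensional space of (complexified) traceless symmetric tensors. -/
def belRobinsonEigenvalues (G : Matrix (Fin 4) (Fin 4) ℝ) (W : Tensor4) : Set ℂ :=
  {t | ∃ A : Fin 4 → Fin 4 → ℂ, A ≠ 0 ∧ (∀ a b, A a b = A b a) ∧
    (∑ a, ∑ b, (G⁻¹ a b : ℂ) * A a b) = 0 ∧
    ∀ a b, (∑ c, ∑ d, (∑ e, ∑ f, belRobinson G W a b e f * G⁻¹ e c * G⁻¹ f d : ℝ) * A c d)
      = t * A a b}

/-- Regular type `I_r`: type `I` with `M` finite and not real, the Bel-Robinson tensor having nine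
different eigenvalues, exactly three of which are real. (The other six then form three pairs of
complex conjugates.) -/
def IsTypeIr (G : Matrix (Fin 4) (Fin 4) ℝ) (W : Tensor4) : Prop :=
  IsTypeI G W ∧ weylB G W ≠ 0 ∧ (weylM G W).im ≠ 0 ∧
    (belRobinsonEigenvalues G W).ncard = 9 ∧
    {t ∈ belRobinsonEigenvalues G W | t.im = 0}.ncard = 3

/-! ### Debever vectors and frames -/

/-- A null Debever vector: `k ≠ 0`, `g(k,k) = 0` and `k_{[a} W_{b]cd[e} k_{f]} k^c k^d = 0`. -/
def IsDebever (G : Matrix (Fin 4) (Fin 4) ℝ) (W : Tensor4) (k : Fin 4 → ℝ) : Prop :=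
  k ≠ 0 ∧ metricProduct G k k = 0 ∧
    ∀ a b e f, ∑ c, ∑ d, k c * k d *
      (lower G k a * W b c d e * lower G k f - lower G k b * W a c d e * lower G k f
        - lower G k a * W b c d f * lower G k e + lower G k b * W a c d f * lower G k e) = 0

/-- `k 0, k 1, k 2, k 3` represent the null Debever directions, each of them exactly once: they are
Debever vectors, pairwise not proportional, and every Debever vector is proportional to one of
them. -/
def AreDebeverVectors (G : Matrix (Fin 4) (Fin 4) ℝ) (W : Tensor4) (k : Fin 4 → Fin 4 → ℝ) : Prop :=
  (∀ i, IsDebever G W (k i)) ∧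
    (∀ i j, i ≠ j → ¬ ∃ c : ℝ, k i = c • k j) ∧
    ∀ v, IsDebever G W v → ∃ i, ∃ c : ℝ, v = c • k i

/-- Four vectors form a frame: they are a basis of the tangent space. -/
def IsFrame (v : Fin 4 → Fin 4 → ℝ) : Prop :=
  LinearIndependent ℝ v ∧ Submodule.span ℝ (Set.range v) = ⊤

/-- A symmetric frame: its vectors cannot be distinguished by their mutual metric products, which
are unchanged by every permutation of the vectors. -/
def IsSymmetricFrame (G : Matrix (Fin 4) (Fin 4) ℝ) (v : Fin 4 → Fin 4 → ℝ) : Prop :=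
  IsFrame v ∧ ∀ (σ : Equiv.Perm (Fin 4)) (i j : Fin 4),
    metricProduct G (v (σ i)) (v (σ j)) = metricProduct G (v i) (v j)

/-- A partially symmetric frame (symmetric by pairs): it splits into two pairs
`{v (s 0), v (s 1)}` and `{v (s 2), v (s 3)}` such that all vectors have the same square, the
product inside both pairs is the same number `q`, and the four products of a vector of one pair by a
vector of the other pair are the same number `r ≠ q`. -/
def IsPartiallySymmetricFrame (G : Matrix (Fin 4) (Fin 4) ℝ) (v : Fin 4 → Fin 4 → ℝ) : Prop :=
  IsFrame v ∧ ∃ (s : Equiv.Perm (Fin 4)) (n q r : ℝ), q ≠ r ∧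
    (∀ i, metricProduct G (v i) (v i) = n) ∧
    metricProduct G (v (s 0)) (v (s 1)) = q ∧ metricProduct G (v (s 2)) (v (s 3)) = q ∧
    metricProduct G (v (s 0)) (v (s 2)) = r ∧ metricProduct G (v (s 0)) (v (s 3)) = r ∧
    metricProduct G (v (s 1)) (v (s 2)) = r ∧ metricProduct G (v (s 1)) (v (s 3)) = r

end SuperEnergy

end

open SuperEnergy

open Matrix
open scoped Kronecker ComplexConjugate

namespace SuperEnergy

/-! Every notion in the statement is unchanged by a change of basis of positive determinant, so the
Weyl tensor may be studied in any oriented orthonormal frame at the point. There a Weyl tensor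
amounts to a symmetric traceless complex 3×3 matrix Q (`IsWeylTensor.exists_ofSd`), and the Weyl
eigenvalues are the eigenvalues of Q. In type I the matrix Q is diagonalised by a complex rotation,
and every complex rotation of the self-dual bivectors is induced by a real Lorentz transformation
(`exists_lorentz_of_orthogonal`). Hence there is a principal frame in which Q = diag(σ₀, σ₁, σ₂)
with σ₀ + σ₁ + σ₂ = 0, and the proposition becomes plane geometry of the triangle with vertices σᵢ
and centroid 0 in ℂ. Write dᵢ for its sides.

Radiation: T is sesquilinear in Q (`belRobinson_ofSd`). If some observer sees no stress flux, then
in the frame of that observer the real and imaginary parts of Q are proportional, so all σᵢ lie on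
one real line through 0. Conversely, for such σᵢ the time vector of the principal frame sees no
flux. So the field is radiative exactly when the triangle is not flat, `triArea σ ≠ 0`.

Debever vectors: null directions correspond to isotropic u in ℂ³ up to scale, and the Debever
condition becomes ∑ σᵢ uᵢ² = 0 (`isDebever_nullVec_iff`). Together with ∑ uᵢ² = 0 this makes (uᵢ²)
proportional to (dᵢ). The signs of the square roots, up to a common one, give four directions. Their
determinant is a nonzero multiple of the area (`det_debeverVec`, `rootIm_prod`), and their metric
products are a common factor times the side lengths |dᵢ|, each side serving for two complementary
pairs (`metricProduct_debeverVec`). An equilateral triangle thus gives a symmetric frame and an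
isosceles one a frame symmetric by pairs.

The scalar M: a³ - 6b² is twice the discriminant (d₀d₁d₂)², so M is a positive multiple of X² with X
= d₀d₁d₂ · conj b. The real part of X vanishes exactly for isosceles triangles and its imaginary
part exactly for flat ones. Hence M < 0 means isosceles and not flat, and among these M = -6 means a
= 0, that is, equilateral. A radiative field outside these types has a scalene triangle that is not
flat. Then M is not real, and the nine eigenvalues σᵢ conj σₖ of T
(`belRobinsonEigenvalues_ofSd_diagonal`) are distinct, only the three with i = k being real. -/

/-- The components of the tensor `W` in the basis formed by the columns of `L`. -/
def pull (L : Matrix (Fin 4) (Fin 4) ℝ) (W : Tensor4) : Tensor4 := fun a b c d =>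
  ∑ a', ∑ b', ∑ c', ∑ d', L a' a * L b' b * L c' c * L d' d * W a' b' c' d'

/-- The matrix of a tensor, for the pairing `(ab)(cd)` of the indices. -/
def flat (W : Tensor4) : Matrix (Fin 4 × Fin 4) (Fin 4 × Fin 4) ℝ :=
  Matrix.of fun P S => W P.1 P.2 S.1 S.2

/-- The matrix of a tensor, for the pairing `(ac)(bd)` of the indices. -/
def cross (W : Tensor4) : Matrix (Fin 4 × Fin 4) (Fin 4 × Fin 4) ℝ :=
  Matrix.of fun P S => W P.1 S.1 P.2 S.2

/-! ### Change of basis as a congruence of 16×16 matrices -/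

theorem flat_injective : Function.Injective flat := by
  intro W V h
  funext a b c d
  exact congrFun (congrFun h (a, b)) (c, d)

theorem cross_injective : Function.Injective cross := by
  intro W V h
  funext a b c d
  exact congrFun (congrFun h (a, c)) (b, d)

theorem flat_pull (L : Matrix (Fin 4) (Fin 4) ℝ) (W : Tensor4) :
    flat (pull L W) = (L ⊗ₖ L)ᵀ * flat W * (L ⊗ₖ L) := by
  ext ⟨a, b⟩ ⟨c, d⟩
  simp only [flat, pull, Matrix.mul_apply, Matrix.of_apply, Matrix.transpose_apply,
    Matrix.kroneckerMap_apply, Finset.sum_mul]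
  conv_rhs => rw [Finset.sum_comm]
  rw [Fintype.sum_prod_type]
  refine Finset.sum_congr rfl fun a' _ => Finset.sum_congr rfl fun b' _ => ?_
  rw [Fintype.sum_prod_type]
  refine Finset.sum_congr rfl fun c' _ => Finset.sum_congr rfl fun d' _ => ?_
  ring

theorem cross_pull (L : Matrix (Fin 4) (Fin 4) ℝ) (W : Tensor4) :
    cross (pull L W) = (L ⊗ₖ L)ᵀ * cross W * (L ⊗ₖ L) := by
  ext ⟨a, b⟩ ⟨c, d⟩
  simp only [cross, pull, Matrix.mul_apply, Matrix.of_apply, Matrix.transpose_apply,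
    Matrix.kroneckerMap_apply, Finset.sum_mul]
  conv_rhs => rw [Finset.sum_comm]
  rw [Fintype.sum_prod_type]
  refine Finset.sum_congr rfl fun a' _ => ?_
  rw [Finset.sum_comm]
  refine Finset.sum_congr rfl fun b' _ => ?_
  rw [Fintype.sum_prod_type]
  refine Finset.sum_congr rfl fun c' _ => Finset.sum_congr rfl fun d' _ => ?_
  ring

theorem pull_pull (L N : Matrix (Fin 4) (Fin 4) ℝ) (W : Tensor4) :
    pull N (pull L W) = pull (L * N) W := by
  apply flat_injective
  rw [flat_pull, flat_pull, flat_pull, Matrix.mul_kronecker_mul]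
  simp only [Matrix.transpose_mul, Matrix.mul_assoc]

theorem pull_one (W : Tensor4) : pull 1 W = W := by
  apply flat_injective
  rw [flat_pull]
  simp

/-! ### Covariance of the Hodge dual -/

/-- Both sides are the determinant of the columns a, b, c, d of L. Multilinear expansion of the rows
gives the contraction with `levi`, while factoring the matrix as a selection matrix times Lᵀ gives
`levi` times `L.det`. -/
theorem flat_levi_pull (L : Matrix (Fin 4) (Fin 4) ℝ) :
    pull L levi = fun a b c d => L.det * levi a b c d := by
  funext a b c d
  have h : ∀ v : Fin 4 → Fin 4, Matrix.det (Matrix.of fun i j : Fin 4 => L j (v i))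
      = ∑ a', ∑ b', ∑ c', ∑ d', L a' (v 0) * L b' (v 1) * L c' (v 2) * L d' (v 3) * levi a' b' c' d' := by
    intro v
    let D := (Matrix.detRowAlternating (R := ℝ) (n := Fin 4)).toMultilinearMap
    have h1 : Matrix.det (Matrix.of fun i j : Fin 4 => L j (v i))
        = D (fun i => ∑ j, L j (v i) • (Pi.single j (1 : ℝ) : Fin 4 → ℝ)) := by
      change Matrix.det _ = Matrix.det _
      congr 1
      ext i j
      simp [Finset.sum_apply, Pi.single_apply]
    rw [h1, MultilinearMap.map_sum]
    have h2 : ∀ r : Fin 4 → Fin 4, D (fun i => L (r i) (v i) • (Pi.single (r i) (1 : ℝ) : Fin 4 → ℝ))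
        = L (r 0) (v 0) * L (r 1) (v 1) * L (r 2) (v 2) * L (r 3) (v 3)
          * levi (r 0) (r 1) (r 2) (r 3) := by
      intro r
      rw [MultilinearMap.map_smul_univ, Fin.prod_univ_four, smul_eq_mul]
      congr 1
      change Matrix.det _ = Matrix.det _
      congr 1
      ext i j
      fin_cases i <;> simp only [Pi.single_apply, Matrix.of_apply, @eq_comm _ j] <;> congr
    simp only [h2]
    -- Peels the sum over index maps `Fin 4 → Fin 4` into four nested sums, one coordinate at a
    -- time.
    rw [← (Fin.consEquiv fun _ : Fin 4 => Fin 4).sum_comp, Fintype.sum_prod_type]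
    refine Finset.sum_congr rfl fun a' _ => ?_
    rw [← (Fin.consEquiv fun _ : Fin 3 => Fin 4).sum_comp, Fintype.sum_prod_type]
    refine Finset.sum_congr rfl fun b' _ => ?_
    rw [← (Fin.consEquiv fun _ : Fin 2 => Fin 4).sum_comp, Fintype.sum_prod_type]
    refine Finset.sum_congr rfl fun c' _ => ?_
    rw [← (Fin.consEquiv fun _ : Fin 1 => Fin 4).sum_comp, Fintype.sum_prod_type]
    refine Finset.sum_congr rfl fun d' _ => ?_
    rw [Fintype.sum_unique]
    rfl
  have h3 := h ![a, b, c, d]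
  simp only [pull]
  refine Eq.trans h3.symm ?_
  rw [levi, mul_comm, ← Matrix.det_transpose L, ← Matrix.det_mul]
  congr 1
  ext i j
  simp [Matrix.mul_apply]

theorem kronecker_inv_congr (G L : Matrix (Fin 4) (Fin 4) ℝ) :
    (Lᵀ * G * L)⁻¹ ⊗ₖ (Lᵀ * G * L)⁻¹
      = (L ⊗ₖ L)⁻¹ * (G⁻¹ ⊗ₖ G⁻¹) * ((L ⊗ₖ L)⁻¹)ᵀ := by
  rw [Matrix.mul_inv_rev, Matrix.mul_inv_rev, Matrix.mul_kronecker_mul, Matrix.mul_kronecker_mul,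
    Matrix.inv_kronecker, ← Matrix.kroneckerMap_transpose, Matrix.transpose_nonsing_inv]
  simp only [Matrix.mul_assoc]

theorem isUnit_kronecker_self {L : Matrix (Fin 4) (Fin 4) ℝ} (hL : L.det ≠ 0) :
    IsUnit (L ⊗ₖ L).det := by
  rw [Matrix.det_kronecker]
  exact (mul_ne_zero (pow_ne_zero _ hL) (pow_ne_zero _ hL)).isUnit

/-- The factor √|det G| scales by |det L| and the Levi-Civita symbol by det L. These agree because
the determinant is positive, which is why orientation enters everything built on the dual. -/
theorem volumeElement_pull (G : Matrix (Fin 4) (Fin 4) ℝ) {L : Matrix (Fin 4) (Fin 4) ℝ}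
    (hL : 0 < L.det) :
    volumeElement (Lᵀ * G * L) = pull L (volumeElement G) := by
  have h : pull L (volumeElement G) = fun a b c d => Real.sqrt |G.det| * pull L levi a b c d := by
    funext a b c d
    simp only [pull, volumeElement, Finset.mul_sum]
    refine Finset.sum_congr rfl fun _ _ => Finset.sum_congr rfl fun _ _ =>
      Finset.sum_congr rfl fun _ _ => Finset.sum_congr rfl fun _ _ => ?_
    ring
  rw [h, flat_levi_pull]
  funext a b c d
  simp only [volumeElement, Matrix.det_mul, Matrix.det_transpose]
  rw [show L.det * G.det * L.det = L.det ^ 2 * G.det by ring, abs_mul, abs_of_nonneg (sq_nonneg _),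
    Real.sqrt_mul (sq_nonneg _), Real.sqrt_sq hL.le]
  ring

theorem flat_hodge (G : Matrix (Fin 4) (Fin 4) ℝ) :
    flat (hodge G) = (1 / 2 : ℝ) • (flat (volumeElement G) * (G⁻¹ ⊗ₖ G⁻¹)) := by
  ext ⟨a, b⟩ ⟨c, d⟩
  simp only [flat, hodge, Matrix.mul_apply, Matrix.of_apply, Matrix.smul_apply, smul_eq_mul,
    Matrix.kroneckerMap_apply, Fintype.sum_prod_type, mul_assoc]

theorem flat_dualWeyl (G : Matrix (Fin 4) (Fin 4) ℝ) (W : Tensor4) :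
    flat (dualWeyl G W) = flat (hodge G) * flat W := by
  ext ⟨a, b⟩ ⟨c, d⟩
  simp only [flat, dualWeyl, Matrix.mul_apply, Matrix.of_apply, Fintype.sum_prod_type]

theorem flat_hodge_congr (G : Matrix (Fin 4) (Fin 4) ℝ) {L : Matrix (Fin 4) (Fin 4) ℝ}
    (hL : 0 < L.det) :
    flat (hodge (Lᵀ * G * L)) = (L ⊗ₖ L)ᵀ * flat (hodge G) * ((L ⊗ₖ L)⁻¹)ᵀ := by
  have hK := isUnit_kronecker_self hL.ne'
  rw [flat_hodge, flat_hodge, volumeElement_pull G hL, flat_pull, kronecker_inv_congr]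
  simp only [Matrix.mul_smul, Matrix.smul_mul, Matrix.mul_assoc]
  rw [Matrix.mul_nonsing_inv_cancel_left _ _ hK]

theorem transpose_inv_mul_cancel_left {n m : Type*} [Fintype n] [DecidableEq n]
    {K : Matrix n n ℝ} (hK : IsUnit K.det) (A : Matrix n m ℝ) : (K⁻¹)ᵀ * (Kᵀ * A) = A := by
  rw [← Matrix.mul_assoc, ← Matrix.transpose_mul, Matrix.mul_nonsing_inv _ hK]
  simp

theorem dualWeyl_pull (G : Matrix (Fin 4) (Fin 4) ℝ) {L : Matrix (Fin 4) (Fin 4) ℝ}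
    (hL : 0 < L.det) (W : Tensor4) :
    dualWeyl (Lᵀ * G * L) (pull L W) = pull L (dualWeyl G W) := by
  have hK := isUnit_kronecker_self hL.ne'
  apply flat_injective
  rw [flat_dualWeyl, flat_hodge_congr G hL, flat_pull, flat_pull, flat_dualWeyl]
  simp only [Matrix.mul_assoc]
  rw [transpose_inv_mul_cancel_left hK]

/-- In the pairing (ac)(bd) the double contraction defining T is a product of three matrices, so its
covariance is again matrix algebra. -/
theorem cross_belRobinson (G : Matrix (Fin 4) (Fin 4) ℝ) (W : Tensor4) :
    cross (belRobinson G W) = (1 / 4 : ℝ) •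
      (cross W * (G⁻¹ ⊗ₖ G⁻¹) * (cross W)ᵀ
        + cross (dualWeyl G W) * (G⁻¹ ⊗ₖ G⁻¹) * (cross (dualWeyl G W))ᵀ) := by
  ext ⟨a, b⟩ ⟨m, n⟩
  simp only [cross, belRobinson, Matrix.mul_apply, Matrix.of_apply, Matrix.smul_apply,
    Matrix.add_apply, smul_eq_mul, Matrix.transpose_apply, Matrix.kroneckerMap_apply,
    Fintype.sum_prod_type, Finset.sum_mul]
  simp only [← Finset.sum_add_distrib]
  congr 1
  refine Finset.sum_congr rfl fun _ _ => Finset.sum_congr rfl fun _ _ =>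
      Finset.sum_congr rfl fun _ _ => Finset.sum_congr rfl fun _ _ => ?_
  ring

theorem belRobinson_pull (G : Matrix (Fin 4) (Fin 4) ℝ) {L : Matrix (Fin 4) (Fin 4) ℝ}
    (hL : 0 < L.det) (W : Tensor4) :
    belRobinson (Lᵀ * G * L) (pull L W) = pull L (belRobinson G W) := by
  have hK := isUnit_kronecker_self hL.ne'
  apply cross_injective
  rw [cross_belRobinson, dualWeyl_pull G hL, cross_pull, cross_pull, cross_pull, cross_belRobinson,
    kronecker_inv_congr]
  simp only [Matrix.transpose_mul, Matrix.transpose_transpose, Matrix.mul_assoc, Matrix.mul_smul,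
    Matrix.smul_mul, Matrix.mul_add, Matrix.add_mul]
  rw [Matrix.mul_nonsing_inv_cancel_left _ _ hK, transpose_inv_mul_cancel_left hK,
    Matrix.mul_nonsing_inv_cancel_left _ _ hK, transpose_inv_mul_cancel_left hK]

/-! ### Evaluation of tensors on vectors -/

/-- The value of a covariant tensor on four vectors. -/
def eval4 (T : Tensor4) (x y z w : Fin 4 → ℝ) : ℝ :=
  ∑ a, ∑ b, ∑ c, ∑ d, x a * y b * z c * w d * T a b c d

/-- The components of `x ⊗ y`. -/
def tensorVec (x y : Fin 4 → ℝ) : Fin 4 × Fin 4 → ℝ := fun P => x P.1 * y P.2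

theorem kronecker_mulVec_tensorVec (L : Matrix (Fin 4) (Fin 4) ℝ) (x y : Fin 4 → ℝ) :
    (L ⊗ₖ L) *ᵥ tensorVec x y = tensorVec (L *ᵥ x) (L *ᵥ y) := by
  ext ⟨a, b⟩
  simp only [Matrix.mulVec, dotProduct, tensorVec, Matrix.kroneckerMap_apply, Fintype.sum_prod_type,
    Finset.sum_mul_sum]
  refine Finset.sum_congr rfl fun _ _ => Finset.sum_congr rfl fun _ _ => ?_
  ring

theorem eval4_eq (T : Tensor4) (x y z w : Fin 4 → ℝ) :
    eval4 T x y z w = tensorVec x y ⬝ᵥ flat T *ᵥ tensorVec z w := by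
  simp only [eval4, Matrix.mulVec, dotProduct, tensorVec, Fintype.sum_prod_type, flat,
    Matrix.of_apply, Finset.mul_sum]
  refine Finset.sum_congr rfl fun _ _ => Finset.sum_congr rfl fun _ _ =>
      Finset.sum_congr rfl fun _ _ => Finset.sum_congr rfl fun _ _ => ?_
  ring

theorem eval4_pull (L : Matrix (Fin 4) (Fin 4) ℝ) (T : Tensor4) (x y z w : Fin 4 → ℝ) :
    eval4 (pull L T) x y z w = eval4 T (L *ᵥ x) (L *ᵥ y) (L *ᵥ z) (L *ᵥ w) := by
  rw [eval4_eq, eval4_eq, flat_pull, ← kronecker_mulVec_tensorVec, ← kronecker_mulVec_tensorVec,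
    ← Matrix.mulVec_mulVec, ← Matrix.mulVec_mulVec, Matrix.dotProduct_mulVec,
    Matrix.vecMul_transpose]

theorem metricProduct_eq (G : Matrix (Fin 4) (Fin 4) ℝ) (v w : Fin 4 → ℝ) :
    metricProduct G v w = v ⬝ᵥ G *ᵥ w := by
  simp only [metricProduct, Matrix.mulVec, dotProduct, Finset.mul_sum]
  refine Finset.sum_congr rfl fun _ _ => Finset.sum_congr rfl fun _ _ => ?_
  ring

theorem metricProduct_congr (G L : Matrix (Fin 4) (Fin 4) ℝ) (v w : Fin 4 → ℝ) :
    metricProduct (Lᵀ * G * L) v w = metricProduct G (L *ᵥ v) (L *ᵥ w) := by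
  rw [metricProduct_eq, metricProduct_eq, ← Matrix.mulVec_mulVec, ← Matrix.mulVec_mulVec,
    Matrix.dotProduct_mulVec, Matrix.vecMul_transpose]

theorem isObserver_congr (G L : Matrix (Fin 4) (Fin 4) ℝ) (v : Fin 4 → ℝ) :
    IsObserver (Lᵀ * G * L) v ↔ IsObserver G (L *ᵥ v) := by
  rw [IsObserver, IsObserver, metricProduct_congr]

theorem metricProduct_comm {G : Matrix (Fin 4) (Fin 4) ℝ} (hG : Gᵀ = G) (v w : Fin 4 → ℝ) :
    metricProduct G v w = metricProduct G w v := by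
  rw [metricProduct_eq, metricProduct_eq, Matrix.dotProduct_mulVec, ← Matrix.mulVec_transpose, hG,
    dotProduct_comm]

theorem sum_lower (G : Matrix (Fin 4) (Fin 4) ℝ) (v x : Fin 4 → ℝ) :
    ∑ a, x a * lower G v a = metricProduct G x v := by
  rw [metricProduct_eq]
  rfl

theorem eval4_single (T : Tensor4) (a b c d : Fin 4) :
    eval4 T (Pi.single a 1) (Pi.single b 1) (Pi.single c 1) (Pi.single d 1) = T a b c d := by
  simp only [eval4, Pi.single_apply, ite_mul, mul_ite, one_mul, mul_one, zero_mul, mul_zero,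
    Finset.sum_ite_eq', Finset.mem_univ, if_true]

theorem sum_mul_comm_aux (x : Fin 4 → ℝ) (f : Fin 4 → Fin 4 → ℝ) (c : Fin 4 → ℝ) :
    ∑ a', (∑ a, x a * f a a') * c a' = ∑ a, x a * ∑ a', f a a' * c a' := by
  simp only [Finset.sum_mul, Finset.mul_sum]
  rw [Finset.sum_comm]
  simp only [mul_assoc]

theorem eval4_sum₁ (T : Tensor4) (s : Fin 4 → ℝ) (f : Fin 4 → Fin 4 → ℝ) (y z w : Fin 4 → ℝ) :
    eval4 T (fun a' => ∑ a, s a * f a a') y z w = ∑ a, s a * eval4 T (f a) y z w := by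
  have h : ∀ x, eval4 T x y z w
      = ∑ a, x a * ∑ b, ∑ c, ∑ d, y b * z c * w d * T a b c d := by
    intro x
    simp only [eval4, Finset.mul_sum, mul_assoc]
  simp only [h, sum_mul_comm_aux]

theorem eval4_sum₂ (T : Tensor4) (s : Fin 4 → ℝ) (f : Fin 4 → Fin 4 → ℝ) (x z w : Fin 4 → ℝ) :
    eval4 T x (fun a' => ∑ a, s a * f a a') z w = ∑ a, s a * eval4 T x (f a) z w := by
  have h : ∀ y, eval4 T x y z w
      = ∑ b, y b * ∑ a, ∑ c, ∑ d, x a * z c * w d * T a b c d := by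
    intro y
    simp only [eval4, Finset.mul_sum]
    rw [Finset.sum_comm]
    refine Finset.sum_congr rfl fun _ _ => Finset.sum_congr rfl fun _ _ =>
      Finset.sum_congr rfl fun _ _ => Finset.sum_congr rfl fun _ _ => ?_
    ring
  simp only [h, sum_mul_comm_aux]

theorem eval4_sum₃ (T : Tensor4) (s : Fin 4 → ℝ) (f : Fin 4 → Fin 4 → ℝ) (x y w : Fin 4 → ℝ) :
    eval4 T x y (fun a' => ∑ a, s a * f a a') w = ∑ a, s a * eval4 T x y (f a) w := by
  have h : ∀ z, eval4 T x y z w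
      = ∑ c, z c * ∑ a, ∑ b, ∑ d, x a * y b * w d * T a b c d := by
    intro z
    simp only [eval4, Finset.mul_sum]
    conv_lhs => enter [2, a]; rw [Finset.sum_comm]
    rw [Finset.sum_comm]
    refine Finset.sum_congr rfl fun _ _ => Finset.sum_congr rfl fun _ _ =>
      Finset.sum_congr rfl fun _ _ => Finset.sum_congr rfl fun _ _ => ?_
    ring
  simp only [h, sum_mul_comm_aux]

/-- The stress flux vanishes when the Bel-Robinson tensor does on three vectors orthogonal to the
observer and on the observer. -/
theorem stressFlux_eq_zero_iff (G : Matrix (Fin 4) (Fin 4) ℝ) (W : Tensor4)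
    {u : Fin 4 → ℝ} (hu : IsObserver G u) :
    stressFlux G W u = 0 ↔ ∀ x y z : Fin 4 → ℝ, metricProduct G x u = 0 → metricProduct G y u = 0 →
      metricProduct G z u = 0 → eval4 (belRobinson G W) x y z u = 0 := by
  have hs : ∀ a b c, stressFlux G W u a b c = -eval4 (belRobinson G W) (fun a' => projector G u a' a)
      (fun a' => projector G u a' b) (fun a' => projector G u a' c) u := by
    intro a b c
    simp only [stressFlux, eval4, Finset.mul_sum]
    congr 1
    refine Finset.sum_congr rfl fun _ _ => Finset.sum_congr rfl fun _ _ =>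
      Finset.sum_congr rfl fun _ _ => Finset.sum_congr rfl fun _ _ => ?_
    ring
  constructor
  · intro h x y z hx hy hz
    -- The projector fixes vectors orthogonal to u, so contracting the flux with such vectors
    -- evaluates T on them.
    have hproj : ∀ x : Fin 4 → ℝ, metricProduct G x u = 0 →
        ∀ a', ∑ a, x a * projector G u a' a = x a' := by
      intro x hx a'
      have : ∀ a, x a * projector G u a' a = (if a' = a then x a else 0) + u a' * (x a * lower G u a) := by
        intro a
        rw [projector]
        split_ifs <;> ring
      simp only [this, Finset.sum_add_distrib, ← Finset.mul_sum, sum_lower, hx]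
      simp
    have h1 : ∑ a, ∑ b, ∑ c, x a * y b * z c * stressFlux G W u a b c = 0 := by
      simp [h]
    have h2 : ∑ a, ∑ b, ∑ c, x a * y b * z c * stressFlux G W u a b c
        = -eval4 (belRobinson G W) (fun a' => ∑ a, x a * projector G u a' a)
          (fun a' => ∑ a, y a * projector G u a' a) (fun a' => ∑ a, z a * projector G u a' a) u := by
      rw [eval4_sum₁]
      simp only [eval4_sum₂]
      simp only [eval4_sum₃, hs, Finset.mul_sum, ← Finset.sum_neg_distrib]
      refine Finset.sum_congr rfl fun _ _ => Finset.sum_congr rfl fun _ _ =>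
        Finset.sum_congr rfl fun _ _ => ?_
      ring
    rw [h1] at h2
    rw [funext (hproj x hx), funext (hproj y hy), funext (hproj z hz)] at h2
    linarith
  · intro h
    funext a b c
    rw [hs]
    have : ∀ a, metricProduct G (fun a' => projector G u a' a) u = 0 := by
      intro a
      rw [← sum_lower]
      simp only [projector, add_mul, Finset.sum_add_distrib, ite_mul, one_mul, zero_mul,
        Finset.sum_ite_eq', Finset.mem_univ, if_true]
      have h3 : ∀ x, u x * lower G u a * lower G u x = lower G u a * (u x * lower G u x) :=
        fun x => by ring
      simp only [h3, ← Finset.mul_sum, sum_lower]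
      rw [show metricProduct G u u = -1 from hu]
      ring
    simp [h _ _ _ (this a) (this b) (this c)]

theorem pull_congr_inv {L : Matrix (Fin 4) (Fin 4) ℝ} (hL : 0 < L.det)
    (G : Matrix (Fin 4) (Fin 4) ℝ) (W : Tensor4) :
    (L⁻¹)ᵀ * (Lᵀ * G * L) * L⁻¹ = G ∧ pull L⁻¹ (pull L W) = W := by
  have h := hL.ne'.isUnit
  constructor
  · simp only [Matrix.mul_assoc]
    rw [transpose_inv_mul_cancel_left h, Matrix.mul_nonsing_inv _ h, Matrix.mul_one]
  · rw [pull_pull, Matrix.mul_nonsing_inv _ h, pull_one]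

theorem isSuperEnergyRadiative_congr {G : Matrix (Fin 4) (Fin 4) ℝ} {L : Matrix (Fin 4) (Fin 4) ℝ}
    (hL : 0 < L.det) (W : Tensor4) :
    IsSuperEnergyRadiative (Lᵀ * G * L) (pull L W) ↔ IsSuperEnergyRadiative G W := by
  have h := hL.ne'.isUnit
  have hinv : ∀ x, L *ᵥ (L⁻¹ *ᵥ x) = x := fun x => by
    rw [Matrix.mulVec_mulVec, Matrix.mul_nonsing_inv _ h, Matrix.one_mulVec]
  have key : ∀ u, IsObserver (Lᵀ * G * L) u →
      (stressFlux (Lᵀ * G * L) (pull L W) u = 0 ↔ stressFlux G W (L *ᵥ u) = 0) := by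
    intro u hu
    rw [stressFlux_eq_zero_iff _ _ hu, stressFlux_eq_zero_iff _ _ ((isObserver_congr _ _ _).1 hu),
      belRobinson_pull G hL]
    simp only [metricProduct_congr, eval4_pull]
    constructor
    · intro H x y z hx hy hz
      have := H (L⁻¹ *ᵥ x) (L⁻¹ *ᵥ y) (L⁻¹ *ᵥ z)
      simp only [hinv] at this
      exact this hx hy hz
    · exact fun H x y z => H _ _ _
  constructor
  · intro H u hu
    have hu' : IsObserver (Lᵀ * G * L) (L⁻¹ *ᵥ u) := by
      rw [isObserver_congr, hinv]; exact hu
    have := H _ hu'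
    rwa [Ne, key _ hu', hinv] at this
  · intro H u hu
    rw [Ne, key u hu]
    exact H _ ((isObserver_congr _ _ _).1 hu)

theorem eval4_swap_left (T : Tensor4) (x y z w : Fin 4 → ℝ) :
    eval4 (fun a b c d => T b a c d) x y z w = eval4 T y x z w := by
  simp only [eval4]
  rw [Finset.sum_comm]
  simp only [mul_comm (x _) (y _)]

theorem eval4_swap_right (T : Tensor4) (x y z w : Fin 4 → ℝ) :
    eval4 (fun a b c d => T a b d c) x y z w = eval4 T x y w z := by
  simp only [eval4]
  refine Finset.sum_congr rfl fun _ _ => Finset.sum_congr rfl fun _ _ => ?_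
  rw [Finset.sum_comm]
  refine Finset.sum_congr rfl fun _ _ => Finset.sum_congr rfl fun _ _ => ?_
  ring

theorem eval4_mul (p q : Fin 4 → ℝ) (C : Fin 4 → Fin 4 → ℝ) (x y z w : Fin 4 → ℝ) :
    eval4 (fun a b c d => p a * C b c * q d) x y z w
      = (∑ a, x a * p a) * (∑ b, ∑ c, y b * z c * C b c) * ∑ d, w d * q d := by
  have h : ∀ a b c d, x a * y b * z c * w d * (p a * C b c * q d)
      = (x a * p a) * (y b * z c * C b c) * (w d * q d) := fun a b c d => by ring
  simp only [eval4, h, ← Finset.mul_sum, ← Finset.sum_mul]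

theorem eval4_eq_zero_iff (T : Tensor4) :
    (∀ a b c d, T a b c d = 0) ↔ ∀ x y z w, eval4 T x y z w = 0 := by
  constructor
  · intro h x y z w
    simp [eval4, h]
  · intro h a b c d
    rw [← eval4_single T, h]

/-- Contracting the four free indices with arbitrary vectors gives a form of the condition that is
visibly independent of the basis. -/
theorem isDebever_iff {G : Matrix (Fin 4) (Fin 4) ℝ} (W : Tensor4) (k : Fin 4 → ℝ) :
    IsDebever G W k ↔ k ≠ 0 ∧ metricProduct G k k = 0 ∧ ∀ x y z w : Fin 4 → ℝ,
      metricProduct G x k * eval4 W y k k z * metricProduct G w k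
      - metricProduct G y k * eval4 W x k k z * metricProduct G w k
      - metricProduct G x k * eval4 W y k k w * metricProduct G z k
      + metricProduct G y k * eval4 W x k k w * metricProduct G z k = 0 := by
  have hC : ∀ y z, eval4 W y k k z = ∑ b, ∑ e, y b * z e * ∑ c, ∑ d, k c * k d * W b c d e := by
    intro y z
    simp only [eval4, Finset.mul_sum]
    refine Finset.sum_congr rfl fun _ _ => ?_
    conv_lhs => enter [2, a]; rw [Finset.sum_comm]
    rw [Finset.sum_comm]
    refine Finset.sum_congr rfl fun _ _ => Finset.sum_congr rfl fun _ _ =>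
      Finset.sum_congr rfl fun _ _ => ?_
    ring
  have hD : ∀ a b e f, ∑ c, ∑ d, k c * k d *
      (lower G k a * W b c d e * lower G k f - lower G k b * W a c d e * lower G k f
        - lower G k a * W b c d f * lower G k e + lower G k b * W a c d f * lower G k e)
      = lower G k a * (∑ c, ∑ d, k c * k d * W b c d e) * lower G k f
        - lower G k b * (∑ c, ∑ d, k c * k d * W a c d e) * lower G k f
        - lower G k a * (∑ c, ∑ d, k c * k d * W b c d f) * lower G k e
        + lower G k b * (∑ c, ∑ d, k c * k d * W a c d f) * lower G k e := by
    intro a b e f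
    simp only [Finset.mul_sum, Finset.sum_mul, ← Finset.sum_add_distrib, ← Finset.sum_sub_distrib]
    refine Finset.sum_congr rfl fun _ _ => Finset.sum_congr rfl fun _ _ => ?_
    ring
  rw [IsDebever]
  refine and_congr_right fun _ => and_congr_right fun _ => ?_
  simp only [hD, hC]
  rw [eval4_eq_zero_iff (fun a b e f =>
        lower G k a * (∑ c, ∑ d, k c * k d * W b c d e) * lower G k f
        - lower G k b * (∑ c, ∑ d, k c * k d * W a c d e) * lower G k f
        - lower G k a * (∑ c, ∑ d, k c * k d * W b c d f) * lower G k e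
        + lower G k b * (∑ c, ∑ d, k c * k d * W a c d f) * lower G k e)]
  refine forall_congr' fun x => forall_congr' fun y => forall_congr' fun z => forall_congr' fun w => ?_
  set C : Fin 4 → Fin 4 → ℝ := fun b e => ∑ c, ∑ d, k c * k d * W b c d e with hCdef
  -- All four terms of the antisymmetrised expression are index swaps of this one tensor, and
  -- swapping indices permutes the arguments of `eval4`.
  let T : Tensor4 := fun a b e f => lower G k a * C b e * lower G k f
  have h1 := eval4_mul (lower G k) (lower G k) C
  have h2 : ∀ x y z w, eval4 T x y z w = _ := h1
  have h3 := eval4_swap_left T x y z w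
  have h4 := eval4_swap_right T x y z w
  have h5 := eval4_swap_right (fun a b c d => T b a c d) x y z w
  rw [show eval4 (fun a b c d => T b a c d) x y w z = _ from eval4_swap_left T x y w z] at h5
  simp only [h2, sum_lower] at h3 h4 h5
  have h6 : eval4 (fun a b e f => lower G k a * C b e * lower G k f
      - lower G k b * C a e * lower G k f - lower G k a * C b f * lower G k e
      + lower G k b * C a f * lower G k e) x y z w
      = eval4 T x y z w - eval4 (fun a b c d => T b a c d) x y z w
        - eval4 (fun a b c d => T a b d c) x y z w + eval4 (fun a b c d => T b a d c) x y z w := by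
    simp only [eval4, T, ← Finset.sum_add_distrib, ← Finset.sum_sub_distrib, mul_add, mul_sub]
  rw [h6, h3, h4, h5, h2, sum_lower, sum_lower]

theorem isDebever_congr {G L : Matrix (Fin 4) (Fin 4) ℝ} (hL : L.det ≠ 0) (W : Tensor4)
    (k : Fin 4 → ℝ) : IsDebever (Lᵀ * G * L) (pull L W) k ↔ IsDebever G W (L *ᵥ k) := by
  have hinv : ∀ x, L *ᵥ (L⁻¹ *ᵥ x) = x := fun x => by
    rw [Matrix.mulVec_mulVec, Matrix.mul_nonsing_inv _ hL.isUnit, Matrix.one_mulVec]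
  have hinj : k = 0 ↔ L *ᵥ k = 0 := by
    constructor
    · rintro rfl; simp
    · exact fun h => Matrix.eq_zero_of_mulVec_eq_zero hL h
  rw [isDebever_iff, isDebever_iff, Ne, Ne, ← hinj]
  simp only [metricProduct_congr, eval4_pull]
  refine and_congr_right fun _ => and_congr_right fun _ => ?_
  constructor
  · intro H x y z w
    have := H (L⁻¹ *ᵥ x) (L⁻¹ *ᵥ y) (L⁻¹ *ᵥ z) (L⁻¹ *ᵥ w)
    simpa only [hinv] using this
  · exact fun H x y z w => H _ _ _ _

/-! ### Covariance of the spectra -/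

/-- The complexification of a real matrix. -/
noncomputable abbrev cplx {m n : Type*} (A : Matrix m n ℝ) : Matrix m n ℂ := A.map (algebraMap ℝ ℂ)

theorem cplx_mul {l m n : Type*} [Fintype m] (A : Matrix l m ℝ) (B : Matrix m n ℝ) :
    cplx (A * B) = cplx A * cplx B := Matrix.map_mul

theorem cplx_transpose {m n : Type*} (A : Matrix m n ℝ) : cplx Aᵀ = (cplx A)ᵀ := rfl

theorem cplx_transpose_mul_inv {n : Type*} [Fintype n] [DecidableEq n] {K : Matrix n n ℝ}
    (hK : IsUnit K.det) : (cplx K⁻¹)ᵀ * (cplx K)ᵀ = 1 := by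
  rw [← Matrix.transpose_mul, ← cplx_mul, Matrix.mul_nonsing_inv _ hK]
  simp

theorem weylEndo_eq (G : Matrix (Fin 4) (Fin 4) ℝ) (W : Tensor4) :
    weylEndo G W = (1 / 4 : ℂ) • ((cplx (flat W) - Complex.I • cplx (flat (dualWeyl G W)))
      * cplx (G⁻¹ ⊗ₖ G⁻¹)) := by
  ext ⟨a, b⟩ ⟨c, d⟩
  simp only [weylEndo, flat, Matrix.mul_apply, Matrix.of_apply, Matrix.smul_apply, Matrix.sub_apply,
    Matrix.map_apply, smul_eq_mul, Matrix.kroneckerMap_apply, Fintype.sum_prod_type, Finset.mul_sum,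
    Complex.coe_algebraMap, Complex.ofReal_mul]
  refine Finset.sum_congr rfl fun _ _ => Finset.sum_congr rfl fun _ _ => ?_
  ring

theorem weylEndo_pull (G : Matrix (Fin 4) (Fin 4) ℝ) {L : Matrix (Fin 4) (Fin 4) ℝ}
    (hL : 0 < L.det) (W : Tensor4) :
    weylEndo (Lᵀ * G * L) (pull L W)
      = (cplx (L ⊗ₖ L))ᵀ * weylEndo G W * (cplx (L ⊗ₖ L)⁻¹)ᵀ := by
  have hK := isUnit_kronecker_self hL.ne'
  have h1 : cplx (L ⊗ₖ L) * cplx (L ⊗ₖ L)⁻¹ = 1 := by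
    rw [← cplx_mul, Matrix.mul_nonsing_inv _ hK]; simp
  rw [weylEndo_eq, weylEndo_eq, dualWeyl_pull G hL, flat_pull, flat_pull, kronecker_inv_congr]
  simp only [cplx_mul, Matrix.mul_smul, Matrix.smul_mul, Matrix.mul_assoc, Matrix.mul_sub,
    Matrix.sub_mul, cplx_transpose]
  simp only [← Matrix.mul_assoc (cplx (L ⊗ₖ L)) (cplx (L ⊗ₖ L)⁻¹), h1, Matrix.one_mul]

theorem conj_pow {n : Type*} [Fintype n] [DecidableEq n] {P R A : Matrix n n ℂ} (h : R * P = 1)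
    (k : ℕ) : (P * A * R) ^ (k + 1) = P * A ^ (k + 1) * R := by
  induction k with
  | zero => simp
  | succ k ih =>
    rw [pow_succ, ih, pow_succ A (k + 1)]
    calc _ = P * A ^ (k + 1) * (R * P) * A * R := by simp only [Matrix.mul_assoc]
      _ = _ := by rw [h]; simp only [Matrix.mul_assoc, Matrix.one_mul]

theorem trace_weylEndo_pow_pull (G : Matrix (Fin 4) (Fin 4) ℝ) {L : Matrix (Fin 4) (Fin 4) ℝ}
    (hL : 0 < L.det) (W : Tensor4) (k : ℕ) :
    (weylEndo (Lᵀ * G * L) (pull L W) ^ (k + 1)).trace = (weylEndo G W ^ (k + 1)).trace := by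
  have hK := isUnit_kronecker_self hL.ne'
  rw [weylEndo_pull G hL, conj_pow (cplx_transpose_mul_inv hK), Matrix.trace_mul_comm,
    ← Matrix.mul_assoc, cplx_transpose_mul_inv hK, Matrix.one_mul]

theorem weylA_pull (G : Matrix (Fin 4) (Fin 4) ℝ) {L : Matrix (Fin 4) (Fin 4) ℝ}
    (hL : 0 < L.det) (W : Tensor4) : weylA (Lᵀ * G * L) (pull L W) = weylA G W :=
  trace_weylEndo_pow_pull G hL W 1

theorem weylB_pull (G : Matrix (Fin 4) (Fin 4) ℝ) {L : Matrix (Fin 4) (Fin 4) ℝ}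
    (hL : 0 < L.det) (W : Tensor4) : weylB (Lᵀ * G * L) (pull L W) = weylB G W :=
  trace_weylEndo_pow_pull G hL W 2

theorem kronecker_transpose_mulVec (L : Matrix (Fin 4) (Fin 4) ℝ) (A : Fin 4 × Fin 4 → ℂ)
    (a b : Fin 4) : ((cplx (L ⊗ₖ L))ᵀ *ᵥ A) (a, b)
      = ((cplx L)ᵀ * (Matrix.of fun i j => A (i, j)) * cplx L) a b := by
  simp only [Matrix.mulVec, dotProduct, Matrix.mul_apply, Matrix.transpose_apply, Matrix.map_apply,
    Matrix.of_apply, Matrix.kroneckerMap_apply, Fintype.sum_prod_type, Finset.sum_mul,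
    Complex.coe_algebraMap, Complex.ofReal_mul]
  rw [Finset.sum_comm]
  refine Finset.sum_congr rfl fun _ _ => Finset.sum_congr rfl fun _ _ => ?_
  ring

theorem isSelfDualBivector_iff (G : Matrix (Fin 4) (Fin 4) ℝ) (F : Fin 4 × Fin 4 → ℂ) :
    IsSelfDualBivector G F ↔ (Matrix.of fun i j => F (i, j))ᵀ = -(Matrix.of fun i j => F (i, j)) ∧
      cplx (flat (hodge G)) *ᵥ F = Complex.I • F := by
  constructor
  · rintro ⟨h1, h2⟩
    constructor
    · ext i j
      exact h1 j i
    · ext ⟨a, b⟩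
      rw [← sub_eq_zero]
      have := h2 a b
      simp only [Matrix.mulVec, dotProduct, Fintype.sum_prod_type, Matrix.map_apply, flat,
        Matrix.of_apply, Complex.coe_algebraMap, this]
      simp
  · rintro ⟨h1, h2⟩
    constructor
    · intro a b
      exact congrFun (congrFun h1 b) a
    · intro a b
      have := congrFun h2 (a, b)
      simpa only [Matrix.mulVec, dotProduct, Fintype.sum_prod_type, Matrix.map_apply, flat,
        Matrix.of_apply, Complex.coe_algebraMap, Pi.smul_apply, smul_eq_mul] using this

theorem IsWeylEigenvalue.pull {G : Matrix (Fin 4) (Fin 4) ℝ} {W : Tensor4} {ρ : ℂ}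
    (h : IsWeylEigenvalue G W ρ) {L : Matrix (Fin 4) (Fin 4) ℝ} (hL : 0 < L.det) :
    IsWeylEigenvalue (Lᵀ * G * L) (pull L W) ρ := by
  have hK := isUnit_kronecker_self hL.ne'
  obtain ⟨F, hF, hsd, hW⟩ := h
  rw [isSelfDualBivector_iff] at hsd
  have hc : ∀ F : Fin 4 × Fin 4 → ℂ, (cplx (L ⊗ₖ L)⁻¹)ᵀ *ᵥ ((cplx (L ⊗ₖ L))ᵀ *ᵥ F) = F := by
    intro F
    rw [Matrix.mulVec_mulVec, cplx_transpose_mul_inv hK, Matrix.one_mulVec]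
  refine ⟨(cplx (L ⊗ₖ L))ᵀ *ᵥ F, ?_, ?_, ?_⟩
  · intro h0
    apply hF
    rw [← hc F, h0, Matrix.mulVec_zero]
  · rw [isSelfDualBivector_iff]
    constructor
    · have : (Matrix.of fun i j => ((cplx (L ⊗ₖ L))ᵀ *ᵥ F) (i, j))
          = (cplx L)ᵀ * (Matrix.of fun i j => F (i, j)) * cplx L := by
        ext a b
        exact kronecker_transpose_mulVec L F a b
      rw [this, Matrix.transpose_mul, Matrix.transpose_mul, hsd.1]
      simp only [Matrix.transpose_transpose, Matrix.mul_assoc, Matrix.neg_mul, Matrix.mul_neg]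
    · rw [flat_hodge_congr G hL, cplx_mul, cplx_mul, ← Matrix.mulVec_mulVec, ← Matrix.mulVec_mulVec]
      rw [cplx_transpose, cplx_transpose, hc F, hsd.2, Matrix.mulVec_smul]
  · rw [weylEndo_pull G hL, ← Matrix.mulVec_mulVec, ← Matrix.mulVec_mulVec, hc, hW,
      Matrix.mulVec_smul]

theorem isWeylEigenvalue_pull {G : Matrix (Fin 4) (Fin 4) ℝ} {W : Tensor4} {ρ : ℂ}
    {L : Matrix (Fin 4) (Fin 4) ℝ} (hL : 0 < L.det) :
    IsWeylEigenvalue (Lᵀ * G * L) (SuperEnergy.pull L W) ρ ↔ IsWeylEigenvalue G W ρ := by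
  refine ⟨fun h => ?_, fun h => h.pull hL⟩
  have h' := h.pull (L := L⁻¹) (by rw [Matrix.det_nonsing_inv]; simpa using hL)
  rwa [(pull_congr_inv hL G W).1, (pull_congr_inv hL G W).2] at h'

theorem mem_belRobinsonEigenvalues_iff (G : Matrix (Fin 4) (Fin 4) ℝ) (W : Tensor4) (t : ℂ) :
    t ∈ belRobinsonEigenvalues G W ↔ ∃ A : Fin 4 × Fin 4 → ℂ, A ≠ 0 ∧
      (Matrix.of fun i j => A (i, j))ᵀ = Matrix.of (fun i j => A (i, j)) ∧
      (cplx G⁻¹ * (Matrix.of fun i j => A (i, j))ᵀ).trace = 0 ∧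
      (cplx (flat (belRobinson G W)) * cplx (G⁻¹ ⊗ₖ G⁻¹)) *ᵥ A = t • A := by
  have hT : ∀ A : Fin 4 × Fin 4 → ℂ, ∀ a b,
      ((cplx (flat (belRobinson G W)) * cplx (G⁻¹ ⊗ₖ G⁻¹)) *ᵥ A) (a, b)
      = ∑ c, ∑ d, (∑ e, ∑ f, belRobinson G W a b e f * G⁻¹ e c * G⁻¹ f d : ℝ) * A (c, d) := by
    intro A a b
    rw [← cplx_mul]
    simp only [Matrix.mulVec, dotProduct, Matrix.mul_apply, Matrix.map_apply, flat,
      Matrix.of_apply, Matrix.kroneckerMap_apply, Fintype.sum_prod_type, mul_assoc,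
      Complex.coe_algebraMap]
  constructor
  · rintro ⟨A, h0, hs, htr, hA⟩
    refine ⟨fun P => A P.1 P.2, ?_, ?_, ?_, ?_⟩
    · intro h
      apply h0
      funext a b
      exact congrFun h (a, b)
    · ext a b
      exact hs b a
    · rw [← htr]
      simp only [Matrix.trace, Matrix.diag, Matrix.mul_apply, Matrix.map_apply,
        Matrix.transpose_apply, Matrix.of_apply, Complex.coe_algebraMap]
    · ext ⟨a, b⟩
      rw [hT]
      exact hA a b
  · rintro ⟨A, h0, hs, htr, hA⟩
    refine ⟨fun a b => A (a, b), ?_, ?_, ?_, ?_⟩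
    · intro h
      apply h0
      funext P
      exact congrFun (congrFun h P.1) P.2
    · intro a b
      exact congrFun (congrFun hs b) a
    · rw [← htr]
      simp only [Matrix.trace, Matrix.diag, Matrix.mul_apply, Matrix.map_apply,
        Matrix.transpose_apply, Matrix.of_apply, Complex.coe_algebraMap]
    · intro a b
      rw [← hT, hA]
      rfl

theorem belRobinsonEigenvalues_subset_pull {G : Matrix (Fin 4) (Fin 4) ℝ} {W : Tensor4}
    {L : Matrix (Fin 4) (Fin 4) ℝ} (hL : 0 < L.det) :
    belRobinsonEigenvalues G W ⊆ belRobinsonEigenvalues (Lᵀ * G * L) (pull L W) := by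
  intro t ht
  have hK := isUnit_kronecker_self hL.ne'
  rw [mem_belRobinsonEigenvalues_iff] at ht ⊢
  obtain ⟨A, h0, hs, htr, hA⟩ := ht
  have hc : ∀ F : Fin 4 × Fin 4 → ℂ, (cplx (L ⊗ₖ L)⁻¹)ᵀ *ᵥ ((cplx (L ⊗ₖ L))ᵀ *ᵥ F) = F := by
    intro F
    rw [Matrix.mulVec_mulVec, cplx_transpose_mul_inv hK, Matrix.one_mulVec]
  have hmat : (Matrix.of fun i j => ((cplx (L ⊗ₖ L))ᵀ *ᵥ A) (i, j))
      = (cplx L)ᵀ * (Matrix.of fun i j => A (i, j)) * cplx L := by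
    ext a b
    exact kronecker_transpose_mulVec L A a b
  refine ⟨(cplx (L ⊗ₖ L))ᵀ *ᵥ A, ?_, ?_, ?_, ?_⟩
  · intro h
    apply h0
    rw [← hc A, h, Matrix.mulVec_zero]
  · rw [hmat, Matrix.transpose_mul, Matrix.transpose_mul, hs]
    simp [Matrix.mul_assoc]
  · have h1 : cplx L * cplx L⁻¹ = 1 := by
      rw [← cplx_mul, Matrix.mul_nonsing_inv _ hL.ne'.isUnit]; simp
    have h2 : (cplx L⁻¹)ᵀ * (cplx L)ᵀ = 1 := cplx_transpose_mul_inv hL.ne'.isUnit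
    rw [hmat, Matrix.mul_inv_rev, Matrix.mul_inv_rev, cplx_mul, cplx_mul,
      ← Matrix.transpose_nonsing_inv, ← htr, Matrix.transpose_mul, Matrix.transpose_mul]
    simp only [Matrix.transpose_transpose, cplx_transpose, Matrix.mul_assoc]
    rw [← Matrix.mul_assoc (cplx L⁻¹)ᵀ, h2, Matrix.one_mul, Matrix.trace_mul_comm]
    simp only [Matrix.mul_assoc]
    rw [h1, Matrix.mul_one]
  · have h1 : cplx (L ⊗ₖ L) * cplx (L ⊗ₖ L)⁻¹ = 1 := by
      rw [← cplx_mul, Matrix.mul_nonsing_inv _ hK]; simp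
    rw [belRobinson_pull G hL, flat_pull, kronecker_inv_congr]
    simp only [cplx_mul, Matrix.mul_assoc, cplx_transpose]
    rw [← Matrix.mul_assoc (cplx (L ⊗ₖ L)) (cplx (L ⊗ₖ L)⁻¹), h1, Matrix.one_mul]
    simp only [← Matrix.mulVec_mulVec] at hA ⊢
    rw [hc, hA, Matrix.mulVec_smul]

theorem belRobinsonEigenvalues_pull {G : Matrix (Fin 4) (Fin 4) ℝ} {W : Tensor4}
    {L : Matrix (Fin 4) (Fin 4) ℝ} (hL : 0 < L.det) :
    belRobinsonEigenvalues (Lᵀ * G * L) (pull L W) = belRobinsonEigenvalues G W := by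
  refine Set.Subset.antisymm ?_ (belRobinsonEigenvalues_subset_pull hL)
  have h' := belRobinsonEigenvalues_subset_pull (G := Lᵀ * G * L) (W := pull L W) (L := L⁻¹)
    (by rw [Matrix.det_nonsing_inv]; simpa using hL)
  rwa [(pull_congr_inv hL G W).1, (pull_congr_inv hL G W).2] at h'

/-! ### Self-dual bivectors in an orthonormal frame -/

/-- The Minkowski metric. -/
noncomputable def eta : Matrix (Fin 4) (Fin 4) ℝ := Matrix.diagonal ![-1, 1, 1, 1]

theorem eta_transpose : etaᵀ = eta := Matrix.diagonal_transpose _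

theorem eta_mul_eta : eta * eta = 1 := by
  rw [eta, Matrix.diagonal_mul_diagonal, ← Matrix.diagonal_one]
  congr 1
  ext i
  fin_cases i <;> simp

theorem eta_inv : eta⁻¹ = eta := Matrix.inv_eq_right_inv eta_mul_eta

theorem eta_det : eta.det = -1 := by
  rw [eta, Matrix.det_diagonal, Fin.prod_univ_four]
  simp

theorem lorentz_det_ne_zero {G L : Matrix (Fin 4) (Fin 4) ℝ} (h : Lᵀ * G * L = eta) :
    L.det ≠ 0 := by
  intro h0
  have := congrArg Matrix.det h
  rw [Matrix.det_mul, h0, eta_det] at this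
  norm_num at this

/-- The reflection of the last vector of a frame. -/
noncomputable def reflect : Matrix (Fin 4) (Fin 4) ℝ := Matrix.diagonal ![1, 1, 1, -1]

theorem reflect_det : reflect.det = -1 := by
  simp [reflect, Matrix.det_diagonal, Fin.prod_univ_four]

theorem reflect_eta : reflectᵀ * eta * reflect = eta := by
  simp only [reflect, eta, Matrix.diagonal_transpose, Matrix.diagonal_mul_diagonal]
  congr 1
  ext i
  fin_cases i <;> simp

theorem reflect_mul_eta {G L : Matrix (Fin 4) (Fin 4) ℝ}
    (h : Lᵀ * G * L = eta) : (L * reflect)ᵀ * G * (L * reflect) = eta := by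
  rw [Matrix.transpose_mul]
  calc _ = reflectᵀ * (Lᵀ * G * L) * reflect := by simp only [Matrix.mul_assoc]
    _ = _ := by rw [h, reflect_eta]

/-- The basis of self-dual bivectors, as endomorphisms: `S i e₀ = eᵢ` and
`S i eⱼ = δᵢⱼ e₀ + i εᵢⱼₖ eₖ`. -/
noncomputable def sdEndo : Fin 3 → Matrix (Fin 4) (Fin 4) ℂ :=
  ![!![0, 1, 0, 0; 1, 0, 0, 0; 0, 0, 0, -Complex.I; 0, 0, Complex.I, 0],
    !![0, 0, 1, 0; 0, 0, 0, Complex.I; 1, 0, 0, 0; 0, -Complex.I, 0, 0],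
    !![0, 0, 0, 1; 0, 0, -Complex.I, 0; 0, Complex.I, 0, 0; 1, 0, 0, 0]]

/-- The basis of self-dual bivectors. -/
noncomputable def sdForm : Fin 3 → Matrix (Fin 4) (Fin 4) ℂ :=
  ![!![0, -1, 0, 0; 1, 0, 0, 0; 0, 0, 0, -Complex.I; 0, 0, Complex.I, 0],
    !![0, 0, -1, 0; 0, 0, 0, Complex.I; 1, 0, 0, 0; 0, -Complex.I, 0, 0],
    !![0, 0, 0, -1; 0, 0, -Complex.I, 0; 0, Complex.I, 0, 0; 1, 0, 0, 0]]

theorem sdForm_eq (i : Fin 3) : sdForm i = cplx eta * sdEndo i := by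
  ext a b
  fin_cases i <;> fin_cases a <;> fin_cases b <;>
    simp [sdForm, sdEndo, eta, Matrix.mul_apply, Fin.sum_univ_four]

theorem sdForm_antisymm (i : Fin 3) (a b : Fin 4) : sdForm i a b = -sdForm i b a := by
  fin_cases i <;> fin_cases a <;> fin_cases b <;> simp [sdForm]

/-- The selection matrix times the Vandermonde matrix of (0, 1, 2, 3) is the Vandermonde matrix of
(a, b, c, d), and the former has determinant 12. The polynomial form makes later case checks purely
arithmetical. -/
theorem levi_eq (a b c d : Fin 4) : levi a b c d =
    ((b : ℝ) - a) * ((c : ℝ) - a) * ((d : ℝ) - a) * ((c : ℝ) - b) * ((d : ℝ) - b) * ((d : ℝ) - c) / 12 := by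
  have h : (Matrix.of fun i j : Fin 4 => if ![a, b, c, d] i = j then (1 : ℝ) else 0)
      * Matrix.vandermonde (fun i : Fin 4 => ((i : ℕ) : ℝ))
      = Matrix.vandermonde (fun i : Fin 4 => ((![a, b, c, d] i : ℕ) : ℝ)) := by
    ext i j
    simp [Matrix.mul_apply, Matrix.vandermonde]
  have h2 := congrArg Matrix.det h
  rw [Matrix.det_mul, Matrix.det_vandermonde, Matrix.det_vandermonde] at h2
  have e0 : Finset.Ioi (0 : Fin 4) = {1, 2, 3} := by decide
  have e1 : Finset.Ioi (1 : Fin 4) = {2, 3} := by decide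
  have e2 : Finset.Ioi (2 : Fin 4) = {3} := by decide
  have e3 : Finset.Ioi (3 : Fin 4) = ∅ := by decide
  simp [Fin.prod_univ_four, e0, e1, e2, e3] at h2
  rw [levi]
  linarith

theorem hodge_eta (a b c d : Fin 4) :
    hodge eta a b c d = (1 / 2) * (levi a b c d * ![-1, 1, 1, 1] c * ![-1, 1, 1, 1] d) := by
  simp only [hodge, eta_inv, volumeElement, eta_det]
  simp [eta, Matrix.diagonal_apply]

theorem hodge_sdForm (i : Fin 3) (a b : Fin 4) :
    ∑ c, ∑ d, (hodge eta a b c d : ℂ) * sdForm i c d = Complex.I * sdForm i a b := by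
  simp only [hodge_eta, levi_eq]
  fin_cases i <;> fin_cases a <;> fin_cases b <;>
    simp [sdForm, Fin.sum_univ_four] <;> ring

/-- The tensor `∑ Q i j S i ⊗ S j`. -/
noncomputable def sdTensor (Q : Matrix (Fin 3) (Fin 3) ℂ) (a b c d : Fin 4) : ℂ :=
  ∑ i, ∑ j, Q i j * sdForm i a b * sdForm j c d

/-- The Weyl tensor, in an orthonormal frame, with self-dual part given by the matrix `Q`. -/
noncomputable def ofSd (Q : Matrix (Fin 3) (Fin 3) ℂ) : Tensor4 := fun a b c d =>
  -(sdTensor Q a b c d).re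

theorem ofSd_cast (Q : Matrix (Fin 3) (Fin 3) ℂ) (a b c d : Fin 4) :
    (ofSd Q a b c d : ℂ) = -(1 / 2) * (sdTensor Q a b c d + conj (sdTensor Q a b c d)) := by
  rw [ofSd, Complex.add_conj]
  push_cast
  ring

theorem dualWeyl_ofSd (Q : Matrix (Fin 3) (Fin 3) ℂ) :
    dualWeyl eta (ofSd Q) = ofSd (Complex.I • Q) := by
  funext a b c d
  have h : ∑ e, ∑ f, (hodge eta a b e f : ℂ) * sdTensor Q e f c d = Complex.I * sdTensor Q a b c d := by
    have h1 : ∀ e f, (hodge eta a b e f : ℂ) * sdTensor Q e f c d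
        = ∑ i, ∑ j, Q i j * sdForm j c d * ((hodge eta a b e f : ℂ) * sdForm i e f) := by
      intro e f
      simp only [sdTensor, Finset.mul_sum]
      refine Finset.sum_congr rfl fun _ _ => Finset.sum_congr rfl fun _ _ => ?_
      ring
    simp only [h1]
    conv_lhs => enter [2, e]; rw [Finset.sum_comm]
    rw [Finset.sum_comm]
    conv_lhs => enter [2, i, 2, e]; rw [Finset.sum_comm]
    conv_lhs => enter [2, i]; rw [Finset.sum_comm]
    simp only [← Finset.mul_sum, hodge_sdForm]
    simp only [sdTensor, Finset.mul_sum]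
    refine Finset.sum_congr rfl fun _ _ => Finset.sum_congr rfl fun _ _ => ?_
    ring
  have h2 : sdTensor (Complex.I • Q) a b c d = Complex.I * sdTensor Q a b c d := by
    simp only [sdTensor, Finset.mul_sum, Matrix.smul_apply, smul_eq_mul, mul_assoc]
  rw [ofSd, h2, ← h, dualWeyl, Complex.re_sum, ← Finset.sum_neg_distrib]
  refine Finset.sum_congr rfl fun _ _ => ?_
  rw [Complex.re_sum, ← Finset.sum_neg_distrib]
  refine Finset.sum_congr rfl fun _ _ => ?_
  rw [Complex.re_ofReal_mul, ofSd]
  ring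

/-- The matrix of the basis of self-dual bivectors. -/
noncomputable def sdCol : Matrix (Fin 4 × Fin 4) (Fin 3) ℂ := Matrix.of fun P i => sdForm i P.1 P.2

/-- The matrix of the basis of self-dual bivectors, with upper indices. -/
noncomputable def sdRow : Matrix (Fin 3) (Fin 4 × Fin 4) ℂ := sdColᵀ * cplx (eta ⊗ₖ eta)

theorem sdRow_mul_sdCol : sdRow * sdCol = (-4 : ℂ) • (1 : Matrix (Fin 3) (Fin 3) ℂ) := by
  ext i j
  fin_cases i <;> fin_cases j <;>
    simp [sdRow, sdCol, Matrix.mul_apply, Fintype.sum_prod_type, Fin.sum_univ_four, sdForm, eta,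
      Matrix.diagonal_apply] <;> norm_num

/-- Dualising multiplies Q by i, so in W - i *W the conjugate halves cancel and the self-dual halves
add up. The factor -1/4 compensates the normalisation `sdRow * sdCol = -4`, so that Q itself is the
matrix of the endomorphism in the basis `sdForm`. -/
theorem weylEndo_ofSd (Q : Matrix (Fin 3) (Fin 3) ℂ) :
    weylEndo eta (ofSd Q) = sdCol * (-(1 / 4 : ℂ) • Q) * sdRow := by
  have h : cplx (flat (ofSd Q)) - Complex.I • cplx (flat (dualWeyl eta (ofSd Q)))
      = -(sdCol * Q * sdColᵀ) := by
    rw [dualWeyl_ofSd]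
    have h2 : ∀ a b c d, sdTensor (Complex.I • Q) a b c d = Complex.I * sdTensor Q a b c d := by
      intro a b c d
      simp only [sdTensor, Finset.mul_sum, Matrix.smul_apply, smul_eq_mul, mul_assoc]
    ext ⟨a, b⟩ ⟨c, d⟩
    simp only [flat, Matrix.sub_apply, Matrix.map_apply, Matrix.of_apply, Matrix.smul_apply,
      Complex.coe_algebraMap, ofSd_cast, h2, smul_eq_mul, map_mul, Complex.conj_I]
    have h3 : (sdCol * Q * sdColᵀ) (a, b) (c, d) = sdTensor Q a b c d := by
      simp only [sdCol, Matrix.mul_apply, Matrix.of_apply, Matrix.transpose_apply, sdTensor,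
        Finset.sum_mul]
      rw [Finset.sum_comm]
      refine Finset.sum_congr rfl fun _ _ => Finset.sum_congr rfl fun _ _ => ?_
      ring
    rw [Matrix.neg_apply, h3]
    linear_combination (1 / 2) * (sdTensor Q a b c d - conj (sdTensor Q a b c d)) * Complex.I_mul_I
  rw [weylEndo_eq, h, eta_inv, sdRow]
  simp only [Matrix.mul_assoc, Matrix.mul_smul, Matrix.smul_mul, Matrix.neg_mul, neg_smul,
    Matrix.mul_neg, smul_neg]

theorem weylEndo_ofSd_pow (Q : Matrix (Fin 3) (Fin 3) ℂ) (k : ℕ) :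
    weylEndo eta (ofSd Q) ^ (k + 1) = sdCol * (-(1 / 4 : ℂ) • Q ^ (k + 1)) * sdRow := by
  induction k with
  | zero => simp [weylEndo_ofSd]
  | succ k ih =>
    rw [pow_succ, ih, weylEndo_ofSd]
    calc _ = sdCol * (-(1 / 4 : ℂ) • Q ^ (k + 1)) * (sdRow * sdCol) * (-(1 / 4 : ℂ) • Q) * sdRow := by
          simp only [Matrix.mul_assoc]
      _ = _ := by
          rw [sdRow_mul_sdCol, pow_succ Q (k + 1)]
          simp only [Matrix.mul_assoc, Matrix.mul_smul, Matrix.smul_mul, Matrix.mul_one, smul_smul]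
          norm_num

theorem trace_weylEndo_ofSd_pow (Q : Matrix (Fin 3) (Fin 3) ℂ) (k : ℕ) :
    (weylEndo eta (ofSd Q) ^ (k + 1)).trace = (Q ^ (k + 1)).trace := by
  rw [weylEndo_ofSd_pow, Matrix.mul_assoc, Matrix.trace_mul_comm, Matrix.mul_assoc, sdRow_mul_sdCol]
  simp

theorem weylEndo_ofSd_mulVec (Q : Matrix (Fin 3) (Fin 3) ℂ) (f : Fin 3 → ℂ) :
    weylEndo eta (ofSd Q) *ᵥ (sdCol *ᵥ f) = sdCol *ᵥ (Q *ᵥ f) := by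
  rw [weylEndo_ofSd, Matrix.mulVec_mulVec, Matrix.mul_assoc, sdRow_mul_sdCol]
  simp only [Matrix.mul_smul, Matrix.mul_one, smul_smul, Matrix.mulVec_mulVec]
  norm_num

theorem sdCol_mulVec_injective : Function.Injective (sdCol *ᵥ ·) := by
  intro f g h
  have : sdRow *ᵥ (sdCol *ᵥ f) = sdRow *ᵥ (sdCol *ᵥ g) := congrArg (sdRow *ᵥ ·) h
  simp only [Matrix.mulVec_mulVec, sdRow_mul_sdCol, Matrix.smul_mulVec, Matrix.one_mulVec] at this
  exact smul_right_injective _ (by norm_num : (-4 : ℂ) ≠ 0) this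

/-- Self-duality determines the spatial components F(i, j) from the electric ones F(i, 0), which
serve as coordinates. -/
theorem isSelfDualBivector_eta_iff (F : Fin 4 × Fin 4 → ℂ) :
    IsSelfDualBivector eta F ↔ ∃ f, F = sdCol *ᵥ f := by
  constructor
  · rintro ⟨h1, h2⟩
    refine ⟨![F (1, 0), F (2, 0), F (3, 0)], ?_⟩
    have hd : ∀ a, F (a, a) = 0 := fun a => by
      have := h1 a a
      linear_combination (1 / 2) * this
    have a1 := h2 1 0
    have a2 := h2 2 0
    have a3 := h2 3 0
    simp only [hodge_eta, levi_eq] at a1 a2 a3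
    simp [Fin.sum_univ_four, hd] at a1 a2 a3
    norm_num at a1 a2 a3
    rw [h1 3 2] at a1
    rw [h1 3 1] at a2
    rw [h1 2 1] at a3
    ext ⟨a, b⟩
    fin_cases a <;> fin_cases b <;>
      simp [sdCol, Matrix.mulVec, dotProduct, Fin.sum_univ_three, sdForm, hd] <;>
      first
        | exact h1 _ _
        | linear_combination -a1
        | linear_combination a2
        | linear_combination -a3
        | linear_combination h1 3 2 + a1
        | linear_combination h1 3 1 - a2
        | linear_combination h1 2 1 + a3
  · rintro ⟨f, rfl⟩
    have hF : ∀ a b, (sdCol *ᵥ f) (a, b) = ∑ i, f i * sdForm i a b := by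
      intro a b
      simp [sdCol, Matrix.mulVec, dotProduct, mul_comm]
    constructor
    · intro a b
      rw [hF, hF, ← Finset.sum_neg_distrib]
      refine Finset.sum_congr rfl fun i _ => ?_
      rw [sdForm_antisymm]
      ring
    · intro a b
      simp only [hF, Finset.mul_sum]
      conv_lhs => enter [2, e]; rw [Finset.sum_comm]
      rw [Finset.sum_comm]
      refine Finset.sum_congr rfl fun i _ => ?_
      have := hodge_sdForm i a b
      simp only [mul_left_comm _ (f i), ← Finset.mul_sum, this]

theorem isWeylEigenvalue_ofSd (Q : Matrix (Fin 3) (Fin 3) ℂ) (ρ : ℂ) :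
    IsWeylEigenvalue eta (ofSd Q) ρ ↔ ∃ f : Fin 3 → ℂ, f ≠ 0 ∧ Q *ᵥ f = ρ • f := by
  constructor
  · rintro ⟨F, h0, hsd, hF⟩
    obtain ⟨f, rfl⟩ := (isSelfDualBivector_eta_iff F).1 hsd
    refine ⟨f, ?_, ?_⟩
    · rintro rfl
      exact h0 (Matrix.mulVec_zero _)
    · apply sdCol_mulVec_injective
      simpa only [weylEndo_ofSd_mulVec, Matrix.mulVec_smul] using hF
  · rintro ⟨f, h0, hf⟩
    refine ⟨sdCol *ᵥ f, ?_, (isSelfDualBivector_eta_iff _).2 ⟨f, rfl⟩, ?_⟩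
    · intro h
      exact h0 (sdCol_mulVec_injective (by simpa using h))
    · rw [weylEndo_ofSd_mulVec, hf, Matrix.mulVec_smul]

/-! ### The symmetries of the Weyl tensor -/

/-- The algebraic symmetries of a Weyl tensor. -/
structure IsWeylTensor (G : Matrix (Fin 4) (Fin 4) ℝ) (W : Tensor4) : Prop where
  antisymm_left : ∀ a b c d, W a b c d = -W b a c d
  antisymm_right : ∀ a b c d, W a b c d = -W a b d c
  pair_symm : ∀ a b c d, W a b c d = W c d a b
  bianchi : ∀ a b c d, W a b c d + W a c d b + W a d b c = 0
  traceless : ∀ b d, ∑ a, ∑ c, G⁻¹ a c * W a b c d = 0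

theorem eval4_swap_mid (T : Tensor4) (x y z w : Fin 4 → ℝ) :
    eval4 (fun a b c d => T a c b d) x y z w = eval4 T x z y w := by
  simp only [eval4]
  refine Finset.sum_congr rfl fun _ _ => ?_
  rw [Finset.sum_comm]
  refine Finset.sum_congr rfl fun _ _ => Finset.sum_congr rfl fun _ _ =>
    Finset.sum_congr rfl fun _ _ => ?_
  ring

theorem pull_apply (L : Matrix (Fin 4) (Fin 4) ℝ) (T : Tensor4) (a b c d : Fin 4) :
    pull L T a b c d = eval4 T (Lᵀ a) (Lᵀ b) (Lᵀ c) (Lᵀ d) := by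
  rw [← eval4_single (pull L T), eval4_pull]
  simp only [Matrix.mulVec_single_one, Matrix.col_def]

theorem IsWeylTensor.pull {G : Matrix (Fin 4) (Fin 4) ℝ} {W : Tensor4} (h : IsWeylTensor G W)
    {L : Matrix (Fin 4) (Fin 4) ℝ} (hL : L.det ≠ 0) :
    IsWeylTensor (Lᵀ * G * L) (pull L W) where
  antisymm_left a b c d := by
    rw [pull_apply, pull_apply, ← eval4_swap_left]
    simp only [eval4, ← Finset.sum_neg_distrib]
    refine Finset.sum_congr rfl fun a _ => Finset.sum_congr rfl fun b _ =>
      Finset.sum_congr rfl fun c _ => Finset.sum_congr rfl fun d _ => ?_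
    rw [h.antisymm_left a b]
    ring
  antisymm_right a b c d := by
    rw [pull_apply, pull_apply, ← eval4_swap_right]
    simp only [eval4, ← Finset.sum_neg_distrib]
    refine Finset.sum_congr rfl fun a _ => Finset.sum_congr rfl fun b _ =>
      Finset.sum_congr rfl fun c _ => Finset.sum_congr rfl fun d _ => ?_
    rw [h.antisymm_right a b]
    ring
  pair_symm a b c d := by
    have h1 : ∀ x y z w, eval4 W x y z w = eval4 (fun a b c d => W c d a b) x y z w := by
      intro x y z w
      congr 1
      funext a b c d
      exact h.pair_symm a b c d
    rw [pull_apply, pull_apply, h1]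
    rw [eval4_swap_mid (fun a b c d => W b d a c), eval4_swap_left (fun a b c d => W a d b c),
      eval4_swap_right (fun a b c d => W a c b d), eval4_swap_mid]
  bianchi a b c d := by
    rw [pull_apply, pull_apply, pull_apply]
    set x := Lᵀ a
    set y := Lᵀ b
    set z := Lᵀ c
    set w := Lᵀ d
    have h1 : eval4 W x z w y = eval4 (fun a b c d => W a c d b) x y z w := by
      rw [eval4_swap_mid (fun a b c d => W a b d c), eval4_swap_right]
    have h2 : eval4 W x w y z = eval4 (fun a b c d => W a d b c) x y z w := by
      rw [eval4_swap_right (fun a b c d => W a c b d), eval4_swap_mid]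
    rw [h1, h2]
    simp only [eval4, ← Finset.sum_add_distrib, ← mul_add, h.bianchi]
    simp
  traceless b d := by
    have hG : L * (Lᵀ * G * L)⁻¹ * Lᵀ = G⁻¹ := by
      rw [Matrix.mul_inv_rev, Matrix.mul_inv_rev]
      simp only [Matrix.mul_assoc]
      rw [Matrix.mul_nonsing_inv_cancel_left _ _ hL.isUnit,
        Matrix.nonsing_inv_mul _ (by rwa [Matrix.det_transpose, isUnit_iff_ne_zero]), Matrix.mul_one]
    have h1 : ∀ (g : Matrix (Fin 4) (Fin 4) ℝ) (V : Tensor4) b d,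
        ∑ a, ∑ c, g a c * V a b c d = ((fun P : Fin 4 × Fin 4 => g P.1 P.2) ᵥ* cross V) (b, d) := by
      intro g V b d
      simp [Matrix.vecMul, dotProduct, cross, Fintype.sum_prod_type]
    have h2 : (fun P : Fin 4 × Fin 4 => (Lᵀ * G * L)⁻¹ P.1 P.2) ᵥ* (L ⊗ₖ L)ᵀ
        = fun P : Fin 4 × Fin 4 => G⁻¹ P.1 P.2 := by
      rw [Matrix.vecMul_transpose, ← hG]
      ext ⟨a, b⟩
      simp only [Matrix.mulVec, dotProduct, Matrix.kroneckerMap_apply, Fintype.sum_prod_type,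
        Matrix.mul_apply, Finset.sum_mul, Matrix.transpose_apply]
      rw [Finset.sum_comm]
      refine Finset.sum_congr rfl fun _ _ => Finset.sum_congr rfl fun _ _ => ?_
      ring
    have h3 : (fun P : Fin 4 × Fin 4 => G⁻¹ P.1 P.2) ᵥ* cross W = 0 := by
      ext ⟨b, d⟩
      rw [← h1]
      exact h.traceless b d
    rw [h1, cross_pull, ← Matrix.vecMul_vecMul, ← Matrix.vecMul_vecMul, h2, h3]
    simp

/-- An antisymmetric array of order four is given by six of its entries. -/
theorem eq_of_antisymm {f g : Fin 4 → Fin 4 → ℝ} (hf : ∀ a b, f a b = -f b a)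
    (hg : ∀ a b, g a b = -g b a) (h01 : f 0 1 = g 0 1) (h02 : f 0 2 = g 0 2) (h03 : f 0 3 = g 0 3)
    (h12 : f 1 2 = g 1 2) (h13 : f 1 3 = g 1 3) (h23 : f 2 3 = g 2 3) (a b : Fin 4) :
    f a b = g a b := by
  have hd : ∀ a, f a a = g a a := fun a => by linarith [hf a a, hg a a]
  fin_cases a <;> fin_cases b <;> simp only [Fin.zero_eta, Fin.mk_one, Fin.reduceFinMk] <;>
    first
      | exact hd _
      | assumption
      | (rw [hf, hg]; congr 1)

/-- The trace conditions express the purely spatial components through W₀ᵢ₀ⱼ and make the magnetic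
part symmetric. The first Bianchi identity makes the magnetic part traceless, and the `00` trace
does the same for the electric part. -/
theorem IsWeylTensor.exists_ofSd {W : Tensor4} (h : IsWeylTensor eta W) :
    ∃ Q : Matrix (Fin 3) (Fin 3) ℂ, Qᵀ = Q ∧ Q.trace = 0 ∧ W = ofSd Q := by
  have hd1 : ∀ a c d, W a a c d = 0 := fun a c d => by linarith [h.antisymm_left a a c d]
  have hd2 : ∀ a b c, W a b c c = 0 := fun a b c => by linarith [h.antisymm_right a b c c]
  have ht : ∀ b d, -W 0 b 0 d + W 1 b 1 d + W 2 b 2 d + W 3 b 3 d = 0 := by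
    intro b d
    have := h.traceless b d
    rw [eta_inv] at this
    simpa [eta, Matrix.diagonal_apply, Fin.sum_univ_four] using this
  have b1 := h.bianchi 0 1 2 3
  have t00 := ht 0 0
  have t01 := ht 0 1
  have t02 := ht 0 2
  have t03 := ht 0 3
  have t11 := ht 1 1
  have t12 := ht 1 2
  have t13 := ht 1 3
  have t22 := ht 2 2
  have t23 := ht 2 3
  have t33 := ht 3 3
  simp only [hd1, hd2, neg_neg, add_zero, zero_add, neg_zero,
    h.antisymm_left 1 0, h.antisymm_right _ _ 1 0, h.antisymm_left 2 0, h.antisymm_right _ _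
    2 0, h.antisymm_left 3 0, h.antisymm_right _ _ 3 0, h.antisymm_left 2 1,
    h.antisymm_right _ _ 2 1, h.antisymm_left 3 1, h.antisymm_right _ _ 3 1, h.antisymm_left
    3 2, h.antisymm_right _ _ 3 2]
    at b1 t00 t01 t02 t03 t11 t12 t13 t22 t23 t33
  -- The real part is minus the electric part `W 0 i 0 j`. The imaginary part is the magnetic part
  -- `W 0 i k l`, where (k, l) is the cyclic pair complementary to j, whence the sign of the `1 3`
  -- entries.
  let Q : Matrix (Fin 3) (Fin 3) ℂ :=
    !![⟨-W 0 1 0 1, W 0 1 2 3⟩, ⟨-W 0 1 0 2, -W 0 1 1 3⟩, ⟨-W 0 1 0 3, W 0 1 1 2⟩;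
      ⟨-W 0 1 0 2, -W 0 1 1 3⟩, ⟨-W 0 2 0 2, -W 0 2 1 3⟩, ⟨-W 0 2 0 3, W 0 2 1 2⟩;
      ⟨-W 0 1 0 3, W 0 1 1 2⟩, ⟨-W 0 2 0 3, W 0 2 1 2⟩, ⟨-W 0 3 0 3, W 0 3 1 2⟩]
  refine ⟨Q, ?_, ?_, ?_⟩
  · ext i j
    fin_cases i <;> fin_cases j <;> rfl
  · apply Complex.ext <;> simp [Q, Matrix.trace, Fin.sum_univ_three] <;> linarith
  · have al : ∀ c d a b, ofSd Q a b c d = -ofSd Q b a c d := by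
      intro c d a b
      have : sdTensor Q a b c d = -sdTensor Q b a c d := by
        simp only [sdTensor, ← Finset.sum_neg_distrib]
        refine Finset.sum_congr rfl fun i _ => Finset.sum_congr rfl fun j _ => ?_
        rw [sdForm_antisymm i a b]
        ring
      rw [ofSd, ofSd, this, Complex.neg_re]
    have ar : ∀ a b c d, ofSd Q a b c d = -ofSd Q a b d c := by
      intro a b c d
      have : sdTensor Q a b c d = -sdTensor Q a b d c := by
        simp only [sdTensor, ← Finset.sum_neg_distrib]
        refine Finset.sum_congr rfl fun i _ => Finset.sum_congr rfl fun j _ => ?_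
        rw [sdForm_antisymm j c d]
        ring
      rw [ofSd, ofSd, this, Complex.neg_re]
    funext a b c d
    apply eq_of_antisymm (f := fun a b => W a b c d) (g := fun a b => ofSd Q a b c d)
      (fun a b => h.antisymm_left a b c d) (al c d) <;>
    · apply eq_of_antisymm (h.antisymm_right _ _) (ar _ _) <;>
      · simp only [ofSd, sdTensor, Fin.sum_univ_three, Q]
        simp [sdForm]
        try simp only [
          h.pair_symm 0 2 0 1, h.pair_symm 0 3 0 1, h.pair_symm 0 3 0 2, h.pair_symm 1 2 0 1,
          h.pair_symm 1 2 0 2, h.pair_symm 1 2 0 3, h.pair_symm 1 3 0 1, h.pair_symm 1 3 0 2,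
          h.pair_symm 1 3 0 3, h.pair_symm 1 3 1 2, h.pair_symm 2 3 0 1, h.pair_symm 2 3 0 2,
          h.pair_symm 2 3 0 3, h.pair_symm 2 3 1 2, h.pair_symm 2 3 1 3]
        try linarith

/-! ### Curvature of a metric in a chart -/

theorem pderiv_comm {f : Coord → ℝ} {x : Coord} (hf : ContDiffAt ℝ ∞ f x) (i j : Fin 4) :
    pderiv i (pderiv j f) x = pderiv j (pderiv i f) x := by
  have hd : DifferentiableAt ℝ (fderiv ℝ f) x :=
    (hf.fderiv_right (m := 1) (by rw [one_add_one_eq_two]; exact WithTop.coe_le_coe.2 le_top)).differentiableAt one_ne_zero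
  have h : ∀ i j, pderiv i (pderiv j f) x
      = fderiv ℝ (fderiv ℝ f) x (EuclideanSpace.single i 1) (EuclideanSpace.single j 1) := by
    intro i j
    change fderiv ℝ (fun y => fderiv ℝ f y (EuclideanSpace.single j 1)) x _ = _
    rw [fderiv_clm_apply hd (differentiableAt_const _)]
    simp
  rw [h, h]
  exact hf.isSymmSndFDerivAt (by rw [minSmoothness_of_isRCLikeNormedField]; exact WithTop.coe_le_coe.2 le_top) _ _

section Curvature

variable {G : Coord → Matrix (Fin 4) (Fin 4) ℝ} {x : Coord}

theorem christoffel_comm (hG : ∀ y i j, G y i j = G y j i) (a b c : Fin 4) :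
    christoffel G a b c x = christoffel G a c b x := by
  simp only [christoffel]
  congr 1
  refine Finset.sum_congr rfl fun d _ => ?_
  rw [show (fun y => G y c b) = fun y => G y b c from funext fun y => hG y c b]
  ring

/-- The first pair of symmetries of the Riemann tensor. -/
theorem riemann_antisymm_left (hG : ∀ y i j, G y i j = G y j i) (a b c d : Fin 4) :
    riemann G x a b c d = -riemann G x b a c d := by
  have hs : ∀ p q r s : Fin 4, ∑ e, ∑ f, G x e f * (christoffel G e p q x * christoffel G f r s x)
      = ∑ e, ∑ f, G x e f * (christoffel G e r s x * christoffel G f p q x) := by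
    intro p q r s
    rw [Finset.sum_comm]
    refine Finset.sum_congr rfl fun e _ => Finset.sum_congr rfl fun f _ => ?_
    rw [hG]
    ring
  simp only [riemann, mul_sub, Finset.sum_sub_distrib]
  linarith [hs b c a d, hs b d a c]

theorem riemann_antisymm_right (a b c d : Fin 4) :
    riemann G x a b c d = -riemann G x a b d c := by
  simp only [riemann, mul_sub, Finset.sum_sub_distrib]
  linarith

theorem riemann_pair_symm (hG : ∀ y i j, G y i j = G y j i)
    (hc : ∀ i j, ContDiffAt ℝ ∞ (fun y => G y i j) x) (a b c d : Fin 4) :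
    riemann G x a b c d = riemann G x c d a b := by
  have hf : ∀ i j, (fun y => G y i j) = fun y => G y j i := fun i j => funext fun y => hG y i j
  have hp : ∀ i j k l, pderiv i (pderiv j fun y => G y k l) x = pderiv j (pderiv i fun y => G y k l) x :=
    fun i j k l => pderiv_comm (hc k l) i j
  have hs : ∀ p q r s : Fin 4, ∑ e, ∑ f, G x e f * (christoffel G e p q x * christoffel G f r s x)
      = ∑ e, ∑ f, G x e f * (christoffel G e r s x * christoffel G f p q x) := by
    intro p q r s
    rw [Finset.sum_comm]
    refine Finset.sum_congr rfl fun e _ => Finset.sum_congr rfl fun f _ => ?_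
    rw [hG]
    ring
  simp only [riemann, mul_sub, Finset.sum_sub_distrib]
  have hs' := hs d a c b
  simp only [fun e => christoffel_comm (x := x) hG e d a, fun e => christoffel_comm (x := x) hG e c b,
    fun e => christoffel_comm (x := x) hG e d b, fun e => christoffel_comm (x := x) hG e c a] at hs' ⊢
  rw [hf c b, hf d a, hf c a, hf d b]
  linarith [hp b c a d, hp a d b c, hp b d a c, hp a c b d]

theorem riemann_bianchi (hG : ∀ y i j, G y i j = G y j i)
    (hc : ∀ i j, ContDiffAt ℝ ∞ (fun y => G y i j) x) (a b c d : Fin 4) :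
    riemann G x a b c d + riemann G x a c d b + riemann G x a d b c = 0 := by
  have hf : ∀ i j, (fun y => G y i j) = fun y => G y j i := fun i j => funext fun y => hG y i j
  have hp : ∀ i j k l, pderiv i (pderiv j fun y => G y k l) x = pderiv j (pderiv i fun y => G y k l) x :=
    fun i j k l => pderiv_comm (hc k l) i j
  simp only [riemann, mul_sub, Finset.sum_sub_distrib]
  simp only [fun e => christoffel_comm (x := x) hG e d b, fun e => christoffel_comm (x := x) hG e c b,
    fun e => christoffel_comm (x := x) hG e d c]
  rw [hf c b, hf d c, hf d b]
  linarith [hp b c a d, hp a d b c, hp b d a c, hp a c b d, hp a b c d, hp c d a b]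

theorem isWeylTensor_weyl (hG : ∀ y i j, G y i j = G y j i)
    (hc : ∀ i j, ContDiffAt ℝ ∞ (fun y => G y i j) x) (hdet : (G x).det ≠ 0) :
    IsWeylTensor (G x) (weyl G x) := by
  have hiG : ∀ i j, (G x)⁻¹ i j = (G x)⁻¹ j i := by
    intro i j
    have h : (G x)ᵀ = G x := by ext i j; exact hG x j i
    have h2 := Matrix.transpose_nonsing_inv (G x)
    rw [h] at h2
    exact (congrFun (congrFun h2 i) j).symm
  have hric : ∀ b d, ricci G x b d = ricci G x d b := by
    intro b d
    simp only [ricci]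
    rw [Finset.sum_comm]
    refine Finset.sum_congr rfl fun a _ => Finset.sum_congr rfl fun c _ => ?_
    rw [hiG, riemann_pair_symm hG hc]
  have hinv : ∀ i j, ∑ k, (G x)⁻¹ i k * G x k j = if i = j then 1 else 0 := by
    intro i j
    rw [← Matrix.mul_apply, Matrix.nonsing_inv_mul _ hdet.isUnit, Matrix.one_apply]
  refine ⟨?_, ?_, ?_, ?_, ?_⟩
  · intro a b c d
    simp only [weyl]
    rw [riemann_antisymm_left hG]
    ring
  · intro a b c d
    simp only [weyl]
    rw [riemann_antisymm_right]
    ring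
  · intro a b c d
    simp only [weyl]
    rw [riemann_pair_symm hG hc, hric b d, hric b c, hric a d, hric a c, hG x a c, hG x b d,
      hG x a d, hG x b c]
    ring
  · intro a b c d
    simp only [weyl]
    have := riemann_bianchi hG hc a b c d
    rw [hric c b, hric d b, hric d c, hG x c b, hG x d b, hG x d c]
    linarith
  · intro b d
    have e1 : ∑ a, ∑ c, (G x)⁻¹ a c * G x a c = 4 := by
      have : ∀ a, ∑ c, (G x)⁻¹ a c * G x a c = 1 := by
        intro a
        have := hinv a a
        simp only [if_true] at this
        rw [← this]
        exact Finset.sum_congr rfl fun c _ => by rw [hG]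
      simp [this]
    have e2 : ∀ f : Fin 4 → ℝ, ∑ a, ∑ c, (G x)⁻¹ a c * (G x a d * f c) = f d := by
      intro f
      rw [Finset.sum_comm]
      have : ∀ c, ∑ a, (G x)⁻¹ a c * (G x a d * f c) = (if c = d then 1 else 0) * f c := by
        intro c
        rw [← hinv, Finset.sum_mul]
        exact Finset.sum_congr rfl fun a _ => by rw [hiG]; ring
      simp [this]
    have e3 : ∀ f : Fin 4 → ℝ, ∑ a, ∑ c, (G x)⁻¹ a c * (G x b c * f a) = f b := by
      intro f
      have : ∀ a, ∑ c, (G x)⁻¹ a c * (G x b c * f a) = (if a = b then 1 else 0) * f a := by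
        intro a
        rw [← hinv, Finset.sum_mul]
        exact Finset.sum_congr rfl fun c _ => by rw [hG]; ring
      simp [this]
    -- With the traces above the right side becomes Ric - ½(4 Ric - 2 Ric + R g) + (R/6)(4 - 1) g =
    -- 0, which is where the coefficients ½ and 1/6 of dimension four are used.
    have e4 : ∑ a, ∑ c, (G x)⁻¹ a c * weyl G x a b c d
        = ricci G x b d - (1 / 2) * ((∑ a, ∑ c, (G x)⁻¹ a c * G x a c) * ricci G x b d
          - (∑ a, ∑ c, (G x)⁻¹ a c * (G x a d * ricci G x b c))
          - (∑ a, ∑ c, (G x)⁻¹ a c * (G x b c * ricci G x a d)) + G x b d * scalarCurvature G x)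
          + (scalarCurvature G x / 6) * ((∑ a, ∑ c, (G x)⁻¹ a c * G x a c) * G x b d
          - (∑ a, ∑ c, (G x)⁻¹ a c * (G x a d * G x b c))) := by
      conv_rhs => enter [1, 1]; rw [ricci]
      conv_rhs => enter [1, 2, 2, 2]; rw [scalarCurvature]
      simp only [Finset.mul_sum, Finset.sum_mul, ← Finset.sum_sub_distrib, ← Finset.sum_add_distrib]
      refine Finset.sum_congr rfl fun a _ => Finset.sum_congr rfl fun c _ => ?_
      simp only [weyl]
      ring
    rw [e4, e1, e2, e3, e2]
    ring

end Curvature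

/-! ### Orthonormal frames and the Weyl tensor at a point of the manifold -/

variable {M : Type*} [TopologicalSpace M] [ChartedSpace Coord M] [IsManifold (𝓡 4) ∞ M]

theorem exists_orthonormal_frame (g : LorentzianMetric M) {φ : OpenPartialHomeomorph M Coord}
    (hφ : φ ∈ IsManifold.maximalAtlas (𝓡 4) ∞ M) {p : M} (hp : p ∈ φ.source) :
    ∃ L : Matrix (Fin 4) (Fin 4) ℝ, 0 < L.det ∧ Lᵀ * g.metricAt φ p * L = eta := by
  have hx : φ p ∈ φ.target := φ.map_source hp
  have hd : φ.MDifferentiable (𝓡 4) (𝓡 4) :=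
    ⟨(contMDiffOn_of_mem_maximalAtlas hφ).mdifferentiableOn (by simp),
      (contMDiffOn_symm_of_mem_maximalAtlas hφ).mdifferentiableOn (by simp)⟩
  let D := hd.symm.mfderiv (x := φ p) hx
  have hD : ∀ v : Coord, D v = mfderiv (𝓡 4) (𝓡 4) φ.symm (φ p) v := fun v => rfl
  -- The orthonormal basis is taken at `φ.symm (φ p)`, the point at which `chartComponents`
  -- evaluates the metric, so no transport along its equality with p is needed.
  obtain ⟨e, he⟩ := g.signature (φ.symm (φ p))
  let w : Fin 4 → Coord := fun i => D.symm (e i)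
  let L : Matrix (Fin 4) (Fin 4) ℝ := Matrix.of fun a i => w i a
  have hL : ∀ i, e i = ∑ a, L a i • D (EuclideanSpace.single a (1 : ℝ) : Coord) := by
    intro i
    have h1 : w i = ∑ a, L a i • (EuclideanSpace.single a (1 : ℝ) : Coord) := by
      ext j
      simp [L, Pi.single_apply]
    have h2 : e i = D (w i) := (D.apply_symm_apply (e i)).symm
    rw [h2, h1]
    erw [map_sum]
    refine Finset.sum_congr rfl fun a _ => ?_
    erw [map_smul]
  have hmet : Lᵀ * g.metricAt φ p * L = eta := by
    ext i j
    have h3 := he i j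
    rw [hL i, hL j] at h3
    simp only [map_sum, map_smul, LinearMap.sum_apply, LinearMap.smul_apply, smul_eq_mul, hD] at h3
    have h4 : eta i j = if i = j then (if i = 0 then -1 else 1) else 0 := by
      rw [eta, Matrix.diagonal_apply]
      fin_cases i <;> rfl
    rw [h4, ← h3]
    simp only [Matrix.mul_apply, Matrix.transpose_apply, Finset.sum_mul, Finset.mul_sum]
    refine Finset.sum_congr rfl fun a _ => Finset.sum_congr rfl fun b _ => ?_
    simp only [LorentzianMetric.metricAt, chartComponents, Matrix.of_apply]
    ring
  -- A frame of negative orientation is corrected by reversing its last vector.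
  rcases (lorentz_det_ne_zero hmet).lt_or_gt with h | h
  · refine ⟨L * reflect, ?_, reflect_mul_eta hmet⟩
    rw [Matrix.det_mul, reflect_det]
    linarith
  · exact ⟨L, h, hmet⟩

theorem isWeylTensor_weylAt (g : LorentzianMetric M) {φ : OpenPartialHomeomorph M Coord}
    (hφ : φ ∈ IsManifold.maximalAtlas (𝓡 4) ∞ M) {p : M} (hp : p ∈ φ.source) :
    IsWeylTensor (g.metricAt φ p) (g.weylAt φ p) := by
  have hx : φ p ∈ φ.target := φ.map_source hp
  apply isWeylTensor_weyl
  · intro y i j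
    exact g.symm _ _ _
  · intro i j
    exact (g.smooth φ hφ i j).contDiffAt (φ.open_target.mem_nhds hx)
  · obtain ⟨L, hL, h⟩ := exists_orthonormal_frame g hφ hp
    intro h0
    have := congrArg Matrix.det h
    rw [Matrix.det_mul, Matrix.det_mul, LorentzianMetric.metricAt, h0, eta_det] at this
    norm_num at this

/-! ### The canonical frame of a type I Weyl tensor -/

theorem map_re_mul {l m n : Type*} [Fintype m] (A : Matrix l m ℝ) (Z : Matrix m n ℂ) :
    (cplx A * Z).map Complex.re = A * Z.map Complex.re := by
  ext i j
  simp [Matrix.mul_apply]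

theorem map_re_mul' {l m n : Type*} [Fintype m] (Z : Matrix l m ℂ) (A : Matrix m n ℝ) :
    (Z * cplx A).map Complex.re = Z.map Complex.re * A := by
  ext i j
  simp [Matrix.mul_apply]

theorem sdTensor_eq (Q : Matrix (Fin 3) (Fin 3) ℂ) (a b c d : Fin 4) :
    (sdCol * Q * sdColᵀ) (a, b) (c, d) = sdTensor Q a b c d := by
  simp only [sdCol, Matrix.mul_apply, Matrix.of_apply, Matrix.transpose_apply, sdTensor,
    Finset.sum_mul]
  rw [Finset.sum_comm]
  refine Finset.sum_congr rfl fun _ _ => Finset.sum_congr rfl fun _ _ => ?_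
  ring

theorem flat_ofSd (Q : Matrix (Fin 3) (Fin 3) ℂ) :
    flat (ofSd Q) = -((sdCol * Q * sdColᵀ).map Complex.re) := by
  ext ⟨a, b⟩ ⟨c, d⟩
  rw [Matrix.neg_apply, Matrix.map_apply, sdTensor_eq]
  rfl

/-- If L acts on the basis bivectors through N, then Q changes as a quadratic form. Taking real
parts commutes with L because L is real. -/
theorem pull_ofSd {L : Matrix (Fin 4) (Fin 4) ℝ} {N : Matrix (Fin 3) (Fin 3) ℂ}
    (h : ∀ i, (cplx L)ᵀ * sdForm i * cplx L = ∑ k, N k i • sdForm k) (Q : Matrix (Fin 3) (Fin 3) ℂ) :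
    pull L (ofSd Q) = ofSd (N * Q * Nᵀ) := by
  have hcol : (cplx (L ⊗ₖ L))ᵀ * sdCol = sdCol * N := by
    ext ⟨a, b⟩ i
    have h1 := kronecker_transpose_mulVec L (fun P => sdForm i P.1 P.2) a b
    have h2 := congrFun (congrFun (h i) a) b
    refine Eq.trans h1 (Eq.trans h2 ?_)
    simp [Matrix.sum_apply, Matrix.mul_apply, sdCol, mul_comm]
  apply flat_injective
  rw [flat_pull, flat_ofSd, flat_ofSd, Matrix.mul_neg, Matrix.neg_mul, ← map_re_mul, ← map_re_mul']
  congr 2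
  rw [cplx_transpose]
  calc _ = ((cplx (L ⊗ₖ L))ᵀ * sdCol) * Q * ((cplx (L ⊗ₖ L))ᵀ * sdCol)ᵀ := by
        rw [Matrix.transpose_mul, Matrix.transpose_transpose]
        simp only [Matrix.mul_assoc]
    _ = _ := by
        rw [hcol, Matrix.transpose_mul]
        simp only [Matrix.mul_assoc]

/-- The self-dual endomorphism with components `v`. -/
noncomputable def sdMap (v : Fin 3 → ℂ) : Matrix (Fin 4) (Fin 4) ℂ :=
  !![0, v 0, v 1, v 2; v 0, 0, -Complex.I * v 2, Complex.I * v 1;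
    v 1, Complex.I * v 2, 0, -Complex.I * v 0; v 2, -Complex.I * v 1, Complex.I * v 0, 0]

theorem sdMap_eq_sum (v : Fin 3 → ℂ) : sdMap v = ∑ i, v i • sdEndo i := by
  ext a b
  fin_cases a <;> fin_cases b <;>
    simp [sdMap, sdEndo, Fin.sum_univ_three, mul_comm]

/-- The multiplication rule of the Pauli matrices, here for endomorphisms of ℂ⁴. -/
theorem sdMap_mul (v w : Fin 3 → ℂ) :
    sdMap v * sdMap w = (v ⬝ᵥ w) • (1 : Matrix (Fin 4) (Fin 4) ℂ) + Complex.I • sdMap (v ⨯₃ w) := by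
  have hI : Complex.I ^ 2 = -1 := Complex.I_sq
  ext a b
  fin_cases a <;> fin_cases b <;>
    simp [sdMap, Matrix.mul_apply, Fin.sum_univ_four, dotProduct, Fin.sum_univ_three,
      cross_apply] <;> ring_nf <;> simp only [hI] <;> ring

/-- The complex conjugate of a matrix. -/
noncomputable abbrev cconj {m n : Type*} (A : Matrix m n ℂ) : Matrix m n ℂ := A.map conj

/-- Self-dual and anti-self-dual endomorphisms commute: they are the two commuting summands of the
complexified Lorentz algebra. -/
theorem sdMap_mul_conj (v w : Fin 3 → ℂ) :
    sdMap v * cconj (sdMap w) = cconj (sdMap w) * sdMap v := by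
  have hI : Complex.I ^ 2 = -1 := Complex.I_sq
  ext a b
  fin_cases a <;> fin_cases b <;>
    simp [sdMap, Matrix.mul_apply, Fin.sum_univ_four] <;> ring_nf <;> simp only [hI] <;> ring

theorem sdMap_transpose_mul_eta (v : Fin 3 → ℂ) :
    (sdMap v)ᵀ * cplx eta = -(cplx eta * sdMap v) := by
  ext a b
  fin_cases a <;> fin_cases b <;>
    simp [sdMap, Matrix.mul_apply, Fin.sum_univ_four, eta]

/-- As Q is symmetric, eigenvectors of different eigenvalues are orthogonal for the bilinear (not
Hermitian) product. They can be normalised by complex square roots once none of them is isotropic.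
-/
theorem exists_diagonalization {Q : Matrix (Fin 3) (Fin 3) ℂ} (hQ : Qᵀ = Q) {ρ : Fin 3 → ℂ}
    (hρ : Function.Injective ρ) (h : ∀ i, ∃ f : Fin 3 → ℂ, f ≠ 0 ∧ Q *ᵥ f = ρ i • f) :
    ∃ V : Matrix (Fin 3) (Fin 3) ℂ, V * Vᵀ = 1 ∧ V.det = 1 ∧ V * Q * Vᵀ = Matrix.diagonal ρ := by
  choose f hf0 hf using h
  have hli : LinearIndependent ℂ f := by
    apply Module.End.eigenvectors_linearIndependent' (Matrix.toLin' Q) ρ hρ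
    intro i
    rw [Module.End.hasEigenvector_iff, Module.End.mem_eigenspace_iff, Matrix.toLin'_apply]
    exact ⟨hf i, hf0 i⟩
  have horth : ∀ i j, i ≠ j → f i ⬝ᵥ f j = 0 := by
    intro i j hij
    have h1 : f i ⬝ᵥ Q *ᵥ f j = ρ i * (f i ⬝ᵥ f j) := by
      rw [Matrix.dotProduct_mulVec, ← Matrix.mulVec_transpose, hQ, hf, smul_dotProduct, smul_eq_mul]
    rw [hf, dotProduct_smul, smul_eq_mul] at h1
    have h2 : (ρ i - ρ j) * (f i ⬝ᵥ f j) = 0 := by linear_combination -h1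
    rcases mul_eq_zero.1 h2 with h3 | h3
    · exact absurd (hρ (sub_eq_zero.1 h3)) hij
    · exact h3
  let P : Matrix (Fin 3) (Fin 3) ℂ := Matrix.of f
  have hP : P * Pᵀ = Matrix.diagonal fun i => f i ⬝ᵥ f i := by
    ext i j
    rw [Matrix.diagonal_apply]
    split_ifs with hij
    · subst hij; rfl
    · exact horth i j hij
  have hPu : IsUnit P := Matrix.linearIndependent_rows_iff_isUnit.1 hli
  -- Three independent orthogonal vectors have an invertible diagonal Gram matrix, which excludes
  -- isotropic eigenvectors.
  have hnn : ∀ i, f i ⬝ᵥ f i ≠ 0 := by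
    have h1 : (P * Pᵀ).det ≠ 0 := by
      rw [Matrix.det_mul, Matrix.det_transpose]
      have := ((Matrix.isUnit_iff_isUnit_det _).1 hPu).ne_zero
      exact mul_ne_zero this this
    rw [hP, Matrix.det_diagonal, Finset.prod_ne_zero_iff] at h1
    exact fun i => h1 i (Finset.mem_univ i)
  have hsq : ∀ i, ∃ c : ℂ, c ^ 2 = f i ⬝ᵥ f i := fun i => IsAlgClosed.exists_pow_nat_eq _ two_pos
  choose c hc using hsq
  have hc0 : ∀ i, c i ≠ 0 := by
    intro i h0
    apply hnn i
    rw [← hc, h0]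
    simp
  let V : Matrix (Fin 3) (Fin 3) ℂ := Matrix.of fun i => (c i)⁻¹ • f i
  have hV : V * Vᵀ = 1 := by
    ext i j
    change ((c i)⁻¹ • f i) ⬝ᵥ ((c j)⁻¹ • f j) = _
    rw [smul_dotProduct, dotProduct_smul, smul_eq_mul, smul_eq_mul, Matrix.one_apply]
    split_ifs with hij
    · subst hij
      rw [← hc]
      field_simp [hc0 i]
    · rw [horth i j hij]
      simp
  have hVQ : V * Q * Vᵀ = Matrix.diagonal ρ := by
    have h1 : Q * Vᵀ = Vᵀ * Matrix.diagonal ρ := by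
      ext i j
      rw [Matrix.mul_diagonal]
      have : (Q *ᵥ ((c j)⁻¹ • f j)) i = (((c j)⁻¹ • f j) i) * ρ j := by
        rw [Matrix.mulVec_smul, hf]
        simp only [Pi.smul_apply, smul_eq_mul]
        ring
      exact this
    rw [Matrix.mul_assoc, h1, ← Matrix.mul_assoc, hV, Matrix.one_mul]
  have hdet : V.det = 1 ∨ V.det = -1 := by
    have := congrArg Matrix.det hV
    rw [Matrix.det_mul, Matrix.det_transpose, Matrix.det_one, mul_self_eq_one_iff] at this
    exact this
  rcases hdet with h1 | h1
  · exact ⟨V, hV, h1, hVQ⟩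
  · refine ⟨-V, ?_, ?_, ?_⟩
    · simpa using hV
    · rw [Matrix.det_neg, h1]
      norm_num
    · simpa using hVQ

/-- For determinant one the inverse Vᵀ is the adjugate, whose entries are the components of the
cross products of the rows. -/
theorem cross_of_orthogonal {V : Matrix (Fin 3) (Fin 3) ℂ} (h : V * Vᵀ = 1) (hd : V.det = 1) :
    V 0 ⨯₃ V 1 = V 2 ∧ V 1 ⨯₃ V 2 = V 0 ∧ V 2 ⨯₃ V 0 = V 1 := by
  have h1 : V.adjugate = Vᵀ := by
    have h2 : V⁻¹ = Vᵀ := Matrix.inv_eq_right_inv h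
    rw [← h2, Matrix.inv_def, hd]
    simp
  have h3 := fun i j => congrFun (congrFun h1 i) j
  simp only [Matrix.adjugate_fin_three, Matrix.transpose_apply] at h3
  refine ⟨?_, ?_, ?_⟩
  · ext i
    rw [← h3 i 2]
    fin_cases i <;> (simp [cross_apply]; try ring)
  · ext i
    rw [← h3 i 0]
    fin_cases i <;> (simp [cross_apply]; try ring)
  · ext i
    rw [← h3 i 1]
    fin_cases i <;> (simp [cross_apply]; try ring)

theorem cconj_mul {l m n : Type*} [Fintype m] (A : Matrix l m ℂ) (B : Matrix m n ℂ) :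
    cconj (A * B) = cconj A * cconj B := Matrix.map_mul

theorem cconj_cconj {m n : Type*} (A : Matrix m n ℂ) : cconj (cconj A) = A := by
  ext i j
  simp

/-- The Clifford relations of the self-dual endomorphisms of an orthonormal basis, their
conjugates, and the projection onto the common fixed vectors of the products. -/
theorem exists_principal_projection {A B : Fin 3 → Matrix (Fin 4) (Fin 4) ℂ}
    (hA : ∀ i, A i * A i = 1) (hB : ∀ i, B i * B i = 1) (hAB : ∀ i j, B i * A j = A j * B i)
    (h01 : A 0 * A 1 = Complex.I • A 2) (h12 : A 1 * A 2 = Complex.I • A 0)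
    (h20 : A 2 * A 0 = Complex.I • A 1)
    (h10 : A 1 * A 0 = -(Complex.I • A 2)) (h21 : A 2 * A 1 = -(Complex.I • A 0))
    (h02 : A 0 * A 2 = -(Complex.I • A 1))
    (k01 : B 0 * B 1 = -(Complex.I • B 2)) (k12 : B 1 * B 2 = -(Complex.I • B 0))
    (k20 : B 2 * B 0 = -(Complex.I • B 1))
    (k10 : B 1 * B 0 = Complex.I • B 2) (k21 : B 2 * B 1 = Complex.I • B 0)
    (k02 : B 0 * B 2 = Complex.I • B 1) (i : Fin 3) :
    A i * (1 + A 0 * B 0 + A 1 * B 1 + A 2 * B 2) = B i * (1 + A 0 * B 0 + A 1 * B 1 + A 2 * B 2) := by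
  have e : ∀ i j, A i * (A j * B j) = (A i * A j) * B j := fun i j => (Matrix.mul_assoc _ _ _).symm
  have e' : ∀ i j, B i * (A j * B j) = A j * (B i * B j) := fun i j => by
    rw [← Matrix.mul_assoc, hAB, Matrix.mul_assoc]
  simp only [Matrix.mul_add, e, e', Matrix.mul_one]
  -- For i = 0 both products become A₀ + B₀ + i A₂B₁ - i A₁B₂, and the other two cases follow
  -- cyclically.
  fin_cases i <;>
    simp only [Fin.zero_eta, Fin.mk_one, Fin.reduceFinMk, hA, hB, h01, h12, h20, h10, h21, h02,
      k01, k12, k20, k10, k21, k02, Matrix.one_mul, Matrix.mul_one, Matrix.neg_mul, Matrix.mul_neg,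
      Matrix.smul_mul, Matrix.mul_smul] <;> abel

/-- The complexified Minkowski product. -/
noncomputable def etaC (v w : Fin 4 → ℂ) : ℂ := v ⬝ᵥ cplx eta *ᵥ w

theorem etaC_comm (v w : Fin 4 → ℂ) : etaC v w = etaC w v := by
  rw [etaC, Matrix.dotProduct_mulVec, ← Matrix.mulVec_transpose, ← cplx_transpose, eta_transpose,
    dotProduct_comm, etaC]

/-- The vectors x, A₀x, A₁x, A₂x are real. They are orthogonal with squares -n, n, n, n, because
each Aₖ is skew for `eta` and the Aₖ obey the Pauli relations. Divided by √n they form an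
orthonormal frame, in which the Aₖ act by the standard matrices `sdEndo k`. -/
theorem exists_lorentz_of_principal_vector {A : Fin 3 → Matrix (Fin 4) (Fin 4) ℂ}
    (hA : ∀ i, A i * A i = 1)
    (h01 : A 0 * A 1 = Complex.I • A 2) (h12 : A 1 * A 2 = Complex.I • A 0)
    (h20 : A 2 * A 0 = Complex.I • A 1)
    (h10 : A 1 * A 0 = -(Complex.I • A 2)) (h21 : A 2 * A 1 = -(Complex.I • A 0))
    (h02 : A 0 * A 2 = -(Complex.I • A 1))
    (hAt : ∀ k, (A k)ᵀ * cplx eta = -(cplx eta * A k)) {x : Fin 4 → ℂ} {n : ℝ} (hn : 0 < n)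
    (hqx : etaC x x = -n) (hxc : ∀ a, conj (x a) = x a)
    (hyc : ∀ k a, conj ((A k *ᵥ x) a) = (A k *ᵥ x) a) :
    ∃ L : Matrix (Fin 4) (Fin 4) ℝ, Lᵀ * eta * L = eta ∧
      ∀ k, A k * cplx L = cplx L * sdEndo k := by
  obtain ⟨y, hy⟩ : ∃ y : Fin 3 → Fin 4 → ℂ, ∀ k, A k *ᵥ x = y k := ⟨_, fun k => rfl⟩
  simp only [hy] at hyc
  have hAA : ∀ k j, A k *ᵥ y j = (A k * A j) *ᵥ x := fun k j => by
    rw [← hy, Matrix.mulVec_mulVec]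
  have y00 : ∀ k, A k *ᵥ y k = x := fun k => by rw [hAA, hA, Matrix.one_mulVec]
  have y01 : A 0 *ᵥ y 1 = Complex.I • y 2 := by rw [hAA, h01, Matrix.smul_mulVec, hy]
  have y12 : A 1 *ᵥ y 2 = Complex.I • y 0 := by rw [hAA, h12, Matrix.smul_mulVec, hy]
  have y20 : A 2 *ᵥ y 0 = Complex.I • y 1 := by rw [hAA, h20, Matrix.smul_mulVec, hy]
  have y10 : A 1 *ᵥ y 0 = -(Complex.I • y 2) := by
    rw [hAA, h10, Matrix.neg_mulVec, Matrix.smul_mulVec, hy]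
  have y21 : A 2 *ᵥ y 1 = -(Complex.I • y 0) := by
    rw [hAA, h21, Matrix.neg_mulVec, Matrix.smul_mulVec, hy]
  have y02 : A 0 *ᵥ y 2 = -(Complex.I • y 1) := by
    rw [hAA, h02, Matrix.neg_mulVec, Matrix.smul_mulVec, hy]
  have hqA : ∀ k v w, etaC (A k *ᵥ v) w = -etaC v (A k *ᵥ w) := fun k v w => by
    rw [etaC, etaC, ← Matrix.vecMul_transpose, ← Matrix.dotProduct_mulVec, Matrix.mulVec_mulVec, hAt,
      Matrix.neg_mulVec, dotProduct_neg, Matrix.mulVec_mulVec]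
  have hqk : ∀ k, etaC x (y k) = 0 := fun k => by
    have := hqA k x x
    rw [etaC_comm, hy] at this
    linear_combination (1 / 2) * this
  have hqk' : ∀ k, etaC (y k) x = 0 := fun k => by rw [etaC_comm, hqk]
  have hqs : ∀ (c : ℂ) v w, etaC v (c • w) = c * etaC v w := fun c v w => by
    rw [etaC, Matrix.mulVec_smul, dotProduct_smul, smul_eq_mul, etaC]
  have hqn : ∀ v w, etaC v (-w) = -etaC v w := fun v w => by
    rw [etaC, Matrix.mulVec_neg, dotProduct_neg, etaC]
  have hqy : ∀ j k, etaC (y j) (y k) = -etaC x (A j *ᵥ y k) := fun j k => by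
    rw [← hqA, hy]
  clear hAA hAt
  let Lc : Matrix (Fin 4) (Fin 4) ℂ := Matrix.of fun a b => ![x, y 0, y 1, y 2] b a
  have hAL : ∀ k, A k * Lc = Lc * sdEndo k := by
    intro k
    have hcol : ∀ a b, (A k * Lc) a b = (A k *ᵥ ![x, y 0, y 1, y 2] b) a := fun a b => rfl
    ext a b
    rw [hcol, Matrix.mul_apply, Fin.sum_univ_four]
    fin_cases k <;> fin_cases b <;>
      simp [sdEndo, Lc, hy, y00, y01, y12, y20, y10, y21, y02, mul_comm (Complex.I)]
  have hmet : Lcᵀ * cplx eta * Lc = (n : ℂ) • cplx eta := by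
    have h1 : ∀ a b, (Lcᵀ * cplx eta * Lc) a b
        = etaC (![x, y 0, y 1, y 2] a) (![x, y 0, y 1, y 2] b) := by
      intro a b
      rw [Matrix.mul_assoc]
      rfl
    ext a b
    rw [h1]
    fin_cases a <;> fin_cases b <;>
      simp [hqk, hqk', hqx, hqy, y00, y01, y12, y20, y10, y21, y02, hqs, hqn, eta]
  let s : ℝ := (Real.sqrt n)⁻¹
  have hs : s * s * n = 1 := by
    have h1 := Real.mul_self_sqrt hn.le
    have h2 : Real.sqrt n ≠ 0 := (Real.sqrt_pos.2 hn).ne'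
    have h3 : s * Real.sqrt n = 1 := inv_mul_cancel₀ h2
    rw [← h1]
    linear_combination (s * Real.sqrt n + 1) * h3
  let L : Matrix (Fin 4) (Fin 4) ℝ := s • Lc.map Complex.re
  have hL : cplx L = (s : ℂ) • Lc := by
    have h1 : ∀ a b, ((Lc a b).re : ℂ) = Lc a b := by
      intro a b
      apply Complex.conj_eq_iff_re.1
      fin_cases b
      · exact hxc a
      · exact hyc 0 a
      · exact hyc 1 a
      · exact hyc 2 a
    ext a b
    simp [L, h1]
  refine ⟨L, ?_, ?_⟩
  · have h1 : cplx (Lᵀ * eta * L) = cplx eta := by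
      rw [cplx_mul, cplx_mul, cplx_transpose, hL]
      simp only [Matrix.transpose_smul, Matrix.smul_mul, Matrix.mul_smul, hmet, smul_smul]
      have : (s : ℂ) * s * n = 1 := by exact_mod_cast hs
      rw [← mul_assoc, this, one_smul]
    exact Matrix.map_injective (algebraMap ℝ ℂ).injective h1
  · intro k
    rw [hL, Matrix.mul_smul, Matrix.smul_mul]
    congr 1
    exact hAL k

/-- This is the surjectivity of the Lorentz group onto SO(3, ℂ). A Lorentz frame adapted to the rows
of V is generated by a real timelike x on which every Aₖ agrees with its conjugate Bₖ. The matrix R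
= 1 + ∑ AₖBₖ satisfies AₖR = BₖR and R² = 4R, and it is real since conjugation exchanges the
commuting Aₖ and Bₖ. Hence R applied to the standard time vector has the required properties. -/
theorem exists_lorentz_of_orthogonal {V : Matrix (Fin 3) (Fin 3) ℂ} (hV : V * Vᵀ = 1)
    (hd : V.det = 1) :
    ∃ L : Matrix (Fin 4) (Fin 4) ℝ, Lᵀ * eta * L = eta ∧
      ∀ k, sdMap (V k) * cplx L = cplx L * sdEndo k := by
  obtain ⟨c01, c12, c20⟩ := cross_of_orthogonal hV hd
  have hdot : ∀ i j, V i ⬝ᵥ V j = if i = j then 1 else 0 := by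
    intro i j
    have := congrFun (congrFun hV i) j
    rwa [Matrix.one_apply] at this
  let A : Fin 3 → Matrix (Fin 4) (Fin 4) ℂ := fun k => sdMap (V k)
  let B : Fin 3 → Matrix (Fin 4) (Fin 4) ℂ := fun k => cconj (sdMap (V k))
  have sneg : ∀ v, sdMap (-v) = -sdMap v := fun v => by
    rw [sdMap_eq_sum, sdMap_eq_sum, ← Finset.sum_neg_distrib]
    simp
  have hmul : ∀ i j, A i * A j = (if i = j then 1 else 0 : ℂ) • (1 : Matrix (Fin 4) (Fin 4) ℂ)
      + Complex.I • sdMap (V i ⨯₃ V j) := fun i j => by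
    rw [← hdot]; exact sdMap_mul _ _
  have hA : ∀ i, A i * A i = 1 := fun i => by
    have h0 : sdMap (0 : Fin 3 → ℂ) = 0 := by simp [sdMap_eq_sum]
    rw [hmul, cross_self, h0]
    simp
  have h01 : A 0 * A 1 = Complex.I • A 2 := by rw [hmul, c01]; simp [A]
  have h12 : A 1 * A 2 = Complex.I • A 0 := by rw [hmul, c12]; simp [A]
  have h20 : A 2 * A 0 = Complex.I • A 1 := by rw [hmul, c20]; simp [A]
  have h10 : A 1 * A 0 = -(Complex.I • A 2) := by
    rw [hmul, ← cross_anticomm, c01, sneg]; simp [A]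
  have h21 : A 2 * A 1 = -(Complex.I • A 0) := by
    rw [hmul, ← cross_anticomm, c12, sneg]; simp [A]
  have h02 : A 0 * A 2 = -(Complex.I • A 1) := by
    rw [hmul, ← cross_anticomm, c20, sneg]; simp [A]
  have hAB : ∀ i j, B i * A j = A j * B i := fun i j => (sdMap_mul_conj _ _).symm
  have hBc : ∀ i j, B i * B j = cconj (A i * A j) := fun i j => (cconj_mul _ _).symm
  have csm : ∀ k, cconj (Complex.I • A k) = -(Complex.I • B k) := fun k => by
    ext i j
    simp [A, B]
  have csm' : ∀ k, cconj (-(Complex.I • A k)) = Complex.I • B k := fun k => by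
    ext i j
    simp [A, B]
  have hB : ∀ i, B i * B i = 1 := fun i => by
    rw [hBc, hA]
    simp [cconj]
  set R : Matrix (Fin 4) (Fin 4) ℂ := 1 + A 0 * B 0 + A 1 * B 1 + A 2 * B 2 with hR
  have key : ∀ i, A i * R = B i * R := exists_principal_projection hA hB hAB h01 h12 h20 h10 h21 h02
    (by rw [hBc, h01, csm]) (by rw [hBc, h12, csm]) (by rw [hBc, h20, csm])
    (by rw [hBc, h10, csm']) (by rw [hBc, h21, csm']) (by rw [hBc, h02, csm'])
  have hRc : cconj R = R := by
    have h1 : ∀ k, cconj (A k * B k) = A k * B k := fun k => by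
      rw [cconj_mul, ← hAB]
      change cconj (A k) * cconj (cconj (A k)) = _
      rw [cconj_cconj]
    have h2 : cconj R = cconj 1 + cconj (A 0 * B 0) + cconj (A 1 * B 1) + cconj (A 2 * B 2) := by
      simp only [hR, cconj, Matrix.map_add _ (map_add (starRingEnd ℂ))]
    rw [h2, h1, h1, h1, hR]
    simp [cconj]
  have hRR : R * R = (4 : ℂ) • R := by
    have h1 : ∀ k, A k * B k * R = R := fun k => by
      rw [Matrix.mul_assoc, ← key, ← Matrix.mul_assoc, hA, Matrix.one_mul]
    nth_rewrite 1 [hR]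
    rw [Matrix.add_mul, Matrix.add_mul, Matrix.add_mul, h1, h1, h1, Matrix.one_mul]
    module
  have hAt : ∀ k, (A k)ᵀ * cplx eta = -(cplx eta * A k) := fun k => sdMap_transpose_mul_eta _
  have hBt : ∀ k, (B k)ᵀ * cplx eta = -(cplx eta * B k) := fun k => by
    have := congrArg cconj (hAt k)
    have hc : cconj (cplx eta) = cplx eta := by ext i j; simp
    rw [cconj_mul, hc] at this
    have hneg : ∀ Z : Matrix (Fin 4) (Fin 4) ℂ, cconj (-Z) = -cconj Z := fun Z => by ext i j; simp
    rw [hneg, cconj_mul, hc] at this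
    exact this
  have hRt : Rᵀ * cplx eta = cplx eta * R := by
    have h1 : ∀ k, (A k * B k)ᵀ * cplx eta = cplx eta * (A k * B k) := fun k => by
      rw [Matrix.transpose_mul, Matrix.mul_assoc, hAt, Matrix.mul_neg, ← Matrix.mul_assoc, hBt,
        Matrix.neg_mul, neg_neg, Matrix.mul_assoc, hAB]
    rw [hR]
    simp only [Matrix.transpose_add, Matrix.add_mul, Matrix.mul_add, h1, Matrix.transpose_one,
      Matrix.one_mul, Matrix.mul_one]
  let x : Fin 4 → ℂ := R *ᵥ Pi.single 0 1
  let y : Fin 3 → Fin 4 → ℂ := fun k => A k *ᵥ x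
  have hxc : ∀ a, conj (x a) = x a := fun a => by
    have := congrFun (congrFun hRc a) 0
    simpa [x] using this
  have hyc : ∀ k a, conj (y k a) = y k a := fun k a => by
    have h1 : y k a = (A k * R) a 0 := by
      simp only [y, x, Matrix.mulVec_single_one]
      rfl
    have h2 : cconj (A k * R) = A k * R := by
      rw [cconj_mul, hRc]
      exact (key k).symm
    rw [h1]
    exact congrFun (congrFun h2 a) 0
  -- By R² = 4R and the symmetry of R for `eta`, the square of x is -4 R₀₀, and R₀₀ = 1 + ∑ |Vₖᵢ|²
  -- is positive, so x is timelike.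
  let n : ℝ := 4 * (1 + ∑ k, ∑ i, Complex.normSq (V k i))
  have hn : 0 < n := by
    have : 0 ≤ ∑ k, ∑ i, Complex.normSq (V k i) :=
      Finset.sum_nonneg fun k _ => Finset.sum_nonneg fun i _ => Complex.normSq_nonneg _
    positivity
  have hqx : etaC x x = -n := by
    have h1 : etaC x x = 4 * (cplx eta * R) 0 0 := by
      have ht : ∀ v w : Fin 4 → ℂ, (R *ᵥ v) ⬝ᵥ w = v ⬝ᵥ Rᵀ *ᵥ w := fun v w => by
        rw [Matrix.dotProduct_mulVec, Matrix.vecMul_transpose]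
      rw [etaC, ht, Matrix.mulVec_mulVec, hRt, Matrix.mulVec_mulVec, Matrix.mul_assoc, hRR]
      simp
    have h2 : R 0 0 = 1 + ∑ k, ∑ i, (Complex.normSq (V k i) : ℂ) := by
      simp only [hR, A, B, Matrix.add_apply, Matrix.mul_apply, Fin.sum_univ_four,
        Fin.sum_univ_three, ← Complex.mul_conj]
      simp [sdMap]
      ring
    have h3 : (cplx eta * R) 0 0 = -R 0 0 := by
      simp [Matrix.mul_apply, Fin.sum_univ_four, eta]
    rw [h1, h3, h2]
    simp only [n]
    push_cast
    ring
  exact exists_lorentz_of_principal_vector hA h01 h12 h20 h10 h21 h02 hAt hn hqx hxc hyc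

/-- The reflection sends each basis bivector to plus or minus its conjugate. The sign appears twice
in a diagonal tensor, so reversing the orientation only conjugates the eigenvalues. -/
theorem pull_reflect_diagonal (ρ : Fin 3 → ℂ) :
    pull reflect (ofSd (Matrix.diagonal ρ)) = ofSd (Matrix.diagonal fun i => conj (ρ i)) := by
  have h1 : ∀ W a b c d, pull reflect W a b c d
      = ![1, 1, 1, -1] a * ![1, 1, 1, -1] b * ![1, 1, 1, -1] c * ![1, 1, 1, -1] d * W a b c d := by
    intro W a b c d
    simp [pull, reflect, Matrix.diagonal_apply]
  have h2 : ∀ i a b, (![1, 1, 1, -1] a : ℂ) * ![1, 1, 1, -1] b * sdForm i a b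
      = ![1, 1, -1] i * conj (sdForm i a b) := by
    intro i a b
    fin_cases i <;> fin_cases a <;> fin_cases b <;> simp [sdForm]
  have h3 : ∀ a, (((![1, 1, 1, -1] : Fin 4 → ℝ) a : ℝ) : ℂ) = (![1, 1, 1, -1] : Fin 4 → ℂ) a := by
    intro a
    fin_cases a <;> simp
  have h4 : ∀ i, (![1, 1, -1] : Fin 3 → ℂ) i * ![1, 1, -1] i = 1 := by
    intro i
    fin_cases i <;> simp
  funext a b c d
  rw [h1]
  simp only [ofSd]
  rw [← Complex.conj_re (sdTensor (Matrix.diagonal ρ) a b c d), mul_neg, ← Complex.re_ofReal_mul]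
  congr 2
  simp only [sdTensor, Matrix.diagonal_apply, ite_mul, zero_mul, Finset.sum_ite_eq, Finset.mem_univ,
    if_true, map_sum, map_mul, Finset.mul_sum]
  refine Finset.sum_congr rfl fun i _ => ?_
  push_cast
  simp only [h3]
  have e1 := congrArg conj (h2 i a b)
  have e2 := congrArg conj (h2 i c d)
  have e3 : ∀ a, conj ((![1, 1, 1, -1] : Fin 4 → ℂ) a) = (![1, 1, 1, -1] : Fin 4 → ℂ) a := by
    intro a
    rw [← h3, Complex.conj_ofReal]
  have e4 : conj ((![1, 1, -1] : Fin 3 → ℂ) i) = (![1, 1, -1] : Fin 3 → ℂ) i := by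
    fin_cases i <;> simp
  simp only [map_mul, e3, e4, Complex.conj_conj] at e1 e2
  calc _ = conj (ρ i) * ((![1, 1, 1, -1] : Fin 4 → ℂ) a * (![1, 1, 1, -1] : Fin 4 → ℂ) b
          * conj (sdForm i a b)) * ((![1, 1, 1, -1] : Fin 4 → ℂ) c * (![1, 1, 1, -1] : Fin 4 → ℂ) d
          * conj (sdForm i c d)) := by ring
    _ = conj (ρ i) * ((![1, 1, -1] : Fin 3 → ℂ) i * ![1, 1, -1] i) * sdForm i a b * sdForm i c d := by
        rw [e1, e2]; ring
    _ = _ := by rw [h4, mul_one]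

/-- A type I Weyl tensor is diagonal in some orthonormal frame. -/
theorem exists_principal_frame {Q : Matrix (Fin 3) (Fin 3) ℂ} (hQ : Qᵀ = Q) (htr : Q.trace = 0)
    {ρ : Fin 3 → ℂ} (hρ : Function.Injective ρ)
    (h : ∀ i, IsWeylEigenvalue eta (ofSd Q) (ρ i)) :
    ∃ (L : Matrix (Fin 4) (Fin 4) ℝ) (σ : Fin 3 → ℂ), 0 < L.det ∧ Lᵀ * eta * L = eta ∧
      Function.Injective σ ∧ ∑ i, σ i = 0 ∧ pull L (ofSd Q) = ofSd (Matrix.diagonal σ) := by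
  obtain ⟨V, hV, hd, hVQ⟩ := exists_diagonalization hQ hρ
    fun i => (isWeylEigenvalue_ofSd Q _).1 (h i)
  obtain ⟨L, hL, hLS⟩ := exists_lorentz_of_orthogonal hV hd
  have hV' : Vᵀ * V = 1 := mul_eq_one_comm.1 hV
  have hsum : ∑ i, ρ i = 0 := by
    rw [← Matrix.trace_diagonal, ← hVQ, Matrix.trace_mul_comm, ← Matrix.mul_assoc, hV',
      Matrix.one_mul, htr]
  have hS : ∀ i, sdEndo i = ∑ k, V k i • sdMap (V k) := by
    intro i
    simp only [sdMap_eq_sum, Finset.smul_sum, smul_smul]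
    rw [Finset.sum_comm]
    have : ∀ j, ∑ k, V k i * V k j = if i = j then 1 else 0 := by
      intro j
      rw [← Matrix.one_apply, ← hV', Matrix.mul_apply]
      rfl
    simp only [← Finset.sum_smul, this]
    simp
  have hpull : pull L (ofSd Q) = ofSd (Matrix.diagonal ρ) := by
    rw [pull_ofSd (N := V), hVQ]
    intro i
    rw [sdForm_eq, hS]
    simp only [Matrix.mul_sum, Matrix.sum_mul, Matrix.mul_smul, Matrix.smul_mul]
    refine Finset.sum_congr rfl fun k _ => ?_
    congr 1
    rw [sdForm_eq, Matrix.mul_assoc, Matrix.mul_assoc, hLS, ← Matrix.mul_assoc, ← Matrix.mul_assoc,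
      ← cplx_transpose, ← cplx_mul, ← cplx_mul, hL]
  rcases (lorentz_det_ne_zero hL).lt_or_gt with h0 | h0
  · refine ⟨L * reflect, fun i => conj (ρ i), ?_, reflect_mul_eta hL, ?_, ?_, ?_⟩
    · rw [Matrix.det_mul, reflect_det]
      linarith
    · exact (RingHom.injective _).comp hρ
    · rw [← map_sum, hsum, map_zero]
    · rw [← pull_pull, hpull, pull_reflect_diagonal]
  · exact ⟨L, ρ, h0, hL, hρ, hsum, hpull⟩

/-! ### The Bel-Robinson tensor -/

theorem cplx_eta : cplx eta = !![-1, 0, 0, 0; 0, 1, 0, 0; 0, 0, 1, 0; 0, 0, 0, 1] := by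
  ext a b
  fin_cases a <;> fin_cases b <;> simp [eta]

/-- The symmetric traceless tensors `S i ⊗ conj (S k)`. -/
noncomputable def sdSym : Fin 3 → Fin 3 → Matrix (Fin 4) (Fin 4) ℂ :=
    ![![!![1, 0, 0, 0; 0, -1, 0, 0; 0, 0, 1, 0; 0, 0, 0, 1],
        !![0, 0, 0, -Complex.I; 0, 0, -1, 0; 0, -1, 0, 0; -Complex.I, 0, 0, 0],
        !![0, 0, Complex.I, 0; 0, 0, 0, -1; Complex.I, 0, 0, 0; 0, -1, 0, 0]],
      ![!![0, 0, 0, Complex.I; 0, 0, -1, 0; 0, -1, 0, 0; Complex.I, 0, 0, 0],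
        !![1, 0, 0, 0; 0, 1, 0, 0; 0, 0, -1, 0; 0, 0, 0, 1],
        !![0, -Complex.I, 0, 0; -Complex.I, 0, 0, 0; 0, 0, 0, -1; 0, 0, -1, 0]],
      ![!![0, 0, -Complex.I, 0; 0, 0, 0, -1; -Complex.I, 0, 0, 0; 0, -1, 0, 0],
        !![0, Complex.I, 0, 0; Complex.I, 0, 0, 0; 0, 0, 0, -1; 0, 0, -1, 0],
        !![1, 0, 0, 0; 0, 1, 0, 0; 0, 0, 1, 0; 0, 0, 0, -1]]]

theorem sdForm_mul_cconj_sdEndo (i k : Fin 3) :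
    sdForm i * cconj (sdEndo k) = -sdSym i k := by
  fin_cases i <;> fin_cases k <;> ext a b <;> fin_cases a <;> fin_cases b <;>
    simp [sdForm, sdEndo, sdSym, Matrix.mul_apply, Fin.sum_univ_four]

theorem sdEndo_eq_sdMap (i : Fin 3) : sdEndo i = sdMap (Pi.single i 1) := by
  rw [sdMap_eq_sum]
  simp [Pi.single_apply]

theorem sdSym_eq_neg (i k : Fin 3) : sdSym i k
    = -(cplx eta * (sdMap (Pi.single i 1) * cconj (sdMap (Pi.single k 1)))) := by
  rw [← sdEndo_eq_sdMap, ← sdEndo_eq_sdMap, ← Matrix.mul_assoc, ← sdForm_eq,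
    sdForm_mul_cconj_sdEndo, neg_neg]

theorem cconj_cplx {m n : Type*} (A : Matrix m n ℝ) : cconj (cplx A) = cplx A := by
  ext i j
  simp

theorem cconj_neg {m n : Type*} (A : Matrix m n ℂ) : cconj (-A) = -cconj A := by
  ext i j
  simp

theorem cconj_sdSym (i k : Fin 3) : cconj (sdSym i k) = sdSym k i := by
  rw [sdSym_eq_neg, sdSym_eq_neg, cconj_neg, cconj_mul, cconj_mul, cconj_cconj, cconj_cplx,
    sdMap_mul_conj]

theorem sdSym_symm (i k : Fin 3) : (sdSym i k)ᵀ = sdSym i k := by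
  have h1 : ∀ v, (cconj (sdMap v))ᵀ * cplx eta = -(cplx eta * cconj (sdMap v)) := fun v => by
    have := congrArg cconj (sdMap_transpose_mul_eta v)
    rwa [cconj_mul, cconj_neg, cconj_mul, cconj_cplx] at this
  rw [sdSym_eq_neg, Matrix.transpose_neg, Matrix.transpose_mul, Matrix.transpose_mul,
    ← cplx_transpose, eta_transpose, Matrix.mul_assoc, sdMap_transpose_mul_eta, Matrix.mul_neg,
    ← Matrix.mul_assoc, h1, Matrix.neg_mul, Matrix.mul_assoc, ← sdMap_mul_conj, neg_neg]

theorem sdSym_eq (i k : Fin 3) : sdForm i * cplx eta * (cconj (sdForm k))ᵀ = sdSym i k := by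
  have h : cplx eta * (cconj (sdForm k))ᵀ = -cconj (sdEndo k) := by
    have h1 : (cconj (sdForm k))ᵀ = -(cplx eta * cconj (sdEndo k)) := by
      rw [← cconj_cplx, ← cconj_mul, ← sdForm_eq]
      ext a b
      simp [sdForm_antisymm k b a]
    rw [h1, Matrix.mul_neg, ← Matrix.mul_assoc, ← cplx_mul, eta_mul_eta]
    simp
  rw [Matrix.mul_assoc, h, Matrix.mul_neg, sdForm_mul_cconj_sdEndo, neg_neg]

theorem trace_sdMap_mul_cconj (v w : Fin 3 → ℂ) : (sdMap v * cconj (sdMap w)).trace = 0 := by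
  have hI : Complex.I ^ 2 = -1 := Complex.I_sq
  simp only [Matrix.trace, Matrix.diag_apply, Matrix.mul_apply, Fin.sum_univ_four]
  simp [sdMap]
  ring_nf
  simp only [hI]
  ring

theorem trace_sdMap (v : Fin 3 → ℂ) : (sdMap v).trace = 0 := by
  simp [Matrix.trace, sdMap, Fin.sum_univ_four]

/-- The metric pairing of two-index tensors in an orthonormal frame. -/
noncomputable def etaPair (A B : Matrix (Fin 4) (Fin 4) ℂ) : ℂ :=
  (cplx eta * A * (cplx eta * B)).trace

/-- The Pauli relations split the product into a self-dual factor and an anti-self-dual one. Only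
the scalar terms have a trace, so the nine tensors are orthogonal. -/
theorem etaPair_sdSym (i k j l : Fin 3) :
    etaPair (sdSym i k) (sdSym j l) = if i = j ∧ k = l then 4 else 0 := by
  have h : ∀ i k, cplx eta * sdSym i k = -(sdMap (Pi.single i 1) * cconj (sdMap (Pi.single k 1))) := by
    intro i k
    rw [sdSym_eq_neg, Matrix.mul_neg, ← Matrix.mul_assoc, ← cplx_mul, eta_mul_eta]
    simp
  rw [etaPair, h, h, neg_mul_neg, Matrix.mul_assoc, ← Matrix.mul_assoc (cconj _),
    ← sdMap_mul_conj, Matrix.mul_assoc, ← Matrix.mul_assoc, ← cconj_mul, sdMap_mul, sdMap_mul]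
  have e : ∀ (c : ℂ) (v : Fin 3 → ℂ), cconj (c • (1 : Matrix (Fin 4) (Fin 4) ℂ) + Complex.I • sdMap v)
      = conj c • (1 : Matrix (Fin 4) (Fin 4) ℂ) + (-Complex.I) • cconj (sdMap v) := by
    intro c v
    ext a b
    by_cases hab : a = b <;> simp [hab]
  have e2 : ∀ v, (cconj (sdMap v)).trace = 0 := fun v => by
    have := congrArg conj (trace_sdMap v)
    simpa [Matrix.trace] using this
  rw [e]
  simp only [Matrix.add_mul, Matrix.mul_add, Matrix.smul_mul, Matrix.mul_smul, Matrix.trace_add,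
    Matrix.trace_smul, trace_sdMap_mul_cconj, trace_sdMap, e2, Matrix.one_mul, Matrix.mul_one]
  by_cases h1 : i = j <;> by_cases h2 : k = l <;> simp [h1, h2]

theorem cross_ofSd (Q : Matrix (Fin 3) (Fin 3) ℂ) : cplx (cross (ofSd Q)) = -(1 / 2 : ℂ) •
    ((∑ i, ∑ j, Q i j • (sdForm i ⊗ₖ sdForm j))
      + cconj (∑ i, ∑ j, Q i j • (sdForm i ⊗ₖ sdForm j))) := by
  have h : ∀ a b r s, (∑ i, ∑ j, Q i j • (sdForm i ⊗ₖ sdForm j)) (a, b) (r, s)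
      = sdTensor Q a r b s := by
    intro a b r s
    simp [Matrix.sum_apply, sdTensor, mul_assoc]
  ext ⟨a, b⟩ ⟨r, s⟩
  simp only [Matrix.map_apply, Matrix.smul_apply, Matrix.add_apply, h, cross, Matrix.of_apply,
    Complex.coe_algebraMap, ofSd_cast, smul_eq_mul]

/-- With Z the self-dual part in the pairing (ac)(bd), W and its dual are -½(Z + Z̄) and -½(iZ -
iZ̄). In the sum of their squares the terms ZZ and Z̄Z̄ cancel, so T is sesquilinear in Q, carried
by the tensors Sᵢₖ ⊗ Sⱼₗ. -/
theorem belRobinson_ofSd (Q : Matrix (Fin 3) (Fin 3) ℂ) (a m b n : Fin 4) :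
    (belRobinson eta (ofSd Q) a m b n : ℂ) = (1 / 4) * ∑ i, ∑ j, ∑ k, ∑ l,
      Q i j * conj (Q k l) * sdSym i k a m * sdSym j l b n := by
  set Z : Matrix (Fin 4 × Fin 4) (Fin 4 × Fin 4) ℂ := ∑ i, ∑ j, Q i j • (sdForm i ⊗ₖ sdForm j)
    with hZ
  set H : Matrix (Fin 4 × Fin 4) (Fin 4 × Fin 4) ℂ := cplx (eta ⊗ₖ eta) with hH
  have hHk : H = cplx eta ⊗ₖ cplx eta := by
    ext ⟨a, b⟩ ⟨c, d⟩
    simp [hH]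
  have hI : ∑ i, ∑ j, (Complex.I • Q) i j • (sdForm i ⊗ₖ sdForm j) = Complex.I • Z := by
    simp only [hZ, Finset.smul_sum, Matrix.smul_apply, smul_eq_mul, mul_smul]
  have hIc : cconj (Complex.I • Z) = -Complex.I • cconj Z := by
    ext i j
    simp
  have h1 : cplx (cross (belRobinson eta (ofSd Q)))
      = (1 / 8 : ℂ) • (Z * H * (cconj Z)ᵀ + cconj Z * H * Zᵀ) := by
    rw [cross_belRobinson, dualWeyl_ofSd, eta_inv]
    have h2 : ∀ A B : Matrix (Fin 4 × Fin 4) (Fin 4 × Fin 4) ℝ,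
        cplx ((1 / 4 : ℝ) • (A * (eta ⊗ₖ eta) * Aᵀ + B * (eta ⊗ₖ eta) * Bᵀ))
        = (1 / 4 : ℂ) • (cplx A * H * (cplx A)ᵀ + cplx B * H * (cplx B)ᵀ) := by
      intro A B
      rw [← cplx_transpose, ← cplx_transpose, hH, ← cplx_mul, ← cplx_mul, ← cplx_mul, ← cplx_mul]
      ext i j
      simp only [Matrix.map_apply, Matrix.smul_apply, Matrix.add_apply, smul_eq_mul,
        Complex.coe_algebraMap]
      push_cast
      ring
    rw [h2, cross_ofSd, cross_ofSd, hI, hIc, ← hZ]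
    generalize cconj Z = Y
    simp only [Matrix.transpose_smul, Matrix.transpose_add, Matrix.add_mul, Matrix.mul_add,
      Matrix.smul_mul, Matrix.mul_smul, smul_add, smul_smul]
    have hII : Complex.I * Complex.I = -1 := Complex.I_mul_I
    match_scalars
    · linear_combination (1 / 16 : ℂ) * hII
    · linear_combination (-1 / 16 : ℂ) * hII
    · linear_combination (-1 / 16 : ℂ) * hII
    · linear_combination (1 / 16 : ℂ) * hII
  have h4 : Z * H * (cconj Z)ᵀ
      = ∑ i, ∑ j, ∑ k, ∑ l, (Q i j * conj (Q k l)) • (sdSym i k ⊗ₖ sdSym j l) := by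
    have hc : (cconj Z)ᵀ
        = ∑ k, ∑ l, conj (Q k l) • ((cconj (sdForm k))ᵀ ⊗ₖ (cconj (sdForm l))ᵀ) := by
      ext ⟨a, b⟩ ⟨c, d⟩
      simp [hZ, Matrix.sum_apply]
    rw [hc, hHk, hZ]
    simp only [Matrix.sum_mul]
    refine Finset.sum_congr rfl fun i _ => Finset.sum_congr rfl fun j _ => ?_
    simp only [Matrix.mul_sum]
    refine Finset.sum_congr rfl fun k _ => Finset.sum_congr rfl fun l _ => ?_
    simp only [Matrix.smul_mul, Matrix.mul_smul, smul_smul, ← Matrix.mul_kronecker_mul, sdSym_eq]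
    rw [mul_comm]
  -- The two mixed terms are conjugate to each other, and the sum is invariant under conjugation
  -- since conj Sᵢₖ = Sₖᵢ.
  have h5 : cconj Z * H * Zᵀ = Z * H * (cconj Z)ᵀ := by
    have h6 : cconj Z * H * Zᵀ = cconj (Z * H * (cconj Z)ᵀ) := by
      rw [cconj_mul, cconj_mul]
      have e1 : cconj H = H := by ext i j; simp [hH]
      have e2 : cconj (cconj Z)ᵀ = Zᵀ := by ext i j; simp
      rw [e1, e2]
    rw [h6, h4]
    have h7 : cconj (∑ i, ∑ j, ∑ k, ∑ l, (Q i j * conj (Q k l)) • (sdSym i k ⊗ₖ sdSym j l))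
        = ∑ i, ∑ j, ∑ k, ∑ l, (Q k l * conj (Q i j)) • (sdSym k i ⊗ₖ sdSym l j) := by
      ext ⟨a, b⟩ ⟨c, d⟩
      have e3 : ∀ i k a b, conj (sdSym i k a b) = sdSym k i a b := fun i k a b =>
        congrFun (congrFun (cconj_sdSym i k) a) b
      simp [Matrix.sum_apply, e3, mul_comm]
    rw [h7]
    conv_lhs => enter [2, i]; rw [Finset.sum_comm]; enter [2, k]; rw [Finset.sum_comm]
    rw [Finset.sum_comm]
    conv_lhs => enter [2, k]; rw [Finset.sum_comm]
  have h8 := congrFun (congrFun h1 (a, b)) (m, n)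
  rw [h5, h4] at h8
  have h9 : cplx (cross (belRobinson eta (ofSd Q))) (a, b) (m, n)
      = belRobinson eta (ofSd Q) a m b n := rfl
  rw [← h9, h8]
  simp only [Matrix.smul_apply, Matrix.add_apply, Matrix.sum_apply, Matrix.kroneckerMap_apply,
    smul_eq_mul, mul_assoc]
  ring

/-- The nine pairings and the trace are ten independent linear conditions on the ten components of a
symmetric tensor. -/
theorem eq_zero_of_etaPair_sdSym {A : Matrix (Fin 4) (Fin 4) ℂ} (hs : Aᵀ = A)
    (ht : (cplx eta * A).trace = 0) (h : ∀ i k, etaPair (sdSym i k) A = 0) : A = 0 := by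
  have hs' : ∀ a b, A a b = A b a := fun a b => congrFun (congrFun hs b) a
  have hI : Complex.I * Complex.I = -1 := Complex.I_mul_I
  have e : ∀ X, etaPair X A = X 0 0 * A 0 0 - X 0 1 * A 1 0 - X 0 2 * A 2 0 - X 0 3 * A 3 0
      - X 1 0 * A 0 1 + X 1 1 * A 1 1 + X 1 2 * A 2 1 + X 1 3 * A 3 1
      - X 2 0 * A 0 2 + X 2 1 * A 1 2 + X 2 2 * A 2 2 + X 2 3 * A 3 2
      - X 3 0 * A 0 3 + X 3 1 * A 1 3 + X 3 2 * A 2 3 + X 3 3 * A 3 3 := by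
    intro X
    simp only [etaPair, cplx_eta, Matrix.trace, Matrix.diag_apply, Matrix.mul_apply,
      Fin.sum_univ_four]
    simp
    ring
  have t : -A 0 0 + A 1 1 + A 2 2 + A 3 3 = 0 := by
    simp only [cplx_eta, Matrix.trace, Matrix.diag_apply, Matrix.mul_apply,
      Fin.sum_univ_four] at ht
    simpa using ht
  have p00 : A 0 0 - A 1 1 + A 2 2 + A 3 3 = 0 := by simpa [e, sdSym, ← sub_eq_add_neg] using h 0 0
  have p11 : A 0 0 + A 1 1 - A 2 2 + A 3 3 = 0 := by simpa [e, sdSym, ← sub_eq_add_neg] using h 1 1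
  have p22 : A 0 0 + A 1 1 + A 2 2 - A 3 3 = 0 := by simpa [e, sdSym, ← sub_eq_add_neg] using h 2 2
  have p01 := h 0 1
  have p10 := h 1 0
  have p02 := h 0 2
  have p20 := h 2 0
  have p12 := h 1 2
  have p21 := h 2 1
  simp only [e, hs' 1 0, hs' 2 0, hs' 3 0, hs' 2 1, hs' 3 1, hs' 3 2] at p01 p10 p02 p20 p12 p21
  simp only [sdSym, Matrix.cons_val] at p01 p10 p02 p20 p12 p21
  simp at p01 p10 p02 p20 p12 p21
  have q00 : A 0 0 = 0 := by linear_combination (1 / 4 : ℂ) * (p00 + p11 + p22 - t)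
  have q11 : A 1 1 = 0 := by linear_combination (1 / 4 : ℂ) * (t - p00 + p11 + p22)
  have q22 : A 2 2 = 0 := by linear_combination (1 / 4 : ℂ) * (t + p00 - p11 + p22)
  have q33 : A 3 3 = 0 := by linear_combination (1 / 4 : ℂ) * (t + p00 + p11 - p22)
  have q03 : A 0 3 = 0 := by linear_combination (-Complex.I / 4) * (p01 - p10) + A 0 3 * hI
  have q12 : A 1 2 = 0 := by linear_combination (-1 / 4 : ℂ) * (p01 + p10)
  have q02 : A 0 2 = 0 := by linear_combination (Complex.I / 4) * (p02 - p20) + A 0 2 * hI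
  have q13 : A 1 3 = 0 := by linear_combination (-1 / 4 : ℂ) * (p02 + p20)
  have q01 : A 0 1 = 0 := by linear_combination (-Complex.I / 4) * (p12 - p21) + A 0 1 * hI
  have q23 : A 2 3 = 0 := by linear_combination (-1 / 4 : ℂ) * (p12 + p21)
  ext a b
  fin_cases a <;> fin_cases b <;>
    simp [q00, q11, q22, q33, q01, q02, q03, q12, q13, q23, hs' 1 0, hs' 2 0, hs' 3 0, hs' 2 1,
      hs' 3 1, hs' 3 2]

theorem belRobinson_ofSd_diagonal_mulVec (σ : Fin 3 → ℂ) {A : Matrix (Fin 4) (Fin 4) ℂ}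
    (hA : Aᵀ = A) (a b : Fin 4) :
    ((cplx (flat (belRobinson eta (ofSd (diagonal σ)))) * cplx (eta ⊗ₖ eta)) *ᵥ
      fun P => A P.1 P.2) (a, b)
    = (1 / 4) * ∑ i, ∑ k, σ i * conj (σ k) * etaPair (sdSym i k) A * sdSym i k a b := by
  have h1 : ∀ c d, ((belRobinson eta (ofSd (diagonal σ)) a b c d : ℝ) : ℂ)
      = (1 / 4) * ∑ i, ∑ k, σ i * conj (σ k) * sdSym i k a b * sdSym i k c d := by
    intro c d
    rw [belRobinson_ofSd]
    congr 1
    refine Finset.sum_congr rfl fun i _ => ?_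
    rw [Finset.sum_eq_single i (fun j _ hj => by simp [hj.symm]) (by simp)]
    refine Finset.sum_congr rfl fun k _ => ?_
    rw [Finset.sum_eq_single k (fun j _ hj => by simp [hj.symm]) (by simp)]
    simp
  have h3 : cplx (eta ⊗ₖ eta) = cplx eta ⊗ₖ cplx eta := by
    ext ⟨a, b⟩ ⟨c, d⟩
    simp
  have h2 : ∀ e f, (cplx (eta ⊗ₖ eta) *ᵥ fun P : Fin 4 × Fin 4 => A P.1 P.2) (e, f)
      = (cplx eta * A * cplx eta) e f := by
    intro e f
    rw [h3]
    simp only [Matrix.mulVec, dotProduct, Fintype.sum_prod_type, Matrix.kroneckerMap_apply,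
      Matrix.mul_apply, Finset.sum_mul]
    rw [Finset.sum_comm]
    refine Finset.sum_congr rfl fun i _ => Finset.sum_congr rfl fun k _ => ?_
    have : cplx eta f i = cplx eta i f := by
      rw [← Matrix.transpose_apply (cplx eta) i f, ← cplx_transpose, eta_transpose]
    rw [this]
    ring
  have h4 : ∀ X : Matrix (Fin 4) (Fin 4) ℂ, ∑ e, ∑ f, X e f * (cplx eta * A * cplx eta) e f
      = etaPair X A := by
    intro X
    have : ∑ e, ∑ f, X e f * (cplx eta * A * cplx eta) e f
        = (X * (cplx eta * A * cplx eta)ᵀ).trace := rfl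
    rw [this, Matrix.transpose_mul, Matrix.transpose_mul, hA, ← cplx_transpose, eta_transpose,
      etaPair, Matrix.mul_assoc (cplx eta) X, Matrix.trace_mul_comm (cplx eta)]
    simp only [Matrix.mul_assoc]
  rw [← Matrix.mulVec_mulVec]
  have h5 : ∀ v, (cplx (flat (belRobinson eta (ofSd (diagonal σ)))) *ᵥ v) (a, b)
      = ∑ c, ∑ d, ((belRobinson eta (ofSd (diagonal σ)) a b c d : ℝ) : ℂ) * v (c, d) := by
    intro v
    simp only [Matrix.mulVec, dotProduct, Fintype.sum_prod_type]
    rfl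
  rw [h5]
  simp only [h2, h1, ← h4, Finset.mul_sum, Finset.sum_mul]
  conv_lhs => enter [2, c]; rw [Finset.sum_comm]; enter [2, i]; rw [Finset.sum_comm]
  rw [Finset.sum_comm]
  conv_lhs => enter [2, i]; rw [Finset.sum_comm]
  refine Finset.sum_congr rfl fun _ _ => Finset.sum_congr rfl fun _ _ =>
    Finset.sum_congr rfl fun _ _ => Finset.sum_congr rfl fun _ _ => ?_
  ring

/-- For diagonal Q, the endomorphism T multiplies each Sᵢₖ by σᵢ conj σₖ, and these nine orthogonal
tensors span the traceless symmetric ones. -/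
theorem belRobinsonEigenvalues_ofSd_diagonal (σ : Fin 3 → ℂ) :
    belRobinsonEigenvalues eta (ofSd (diagonal σ))
      = Set.range fun p : Fin 3 × Fin 3 => σ p.1 * conj (σ p.2) := by
  ext t
  rw [mem_belRobinsonEigenvalues_iff, eta_inv]
  constructor
  · rintro ⟨A, hA0, hs, ht, hT⟩
    set B : Matrix (Fin 4) (Fin 4) ℂ := Matrix.of fun i j => A (i, j) with hB
    rw [hs] at ht
    by_contra hne
    have hpair : ∀ X, t * etaPair X B = (1 / 4) * ∑ i, ∑ k, σ i * conj (σ k) *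
        etaPair (sdSym i k) B * etaPair X (sdSym i k) := by
      intro X
      have h1 : t • B = (1 / 4 : ℂ) • ∑ i, ∑ k,
          (σ i * conj (σ k) * etaPair (sdSym i k) B) • sdSym i k := by
        ext a b
        have := congrFun hT (a, b)
        have h2 := belRobinson_ofSd_diagonal_mulVec σ hs a b
        simp only [Matrix.smul_apply, Matrix.sum_apply, smul_eq_mul]
        rw [← h2]
        exact this.symm
      have := congrArg (etaPair X) h1
      simpa only [etaPair, Matrix.mul_smul, Matrix.trace_smul, Matrix.mul_sum, Matrix.trace_sum,
        smul_eq_mul] using this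
    have h0 : ∀ i k, etaPair (sdSym i k) B = 0 := by
      intro i k
      have h1 := hpair (sdSym i k)
      simp only [etaPair_sdSym] at h1
      rw [Finset.sum_eq_single i (fun j _ hj => by simp [hj.symm]) (by simp),
        Finset.sum_eq_single k (fun j _ hj => by simp [hj.symm]) (by simp)] at h1
      have h2 : (t - σ i * conj (σ k)) * etaPair (sdSym i k) B = 0 := by
        simp at h1
        linear_combination h1
      rcases mul_eq_zero.1 h2 with h3 | h3
      · exact absurd ⟨(i, k), (sub_eq_zero.1 h3).symm⟩ hne
      · exact h3
    apply hA0
    have := eq_zero_of_etaPair_sdSym hs ht h0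
    ext ⟨a, b⟩
    exact congrFun (congrFun this a) b
  · rintro ⟨⟨i, k⟩, rfl⟩
    refine ⟨fun P => sdSym i k P.1 P.2, ?_, sdSym_symm i k, ?_, ?_⟩
    · intro h0
      have h1 : sdSym i k = 0 := by
        ext a b
        exact congrFun h0 (a, b)
      have := etaPair_sdSym i k i k
      rw [h1] at this
      simp [etaPair] at this
    · change (cplx eta * (sdSym i k)ᵀ).trace = 0
      rw [sdSym_symm, sdSym_eq_neg, Matrix.mul_neg, ← Matrix.mul_assoc, ← cplx_mul, eta_mul_eta]
      simp [trace_sdMap_mul_cconj]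
    · ext ⟨a, b⟩
      rw [belRobinson_ofSd_diagonal_mulVec σ (sdSym_symm i k)]
      simp only [etaPair_sdSym]
      rw [Finset.sum_eq_single i (fun j _ hj => by simp [hj]) (by simp),
        Finset.sum_eq_single k (fun j _ hj => by simp [hj]) (by simp)]
      simp
      ring

/-! ### Observers without super-energy flux -/

theorem sdSym_succ_succ (i k m n : Fin 3) : sdSym i k m.succ n.succ
    = (if i = k then 1 else 0) * (if m = n then 1 else 0)
      - (if i = m then 1 else 0) * (if k = n then 1 else 0)
      - (if i = n then 1 else 0) * (if k = m then 1 else 0) := by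
  fin_cases i <;> fin_cases k <;> fin_cases m <;> fin_cases n <;>
    (simp only [sdSym, Fin.zero_eta, Fin.mk_one, Fin.reduceFinMk, Matrix.cons_val, Fin.succ_zero_eq_one,
      Fin.succ_one_eq_two, Fin.reduceSucc]; simp)

/-- The time-space components of Sⱼₗ form a cross product. The indices `b + 1`, `b + 2` are read
modulo three, so they are the cyclic successors of b. -/
theorem sdSym_succ_zero (b : Fin 3) (f : Fin 3 → Fin 3 → ℂ) :
    ∑ j, ∑ l, f j l * sdSym j l b.succ 0
    = -Complex.I * (f (b + 1) (b + 2) - f (b + 2) (b + 1)) := by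
  simp only [Fin.sum_univ_three]
  fin_cases b <;>
    (simp only [sdSym, Fin.zero_eta, Fin.mk_one, Fin.reduceFinMk, Matrix.cons_val, Fin.succ_zero_eq_one,
      Fin.succ_one_eq_two, Fin.reduceSucc]; simp; try ring)

theorem belRobinson_ofSd_flux (Q : Matrix (Fin 3) (Fin 3) ℂ) (m n b : Fin 3) :
    (belRobinson eta (ofSd Q) m.succ n.succ b.succ 0 : ℂ) = (1 / 4) * (-Complex.I *
      (((if m = n then 1 else 0) * ∑ i, Q i (b + 1) * conj (Q i (b + 2))
          - Q m (b + 1) * conj (Q n (b + 2)) - Q n (b + 1) * conj (Q m (b + 2)))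
      - ((if m = n then 1 else 0) * ∑ i, Q i (b + 2) * conj (Q i (b + 1))
          - Q m (b + 2) * conj (Q n (b + 1)) - Q n (b + 2) * conj (Q m (b + 1))))) := by
  have h : ∀ j l, ∑ i, ∑ k, Q i j * conj (Q k l) * sdSym i k m.succ n.succ
      = (if m = n then 1 else 0) * ∑ i, Q i j * conj (Q i l)
          - Q m j * conj (Q n l) - Q n j * conj (Q m l) := by
    intro j l
    simp only [sdSym_succ_succ, mul_sub, Finset.sum_sub_distrib]
    congr 1
    · congr 1
      · by_cases hmn : m = n <;> simp [hmn]
      · simp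
    · simp
  rw [belRobinson_ofSd]
  congr 1
  rw [← h, ← h, ← sdSym_succ_zero b fun j l => ∑ i, ∑ k, Q i j * conj (Q k l) * sdSym i k m.succ n.succ]
  simp only [Finset.sum_mul]
  rw [Finset.sum_comm]
  conv_lhs => enter [2, j]; enter [2, i]; rw [Finset.sum_comm]
  conv_lhs => enter [2, j]; rw [Finset.sum_comm]

/-- Here E and B are the electric and magnetic matrices. The trace of the flux condition makes them
commute. Contracting what remains with E leaves ⟨E,B⟩E - ⟨E,E⟩B plus terms that cancel by
commutativity, so E and B are proportional. -/
theorem proportional_of_flux_eq_zero {E B : Matrix (Fin 3) (Fin 3) ℝ} (hE : Eᵀ = E) (hB : Bᵀ = B)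
    (h : ∀ m n j l, B m j * E n l - E m j * B n l - B m l * E n j + E m l * B n j
      = (if m = n then 1 else 0) * ∑ i, (B i j * E i l - E i j * B i l)) :
    ∀ n l, (∑ m, ∑ j, E m j * B m j) * E n l = (∑ m, ∑ j, E m j * E m j) * B n l := by
  have hE' : ∀ a b, E a b = E b a := fun a b => congrFun (congrFun hE b) a
  have hB' : ∀ a b, B a b = B b a := fun a b => congrFun (congrFun hB b) a
  have hP : ∀ j l, ∑ i, (B i j * E i l - E i j * B i l) = 0 := by
    intro j l
    -- Writing P for the commutator, the trace over m = n reads 2P = 3P.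
    have h1 : ∑ m, (B m j * E m l - E m j * B m l - B m l * E m j + E m l * B m j)
        = ∑ m : Fin 3, ∑ i, (B i j * E i l - E i j * B i l) :=
      Finset.sum_congr rfl fun m _ => by simpa using h m m j l
    simp only [Fin.sum_univ_three] at h1 ⊢
    linear_combination -h1
  have hP' : ∀ j l, ∑ i, (B j i * E l i - E j i * B l i) = 0 := by
    intro j l
    rw [← hP j l]
    refine Finset.sum_congr rfl fun i _ => ?_
    rw [hE' l, hE' j, hB' j, hB' l]
  simp only [hP, mul_zero] at h
  intro n l
  simp only [Fin.sum_univ_three] at hP hP' ⊢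
  linear_combination E 0 0 * h 0 n 0 l + E 0 1 * h 0 n 1 l + E 0 2 * h 0 n 2 l
    + E 1 0 * h 1 n 0 l + E 1 1 * h 1 n 1 l + E 1 2 * h 1 n 2 l
    + E 2 0 * h 2 n 0 l + E 2 1 * h 2 n 1 l + E 2 2 * h 2 n 2 l
    - E n 0 * hP 0 l - E n 1 * hP 1 l - E n 2 * hP 2 l
    + E 0 l * hP' 0 n + E 1 l * hP' 1 n + E 2 l * hP' 2 n

theorem exists_real_of_flux_eq_zero {Q : Matrix (Fin 3) (Fin 3) ℂ} (hQ : Qᵀ = Q)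
    (h : ∀ m n b : Fin 3, belRobinson eta (ofSd Q) m.succ n.succ b.succ 0 = 0) :
    ∃ (z : ℂ) (R : Matrix (Fin 3) (Fin 3) ℝ), Rᵀ = R ∧ Q = z • cplx R := by
  set E : Matrix (Fin 3) (Fin 3) ℝ := Q.map Complex.re with hE
  set B : Matrix (Fin 3) (Fin 3) ℝ := Q.map Complex.im with hB
  have hEt : Eᵀ = E := by rw [hE, ← Matrix.transpose_map, hQ]
  have hBt : Bᵀ = B := by rw [hB, ← Matrix.transpose_map, hQ]
  have hQeq : ∀ i j, Q i j = E i j + B i j * Complex.I := fun i j => (Complex.re_add_im _).symm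
  let D : Fin 3 → Fin 3 → Fin 3 → Fin 3 → ℝ := fun m n j l =>
    B m j * E n l - E m j * B n l - B m l * E n j + E m l * B n j
      - (if m = n then 1 else 0) * ∑ i, (B i j * E i l - E i j * B i l)
  have h1 : ∀ m n b, D m n (b + 1) (b + 2) = 0 := by
    intro m n b
    have h2 := belRobinson_ofSd_flux Q m n b
    rw [h m n b] at h2
    have h3 : ((D m n (b + 1) (b + 2) : ℝ) : ℂ) = 0 := by
      have hI : Complex.I * Complex.I = -1 := Complex.I_mul_I
      simp only [hQeq, map_add, map_mul, Complex.conj_ofReal, Complex.conj_I,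
        Fin.sum_univ_three] at h2
      have hD : ((D m n (b + 1) (b + 2) : ℝ) : ℂ)
          = B m (b + 1) * E n (b + 2) - E m (b + 1) * B n (b + 2) - B m (b + 2) * E n (b + 1)
            + E m (b + 2) * B n (b + 1) - (if m = n then 1 else 0) *
            (B 0 (b + 1) * E 0 (b + 2) - E 0 (b + 1) * B 0 (b + 2)
            + (B 1 (b + 1) * E 1 (b + 2) - E 1 (b + 1) * B 1 (b + 2))
            + (B 2 (b + 1) * E 2 (b + 2) - E 2 (b + 1) * B 2 (b + 2))) := by
        simp only [D, Fin.sum_univ_three]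
        push_cast
        by_cases hmn : m = n <;> simp [hmn]
      have h4 : (D m n (b + 1) (b + 2) : ℂ) * (Complex.I * Complex.I) = 0 := by
        rw [hD]
        push_cast at h2
        linear_combination -2 * h2
      rwa [hI, mul_neg_one, neg_eq_zero] at h4
    exact_mod_cast h3
  have hanti : ∀ m n j l, D m n j l = -D m n l j := by
    intro m n j l
    simp only [D, Fin.sum_univ_three]
    ring
  -- The cyclic pairs (b + 1, b + 2) and antisymmetry in j, l cover all index pairs.
  have hD : ∀ m n j l, D m n j l = 0 := by
    intro m n j l
    have h0 := h1 m n 0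
    have h1' := h1 m n 1
    have h2 := h1 m n 2
    simp only [zero_add, show (1 : Fin 3) + 1 = 2 from rfl, show (1 : Fin 3) + 2 = 0 from rfl,
      show (2 : Fin 3) + 1 = 0 from rfl, show (2 : Fin 3) + 2 = 1 from rfl] at h0 h1' h2
    have d0 := hanti m n 0 0
    have d1 := hanti m n 1 1
    have d2 := hanti m n 2 2
    have e0 := hanti m n 2 1
    have e1 := hanti m n 0 2
    have e2 := hanti m n 1 0
    fin_cases j <;> fin_cases l <;> simp only [Fin.zero_eta, Fin.mk_one, Fin.reduceFinMk] <;>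
      linarith
  have hprop := proportional_of_flux_eq_zero hEt hBt fun m n j l => sub_eq_zero.1 (hD m n j l)
  -- If E = 0 then Q = iB; otherwise B is a real multiple of E.
  by_cases h0 : ∑ m, ∑ j, E m j * E m j = 0
  · refine ⟨Complex.I, B, hBt, ?_⟩
    have hE0 : ∀ i j, E i j = 0 := by
      intro i j
      have h2 := (Finset.sum_eq_zero_iff_of_nonneg
        (fun m _ => Finset.sum_nonneg fun j _ => mul_self_nonneg (E m j))).1 h0 i (Finset.mem_univ i)
      have h3 := (Finset.sum_eq_zero_iff_of_nonneg
        (fun j _ => mul_self_nonneg (E i j))).1 h2 j (Finset.mem_univ j)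
      exact mul_self_eq_zero.1 h3
    ext i j
    rw [hQeq, hE0]
    simp [mul_comm]
  · refine ⟨1 + ((∑ m, ∑ j, E m j * B m j) / (∑ m, ∑ j, E m j * E m j) : ℝ) * Complex.I, E, hEt, ?_⟩
    ext i j
    have h2 : B i j = (∑ m, ∑ j, E m j * B m j) / (∑ m, ∑ j, E m j * E m j) * E i j := by
      rw [div_mul_eq_mul_div, hprop, mul_div_cancel_left₀ _ h0]
    rw [hQeq, h2]
    simp only [Matrix.smul_apply, Matrix.map_apply, smul_eq_mul, Complex.coe_algebraMap]
    push_cast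
    ring

/-- The Rayleigh quotient of the real symmetric matrix R on f is real, so every eigenvalue of z R is
a real multiple of z. -/
theorem im_mul_conj_of_smul_real {z : ℂ} {R : Matrix (Fin 3) (Fin 3) ℝ} (hR : Rᵀ = R) {ρ τ : ℂ}
    {f g : Fin 3 → ℂ} (hf : f ≠ 0) (hg : g ≠ 0) (h : (z • cplx R) *ᵥ f = ρ • f)
    (h' : (z • cplx R) *ᵥ g = τ • g) : (ρ * conj τ).im = 0 := by
  have key : ∀ {ρ : ℂ} {f : Fin 3 → ℂ}, f ≠ 0 → (z • cplx R) *ᵥ f = ρ • f → ∃ r : ℝ, ρ = z * r := by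
    intro ρ f hf h
    have hn : star f ⬝ᵥ f ≠ 0 := by
      open ComplexOrder in
      rwa [Ne, dotProduct_star_self_eq_zero]
    have h1 : z * (star f ⬝ᵥ cplx R *ᵥ f) = ρ * (star f ⬝ᵥ f) := by
      have := congrArg (star f ⬝ᵥ ·) h
      simpa only [Matrix.smul_mulVec, dotProduct_smul, smul_eq_mul] using this
    have hreal : ∀ w : ℂ, conj w = w → ∃ r : ℝ, w = r := fun w hw =>
      (Complex.conj_eq_iff_real.1 hw)
    obtain ⟨p, hp⟩ := hreal (star f ⬝ᵥ f) (by
      change star (star f ⬝ᵥ f) = _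
      rw [← Matrix.star_dotProduct])
    obtain ⟨q, hq⟩ := hreal (star f ⬝ᵥ cplx R *ᵥ f) (by
      change star (star f ⬝ᵥ cplx R *ᵥ f) = _
      have hH : (cplx R)ᴴ = cplx R := by
        rw [Matrix.conjTranspose, ← cplx_transpose, hR]
        exact cconj_cplx R
      rw [← Matrix.star_dotProduct, Matrix.star_mulVec, hH, ← Matrix.dotProduct_mulVec])
    rw [hp, hq] at h1
    rw [hp] at hn
    refine ⟨q / p, ?_⟩
    push_cast
    field_simp
    exact h1.symm
  obtain ⟨r, rfl⟩ := key hf h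
  obtain ⟨s, rfl⟩ := key hg h'
  have : z * r * conj (z * s) = ((Complex.normSq z * r * s : ℝ) : ℂ) := by
    push_cast
    rw [← Complex.mul_conj, map_mul, Complex.conj_ofReal]
    ring
  rw [this, Complex.ofReal_im]

/-- Every unit timelike vector is the first vector of an oriented orthonormal frame. -/
theorem exists_lorentz_mulVec_eq {u : Fin 4 → ℝ} (hu : IsObserver eta u) :
    ∃ L : Matrix (Fin 4) (Fin 4) ℝ, 0 < L.det ∧ Lᵀ * eta * L = eta ∧ L *ᵥ Pi.single 0 1 = u := by
  obtain ⟨L, hL, hLu⟩ : ∃ L : Matrix (Fin 4) (Fin 4) ℝ, Lᵀ * eta * L = eta ∧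
      L *ᵥ Pi.single 0 1 = u := by
    have hue : metricProduct eta u u = -(u 0 * u 0) + u 1 * u 1 + u 2 * u 2 + u 3 * u 3 := by
      simp [metricProduct, eta, Fin.sum_univ_four]
    have hu' : -(u 0 * u 0) + u 1 * u 1 + u 2 * u 2 + u 3 * u 3 = -1 := hue ▸ hu
    -- The frame is obtained by the reflection exchanging u and e₀, along w = u - e₀ of square 2(u⁰
    -- - 1). It degenerates only for u⁰ = 1, where u = e₀ and the identity serves.
    by_cases h1 : u 0 = 1
    · refine ⟨1, by simp, ?_⟩
      have h2 : u 1 = 0 := by nlinarith [mul_self_nonneg (u 1), mul_self_nonneg (u 2), mul_self_nonneg (u 3)]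
      have h3 : u 2 = 0 := by nlinarith [mul_self_nonneg (u 1), mul_self_nonneg (u 2), mul_self_nonneg (u 3)]
      have h4 : u 3 = 0 := by nlinarith [mul_self_nonneg (u 1), mul_self_nonneg (u 2), mul_self_nonneg (u 3)]
      rw [Matrix.one_mulVec]
      ext i
      fin_cases i <;> simp [h1, h2, h3, h4]
    · have h2 : u 0 - 1 ≠ 0 := sub_ne_zero.2 h1
      let w : Fin 4 → ℝ := u - Pi.single 0 1
      -- This is 2 divided by the square of w, the coefficient of the reflection x ↦ x - c g(w, x)
      -- w.
      let c : ℝ := (u 0 - 1)⁻¹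
      have hc : c * (u 0 - 1) = 1 := inv_mul_cancel₀ h2
      have hw : w ⬝ᵥ eta *ᵥ w = 2 * (u 0 - 1) := by
        rw [← metricProduct_eq]
        simp [metricProduct, eta, Fin.sum_univ_four, w]
        linear_combination hu'
      let K : Matrix (Fin 4) (Fin 4) ℝ := Matrix.vecMulVec w (eta *ᵥ w)
      have hK1 : Kᵀ * eta = eta * K := by
        rw [Matrix.transpose_vecMulVec, Matrix.vecMulVec_mul, Matrix.mul_vecMulVec,
          ← Matrix.mulVec_transpose, eta_transpose]
      have hK2 : K * K = (2 * (u 0 - 1)) • K := by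
        rw [Matrix.vecMulVec_mul_vecMulVec, dotProduct_comm, hw, Matrix.vecMulVec_smul]
      refine ⟨1 - c • K, ?_, ?_⟩
      · rw [Matrix.transpose_sub, Matrix.transpose_smul, Matrix.transpose_one, Matrix.sub_mul,
          Matrix.smul_mul, hK1, Matrix.one_mul]
        have : (eta - c • (eta * K)) * (1 - c • K)
            = eta * (1 - (2 * c) • K + (c * c) • (K * K)) := by
          simp only [Matrix.mul_sub, Matrix.sub_mul, Matrix.mul_add, Matrix.mul_smul,
            Matrix.smul_mul, Matrix.mul_one, Matrix.mul_assoc]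
          module
        rw [this, hK2, smul_smul]
        have h3 : c * c * (2 * (u 0 - 1)) = 2 * c := by linear_combination 2 * c * hc
        rw [h3]
        simp
      · rw [Matrix.sub_mulVec, Matrix.one_mulVec, Matrix.smul_mulVec, Matrix.vecMulVec_mulVec]
        have h3 : (eta *ᵥ w) ⬝ᵥ Pi.single 0 1 = 1 - u 0 := by
          simp [eta, w, Matrix.mulVec_diagonal]
        rw [h3]
        have h4 : c * (1 - u 0) = -1 := by linear_combination -hc
        ext i
        change (Pi.single 0 1 : Fin 4 → ℝ) i
          - c * ((u i - (Pi.single 0 1 : Fin 4 → ℝ) i) * (1 - u 0)) = u i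
        linear_combination -(u i - (Pi.single 0 1 : Fin 4 → ℝ) i) * h4
  rcases (lorentz_det_ne_zero hL).lt_or_gt with h0 | h0
  · refine ⟨L * reflect, ?_, reflect_mul_eta hL, ?_⟩
    · rw [Matrix.det_mul, reflect_det]
      linarith
    · rw [← Matrix.mulVec_mulVec, ← hLu]
      congr 1
      ext i
      fin_cases i <;> simp [reflect]
  · exact ⟨L, h0, hL, hLu⟩

theorem metricProduct_eta_single_zero (x : Fin 4 → ℝ) :
    metricProduct eta x (Pi.single 0 1) = -x 0 := by
  simp [metricProduct, eta, Fin.sum_univ_four]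

/-- In a frame whose time vector is the observer without flux, the matrix Q is a complex multiple of
a real symmetric one. -/
theorem im_mul_conj_of_not_radiative {W : Tensor4} (hW : IsWeylTensor eta W) {ρ τ : ℂ}
    (hρ : IsWeylEigenvalue eta W ρ) (hτ : IsWeylEigenvalue eta W τ)
    (h : ¬ IsSuperEnergyRadiative eta W) : (ρ * conj τ).im = 0 := by
  simp only [IsSuperEnergyRadiative, not_forall, not_not] at h
  obtain ⟨u, hu, hflux⟩ := h
  rw [stressFlux_eq_zero_iff _ _ hu] at hflux
  obtain ⟨L, hd, hL, hLu⟩ := exists_lorentz_mulVec_eq hu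
  have hW' := hW.pull hd.ne'
  rw [hL] at hW'
  obtain ⟨Q, hQ, -, hWQ⟩ := hW'.exists_ofSd
  have hev : ∀ ρ, IsWeylEigenvalue eta W ρ → ∃ f : Fin 3 → ℂ, f ≠ 0 ∧ Q *ᵥ f = ρ • f := by
    intro ρ hρ
    rw [← isWeylEigenvalue_ofSd, ← hWQ]
    have := (isWeylEigenvalue_pull (W := W) (G := eta) (ρ := ρ) hd).2 hρ
    rwa [hL] at this
  have hT : belRobinson eta (ofSd Q) = pull L (belRobinson eta W) := by
    rw [← belRobinson_pull _ hd, hL, hWQ]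
  have hz : ∀ m n b : Fin 3, belRobinson eta (ofSd Q) m.succ n.succ b.succ 0 = 0 := by
    have h0 : ∀ a : Fin 3, metricProduct eta (L *ᵥ Pi.single a.succ 1) u = 0 := by
      intro a
      rw [← hLu, ← metricProduct_congr, hL, metricProduct_eta_single_zero]
      simp
    intro m n b
    rw [← eval4_single (belRobinson eta (ofSd Q)), hT, eval4_pull, hLu]
    exact hflux _ _ _ (h0 m) (h0 n) (h0 b)
  obtain ⟨z, R, hR, hzR⟩ := exists_real_of_flux_eq_zero hQ hz
  obtain ⟨f, hf, hf'⟩ := hev ρ hρ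
  obtain ⟨g, hg, hg'⟩ := hev τ hτ
  rw [hzR] at hf' hg'
  exact im_mul_conj_of_smul_real hR hf hg hf' hg'

/-- The time vector of the principal frame is an observer without flux: every product of entries of
Q with conjugate entries is real, so the two terms of the flux formula cancel. -/
theorem not_radiative_of_im_mul_conj {σ : Fin 3 → ℂ} (h : ∀ i j, (σ i * conj (σ j)).im = 0) :
    ¬ IsSuperEnergyRadiative eta (ofSd (diagonal σ)) := by
  intro hr
  have hu : IsObserver eta (Pi.single 0 1) := by
    rw [IsObserver, metricProduct_eta_single_zero]
    simp
  apply hr _ hu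
  rw [stressFlux_eq_zero_iff _ _ hu]
  have hz : ∀ m n b : Fin 3, belRobinson eta (ofSd (diagonal σ)) m.succ n.succ b.succ 0 = 0 := by
    intro m n b
    have h1 := belRobinson_ofSd_flux (diagonal σ) m n b
    have hc : ∀ i j, σ i * conj (σ j) = σ j * conj (σ i) := by
      intro i j
      have := Complex.conj_eq_iff_im.2 (h i j)
      rw [map_mul, Complex.conj_conj] at this
      rw [← this, mul_comm]
    have h2 : ∀ m n j l, diagonal σ m j * conj (diagonal σ n l)
        = diagonal σ n l * conj (diagonal σ m j) := by
      intro m n j l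
      rw [diagonal_apply, diagonal_apply]
      split_ifs <;> simp [hc]
    rw [h2 m n, h2 n m (b + 1), Finset.sum_congr rfl fun i _ => h2 i i (b + 1) (b + 2)] at h1
    have h3 : (belRobinson eta (ofSd (diagonal σ)) m.succ n.succ b.succ 0 : ℂ) = 0 := by
      rw [h1]
      ring
    exact_mod_cast h3
  intro x y z hx hy hz'
  rw [metricProduct_eta_single_zero, neg_eq_zero] at hx hy hz'
  simp only [eval4]
  refine Finset.sum_eq_zero fun a _ => Finset.sum_eq_zero fun b _ => Finset.sum_eq_zero fun c _ =>
    Finset.sum_eq_zero fun d _ => ?_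
  refine Fin.cases ?_ (fun a => ?_) a
  · simp [hx]
  refine Fin.cases ?_ (fun b => ?_) b
  · simp [hy]
  refine Fin.cases ?_ (fun c => ?_) c
  · simp [hz']
  refine Fin.cases ?_ (fun d => ?_) d
  · simp [hz]
  · simp

/-! ### The plane triangle of the Weyl eigenvalues -/

/-- The oriented area (up to a factor) of the triangle of the Weyl eigenvalues. -/
noncomputable def triArea (σ : Fin 3 → ℂ) : ℝ := (σ 0 * conj (σ 1)).im

/-- The sides of the triangle of the Weyl eigenvalues. -/
def triSide (σ : Fin 3 → ℂ) : Fin 3 → ℂ := ![σ 1 - σ 2, σ 2 - σ 0, σ 0 - σ 1]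

theorem eq_neg_of_sum_eq_zero {σ : Fin 3 → ℂ} (hσ : ∑ i, σ i = 0) : σ 2 = -σ 0 - σ 1 := by
  rw [Fin.sum_univ_three] at hσ
  linear_combination hσ

/-- The product of the sides is a square root of the discriminant of the cubic with roots σᵢ. -/
theorem sum_pow_two_three {σ : Fin 3 → ℂ} (hσ : ∑ i, σ i = 0) :
    (∑ i, σ i ^ 2) ^ 3 - 6 * (∑ i, σ i ^ 3) ^ 2
      = 2 * (triSide σ 0 * triSide σ 1 * triSide σ 2) ^ 2 := by
  simp only [Fin.sum_univ_three, triSide, Matrix.cons_val, eq_neg_of_sum_eq_zero hσ]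
  ring

/-- The real part of X = d₀d₁d₂ · conj b vanishes exactly when two vertices are equidistant from the
centroid, that is, when the triangle is isosceles. -/
theorem re_triSide_mul {σ : Fin 3 → ℂ} (hσ : ∑ i, σ i = 0) :
    (triSide σ 0 * triSide σ 1 * triSide σ 2 * conj (∑ i, σ i ^ 3)).re
      = -3 * ((Complex.normSq (σ 0) - Complex.normSq (σ 1)) *
        (Complex.normSq (σ 1) - Complex.normSq (σ 2)) *
        (Complex.normSq (σ 2) - Complex.normSq (σ 0))) := by
  simp only [Fin.sum_univ_three, triSide, Matrix.cons_val, eq_neg_of_sum_eq_zero hσ]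
  simp only [pow_succ, pow_zero, one_mul, Complex.normSq_apply, map_add, map_mul, map_sub, map_neg,
    Complex.mul_re, Complex.mul_im,
    Complex.add_re, Complex.add_im, Complex.sub_re, Complex.sub_im, Complex.neg_re, Complex.neg_im,
    Complex.conj_re, Complex.conj_im]
  ring

/-- The second factor is positive as soon as some σᵢ is nonzero, so the imaginary part of X detects
a flat triangle. -/
theorem im_triSide_mul {σ : Fin 3 → ℂ} (hσ : ∑ i, σ i = 0) :
    (triSide σ 0 * triSide σ 1 * triSide σ 2 * conj (∑ i, σ i ^ 3)).im
      = triArea σ * (3 / 2 * (∑ i, Complex.normSq (σ i)) ^ 2 + 6 * triArea σ ^ 2) := by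
  simp only [Fin.sum_univ_three, triSide, triArea, Matrix.cons_val, eq_neg_of_sum_eq_zero hσ]
  simp only [pow_succ, pow_zero, one_mul, Complex.normSq_apply, map_add, map_mul, map_sub, map_neg,
    Complex.mul_re, Complex.mul_im,
    Complex.add_re, Complex.add_im, Complex.sub_re, Complex.sub_im, Complex.neg_re, Complex.neg_im,
    Complex.conj_re, Complex.conj_im]
  ring

theorem triSide_ne_zero {σ : Fin 3 → ℂ} (hi : Function.Injective σ) (i : Fin 3) :
    triSide σ i ≠ 0 := by
  fin_cases i <;> simp only [triSide, Fin.zero_eta, Fin.mk_one, Fin.reduceFinMk, Matrix.cons_val] <;>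
    exact sub_ne_zero.2 (hi.ne (by decide))

theorem sum_triSide (σ : Fin 3 → ℂ) : triSide σ 0 + triSide σ 1 + triSide σ 2 = 0 := by
  simp only [triSide, Matrix.cons_val]
  ring

theorem weylM_aux {σ : Fin 3 → ℂ} (hσ : ∑ i, σ i = 0) (hb : ∑ i, σ i ^ 3 ≠ 0) :
    (∑ i, σ i ^ 2) ^ 3 / (∑ i, σ i ^ 3) ^ 2 - 6
      = ((2 / Complex.normSq (∑ i, σ i ^ 3) ^ 2 : ℝ) : ℂ)
        * (triSide σ 0 * triSide σ 1 * triSide σ 2 * conj (∑ i, σ i ^ 3)) ^ 2 := by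
  have h1 := sum_pow_two_three hσ
  have hb' : conj (∑ i, σ i ^ 3) ≠ 0 := by rwa [Ne, map_eq_zero]
  push_cast
  rw [← Complex.mul_conj]
  field_simp
  linear_combination h1

/-- M is a positive multiple of X², so M < 0 forces X to be nonzero and purely imaginary. -/
theorem triArea_ne_zero_of_neg {σ : Fin 3 → ℂ} (hσ : ∑ i, σ i = 0) (hb : ∑ i, σ i ^ 3 ≠ 0) {m : ℝ}
    (hm : m < 0) (h : (∑ i, σ i ^ 2) ^ 3 / (∑ i, σ i ^ 3) ^ 2 - 6 = (m : ℂ)) :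
    triArea σ ≠ 0 ∧ (Complex.normSq (σ 0) - Complex.normSq (σ 1)) *
        (Complex.normSq (σ 1) - Complex.normSq (σ 2)) *
        (Complex.normSq (σ 2) - Complex.normSq (σ 0)) = 0 := by
  rw [weylM_aux hσ hb] at h
  have hn : 0 < 2 / Complex.normSq (∑ i, σ i ^ 3) ^ 2 := by
    have := Complex.normSq_pos.2 hb
    positivity
  have hre := re_triSide_mul hσ
  have him := im_triSide_mul hσ
  set X := triSide σ 0 * triSide σ 1 * triSide σ 2 * conj (∑ i, σ i ^ 3)
  have h1 := congrArg Complex.re h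
  have h2 := congrArg Complex.im h
  rw [Complex.re_ofReal_mul, Complex.ofReal_re, pow_two X, Complex.mul_re] at h1
  rw [Complex.im_ofReal_mul, Complex.ofReal_im, pow_two X, Complex.mul_im] at h2
  have h3 : X.re * X.re - X.im * X.im < 0 := by
    by_contra hc
    push Not at hc
    have := mul_nonneg hn.le hc
    linarith
  have h4 : X.im ≠ 0 := by
    intro h0
    rw [h0] at h3
    nlinarith [mul_self_nonneg X.re]
  have h5 : X.re = 0 := by
    have h6 : X.re * X.im + X.im * X.re = 0 := (mul_eq_zero.1 h2).resolve_left hn.ne'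
    have h7 : X.re * X.im = 0 := by linarith
    exact (mul_eq_zero.1 h7).resolve_right h4
  refine ⟨?_, ?_⟩
  · intro h0
    rw [h0, zero_mul] at him
    exact h4 him
  · rw [h5] at hre
    linarith

theorem regular_of_triArea_ne_zero {σ : Fin 3 → ℂ} (hσ : ∑ i, σ i = 0) (hA : triArea σ ≠ 0)
    (h : ∑ i, σ i ^ 3 ≠ 0 →
      ¬ ∃ m : ℝ, m < 0 ∧ (∑ i, σ i ^ 2) ^ 3 / (∑ i, σ i ^ 3) ^ 2 - 6 = (m : ℂ)) :
    ∑ i, σ i ^ 3 ≠ 0 ∧ ((∑ i, σ i ^ 2) ^ 3 / (∑ i, σ i ^ 3) ^ 2 - 6).im ≠ 0 ∧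
      (Complex.normSq (σ 0) - Complex.normSq (σ 1)) *
        (Complex.normSq (σ 1) - Complex.normSq (σ 2)) *
        (Complex.normSq (σ 2) - Complex.normSq (σ 0)) ≠ 0 := by
  -- For sum zero, b = 3σ₀σ₁σ₂, and a vanishing σᵢ makes the other two opposite, hence the triangle
  -- flat.
  have hb : ∑ i, σ i ^ 3 ≠ 0 := by
    have h2 := eq_neg_of_sum_eq_zero hσ
    have h1 : ∑ i, σ i ^ 3 = 3 * (σ 0 * σ 1 * σ 2) := by
      rw [Fin.sum_univ_three, h2]
      ring
    intro h0
    rw [h1] at h0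
    apply hA
    have h3 : σ 0 * σ 1 * σ 2 = 0 := by
      rcases mul_eq_zero.1 h0 with h4 | h4
      · norm_num at h4
      · exact h4
    simp only [triArea]
    rcases mul_eq_zero.1 h3 with h4 | h4
    · rcases mul_eq_zero.1 h4 with h5 | h5 <;> simp [h5]
    · have h5 : σ 0 = -σ 1 := by linear_combination h2 - h4
      rw [h5, neg_mul, Complex.mul_conj]
      simp
  refine ⟨hb, ?_⟩
  specialize h hb
  rw [weylM_aux hσ hb] at h ⊢
  have hn : 0 < 2 / Complex.normSq (∑ i, σ i ^ 3) ^ 2 := by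
    have := Complex.normSq_pos.2 hb
    positivity
  have hre := re_triSide_mul hσ
  have him := im_triSide_mul hσ
  set X := triSide σ 0 * triSide σ 1 * triSide σ 2 * conj (∑ i, σ i ^ 3)
  have h4 : X.im ≠ 0 := by
    rw [him]
    have : 0 < triArea σ ^ 2 := by positivity
    exact mul_ne_zero hA (by positivity)
  have h5 : X.re ≠ 0 := by
    intro h0
    apply h
    have hX : X = X.im * Complex.I := by
      apply Complex.ext <;> simp [h0]
    refine ⟨2 / Complex.normSq (∑ i, σ i ^ 3) ^ 2 * -(X.im ^ 2), ?_, ?_⟩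
    · have : 0 < X.im ^ 2 := by positivity
      nlinarith
    · nth_rewrite 1 [hX]
      rw [mul_pow, Complex.I_sq]
      push_cast
      ring
  refine ⟨?_, ?_⟩
  · rw [Complex.im_ofReal_mul, pow_two X, Complex.mul_im]
    refine mul_ne_zero hn.ne' ?_
    have : X.re * X.im ≠ 0 := mul_ne_zero h5 h4
    intro h6
    apply this
    linarith
  · intro h0
    rw [h0] at hre
    apply h5
    rw [hre]
    ring

/-- Since the centroid is 0, differences of squared sides are -3 times differences of squared
distances |σᵢ|². -/
theorem norm_triSide_eq_of_mul_eq_zero {σ : Fin 3 → ℂ} (hσ : ∑ i, σ i = 0)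
    (h : (Complex.normSq (σ 0) - Complex.normSq (σ 1)) *
        (Complex.normSq (σ 1) - Complex.normSq (σ 2)) *
        (Complex.normSq (σ 2) - Complex.normSq (σ 0)) = 0) :
    ‖triSide σ 0‖ = ‖triSide σ 1‖ ∨ ‖triSide σ 1‖ = ‖triSide σ 2‖ ∨
      ‖triSide σ 2‖ = ‖triSide σ 0‖ := by
  have key : ∀ z w : ℂ, Complex.normSq z = Complex.normSq w → ‖z‖ = ‖w‖ := by
    intro z w h
    rw [Complex.normSq_eq_norm_sq, Complex.normSq_eq_norm_sq] at h
    exact (pow_left_inj₀ (norm_nonneg _) (norm_nonneg _) two_ne_zero).1 h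
  have h2 := eq_neg_of_sum_eq_zero hσ
  have e01 : Complex.normSq (triSide σ 0) - Complex.normSq (triSide σ 1)
      = -3 * (Complex.normSq (σ 0) - Complex.normSq (σ 1)) := by
    simp only [triSide, Matrix.cons_val, h2, Complex.normSq_apply, Complex.sub_re, Complex.sub_im,
      Complex.neg_re, Complex.neg_im]
    ring
  have e12 : Complex.normSq (triSide σ 1) - Complex.normSq (triSide σ 2)
      = -3 * (Complex.normSq (σ 1) - Complex.normSq (σ 2)) := by
    simp only [triSide, Matrix.cons_val, h2, Complex.normSq_apply, Complex.sub_re, Complex.sub_im,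
      Complex.neg_re, Complex.neg_im]
    ring
  rcases mul_eq_zero.1 h with h | h
  · rcases mul_eq_zero.1 h with h | h
    · exact Or.inl (key _ _ (by linarith))
    · exact Or.inr (Or.inl (key _ _ (by linarith)))
  · exact Or.inr (Or.inr (key _ _ (by linarith)))

theorem sum_sq_eq_triSide {σ : Fin 3 → ℂ} (hσ : ∑ i, σ i = 0) :
    triSide σ 0 ^ 2 + triSide σ 0 * triSide σ 1 + triSide σ 1 ^ 2 = 3 / 2 * ∑ i, σ i ^ 2 := by
  simp only [triSide, Matrix.cons_val, Fin.sum_univ_three, eq_neg_of_sum_eq_zero hσ]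
  ring

/-- With sides x, y, -x - y, the sum of squares of the σᵢ is a multiple of x² + xy + y². It vanishes
exactly when the sides differ by cube roots of unity, that is, for an equilateral triangle. -/
theorem norm_triSide_eq_iff {σ : Fin 3 → ℂ} (hσ : ∑ i, σ i = 0) (hi : Function.Injective σ) :
    (‖triSide σ 0‖ = ‖triSide σ 1‖ ∧ ‖triSide σ 1‖ = ‖triSide σ 2‖) ↔ ∑ i, σ i ^ 2 = 0 := by
  have hs := sum_triSide σ
  have h1 := sum_sq_eq_triSide hσ
  have hne := triSide_ne_zero hi
  set x := triSide σ 0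
  set y := triSide σ 1
  have hz : triSide σ 2 = -x - y := by linear_combination hs
  rw [hz]
  constructor
  · rintro ⟨hxy, hyz⟩
    have e : ∀ z : ℂ, z * conj z = ((‖z‖ ^ 2 : ℝ) : ℂ) := fun z => by
      rw [Complex.mul_conj, Complex.normSq_eq_norm_sq]
    have ex := e x
    have ey := e y
    have ez := e (-x - y)
    rw [← hyz] at ez
    rw [hxy] at ex
    rw [map_sub, map_neg] at ez
    -- With c the common squared length, |x + y|² = c gives x conj y + y conj x = -c, which is the
    -- claim after multiplication by conj x · conj y.
    have h2 : (conj x * conj y) * (x ^ 2 + x * y + y ^ 2) = 0 := by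
      set c : ℂ := ((‖y‖ ^ 2 : ℝ) : ℂ)
      have hc : c = -(x * conj y) - y * conj x := by linear_combination ez - ex - ey
      linear_combination x * conj y * ex + y * conj y * ex + y * conj x * ey + c * ey + c * hc
    have h3 : x ^ 2 + x * y + y ^ 2 = 0 := by
      refine (mul_eq_zero.1 h2).resolve_left (mul_ne_zero ?_ ?_)
      · rw [Ne, map_eq_zero]; exact hne 0
      · rw [Ne, map_eq_zero]; exact hne 1
    rw [h3] at h1
    linear_combination (-2 / 3 : ℂ) * h1
  · intro h0
    rw [h0, mul_zero] at h1
    have hn : ∀ u v : ℂ, u ^ 3 = v ^ 3 → ‖u‖ = ‖v‖ := by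
      intro u v h
      have := congrArg norm h
      rw [norm_pow, norm_pow] at this
      exact (pow_left_inj₀ (norm_nonneg _) (norm_nonneg _) three_ne_zero).1 this
    refine ⟨hn _ _ ?_, hn _ _ ?_⟩
    · linear_combination (x - y) * h1
    · linear_combination (x + 2 * y) * h1

/-- For i ≠ k the third vertex is -σᵢ - σₖ. The imaginary part is then the area with the sign of the
cyclic order, and twice the real part is |σⱼ|² - |σᵢ|² - |σₖ|². On the diagonal, the factors 4 and ½
give 2|σᵢ|². -/
theorem mul_conj_re_im {σ : Fin 3 → ℂ} (hσ : ∑ i, σ i = 0) (i k : Fin 3) :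
    (σ i * conj (σ k)).im = ![![0, triArea σ, -triArea σ], ![-triArea σ, 0, triArea σ],
      ![triArea σ, -triArea σ, 0]] i k ∧
    2 * (σ i * conj (σ k)).re =
      (if i = k then 4 else 1) * ![![Complex.normSq (σ 0) / 2,
        Complex.normSq (σ 2) - Complex.normSq (σ 0) - Complex.normSq (σ 1),
        Complex.normSq (σ 1) - Complex.normSq (σ 0) - Complex.normSq (σ 2)],
      ![Complex.normSq (σ 2) - Complex.normSq (σ 0) - Complex.normSq (σ 1),
        Complex.normSq (σ 1) / 2,
        Complex.normSq (σ 0) - Complex.normSq (σ 1) - Complex.normSq (σ 2)],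
      ![Complex.normSq (σ 1) - Complex.normSq (σ 0) - Complex.normSq (σ 2),
        Complex.normSq (σ 0) - Complex.normSq (σ 1) - Complex.normSq (σ 2),
        Complex.normSq (σ 2) / 2]] i k := by
  have h2 := eq_neg_of_sum_eq_zero hσ
  fin_cases i <;> fin_cases k <;>
    simp only [Fin.zero_eta, Fin.mk_one, Fin.reduceFinMk, Matrix.cons_val, triArea, h2,
      Complex.normSq_apply, map_sub, map_neg, Complex.mul_re, Complex.mul_im, Complex.sub_re,
      Complex.sub_im, Complex.neg_re, Complex.neg_im, Complex.conj_re, Complex.conj_im] <;>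
    constructor <;> simp <;> ring

/-- The imaginary parts 0, α, -α sort the nine products into three classes of three. Within a class
the real parts differ by multiples of differences of the |σᵢ|². -/
theorem mul_conj_injective {σ : Fin 3 → ℂ} (hσ : ∑ i, σ i = 0) (hA : triArea σ ≠ 0)
    (hn : (Complex.normSq (σ 0) - Complex.normSq (σ 1)) *
        (Complex.normSq (σ 1) - Complex.normSq (σ 2)) *
        (Complex.normSq (σ 2) - Complex.normSq (σ 0)) ≠ 0) :
    Function.Injective fun p : Fin 3 × Fin 3 => σ p.1 * conj (σ p.2) := by
  obtain ⟨h0, h20⟩ := mul_ne_zero_iff.1 hn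
  obtain ⟨h01, h12⟩ := mul_ne_zero_iff.1 h0
  rintro ⟨i, k⟩ ⟨j, l⟩ h
  have him := (mul_conj_re_im hσ i k).1
  have hre := (mul_conj_re_im hσ i k).2
  simp only at h
  rw [h] at him hre
  rw [(mul_conj_re_im hσ j l).1] at him
  rw [(mul_conj_re_im hσ j l).2] at hre
  clear h hn hσ h0
  generalize triArea σ = α at *
  generalize Complex.normSq (σ 0) = n0 at *
  generalize Complex.normSq (σ 1) = n1 at *
  generalize Complex.normSq (σ 2) = n2 at *
  have c1 : ¬ 0 = α := fun h => hA h.symm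
  have c2 : ¬ α = 0 := hA
  have c3 : ¬ α = -α := fun h => hA (by linarith)
  have c4 : ¬ -α = α := fun h => hA (by linarith)
  fin_cases i <;> fin_cases k <;> fin_cases j <;> fin_cases l <;>
    first
    | rfl
    | (exfalso
       simp only [Fin.zero_eta, Fin.mk_one, Fin.reduceFinMk, Matrix.cons_val] at him
       first
       | exact c1 him
       | exact c2 him
       | exact c3 him
       | exact c4 him
       | exact hA (by linarith)
       | (simp only [Fin.zero_eta, Fin.mk_one, Fin.reduceFinMk, Matrix.cons_val, Fin.reduceEq,
            if_true, if_false] at hre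
          first
          | exact h01 (by linarith)
          | exact h12 (by linarith)
          | exact h20 (by linarith)))

theorem ncard_range_mul_conj {σ : Fin 3 → ℂ} (hσ : ∑ i, σ i = 0) (hA : triArea σ ≠ 0)
    (hn : (Complex.normSq (σ 0) - Complex.normSq (σ 1)) *
        (Complex.normSq (σ 1) - Complex.normSq (σ 2)) *
        (Complex.normSq (σ 2) - Complex.normSq (σ 0)) ≠ 0) :
    (Set.range fun p : Fin 3 × Fin 3 => σ p.1 * conj (σ p.2)).ncard = 9 ∧
    {t ∈ Set.range fun p : Fin 3 × Fin 3 => σ p.1 * conj (σ p.2) | t.im = 0}.ncard = 3 := by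
  have hinj := mul_conj_injective hσ hA hn
  refine ⟨?_, ?_⟩
  · rw [← Set.image_univ, Set.ncard_image_of_injective _ hinj, Set.ncard_univ]
    simp
  · have h1 : {t ∈ Set.range fun p : Fin 3 × Fin 3 => σ p.1 * conj (σ p.2) | t.im = 0}
        = (fun p : Fin 3 × Fin 3 => σ p.1 * conj (σ p.2)) '' Set.range fun i => (i, i) := by
      ext t
      simp only [Set.mem_ofPred_eq, Set.mem_range, Set.mem_image, Prod.exists]
      constructor
      · rintro ⟨⟨i, k, rfl⟩, h⟩
        rw [(mul_conj_re_im hσ i k).1] at h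
        have : i = k := by
          fin_cases i <;> fin_cases k <;>
            first
            | rfl
            | (exfalso
               simp only [Fin.zero_eta, Fin.mk_one, Fin.reduceFinMk, Matrix.cons_val,
                 neg_eq_zero] at h
               exact hA h)
        subst this
        exact ⟨i, i, ⟨i, rfl⟩, rfl⟩
      · rintro ⟨i, k, ⟨j, hj⟩, rfl⟩
        obtain ⟨rfl, rfl⟩ := Prod.mk.inj hj
        exact ⟨⟨_, _, rfl⟩, by simp [Complex.mul_conj]⟩
    rw [h1, Set.ncard_image_of_injective _ hinj, ← Set.image_univ,
      Set.ncard_image_of_injective _ (fun i j h => (Prod.mk.inj h).1), Set.ncard_univ]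
    simp

/-! ### Null Debever vectors -/

/-- The value of the bivector `S i` on two real vectors. -/
noncomputable def sdBil (i : Fin 3) (y k : Fin 4 → ℝ) : ℂ := ∑ a, ∑ b, sdForm i a b * y a * k b

theorem sdBil_eq (i : Fin 3) (y k : Fin 4 → ℝ) : sdBil i y k
    = ![-(y 0 : ℂ) * k 1 + y 1 * k 0 - Complex.I * (y 2 * k 3 - y 3 * k 2),
      -(y 0 : ℂ) * k 2 + y 2 * k 0 - Complex.I * (y 3 * k 1 - y 1 * k 3),
      -(y 0 : ℂ) * k 3 + y 3 * k 0 - Complex.I * (y 1 * k 2 - y 2 * k 1)] i := by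
  simp only [sdBil, Fin.sum_univ_four]
  fin_cases i <;>
    (simp only [sdForm, Fin.zero_eta, Fin.mk_one, Fin.reduceFinMk, Matrix.cons_val]; simp; ring)

theorem sdBil_sub_left (i : Fin 3) (a b : ℝ) (x y k : Fin 4 → ℝ) :
    sdBil i (a • y - b • x) k = a * sdBil i y k - b * sdBil i x k := by
  simp only [sdBil, Finset.mul_sum, ← Finset.sum_sub_distrib]
  refine Finset.sum_congr rfl fun _ _ => Finset.sum_congr rfl fun _ _ => ?_
  simp only [Pi.sub_apply, Pi.smul_apply, smul_eq_mul]
  push_cast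
  ring

theorem sdBil_smul_right (i : Fin 3) (c : ℝ) (y k : Fin 4 → ℝ) :
    sdBil i y (c • k) = c * sdBil i y k := by
  simp only [sdBil, Finset.mul_sum]
  refine Finset.sum_congr rfl fun _ _ => Finset.sum_congr rfl fun _ _ => ?_
  simp only [Pi.smul_apply, smul_eq_mul]
  push_cast
  ring

theorem eval4_ofSd_diagonal (σ : Fin 3 → ℂ) (y k z : Fin 4 → ℝ) :
    eval4 (ofSd (diagonal σ)) y k k z = (∑ i, σ i * sdBil i y k * sdBil i z k).re := by
  have h : ((∑ a, ∑ b, ∑ c, ∑ d, (y a * k b * k c * z d : ℝ) *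
      -sdTensor (diagonal σ) a b c d : ℂ)) = ∑ i, σ i * sdBil i y k * sdBil i z k := by
    have h1 : ∀ a b c d, sdTensor (diagonal σ) a b c d
        = ∑ i, σ i * sdForm i a b * sdForm i c d := by
      intro a b c d
      simp only [sdTensor, Matrix.diagonal_apply, ite_mul, zero_mul, Finset.sum_ite_eq,
        Finset.mem_univ, if_true]
    have h2 : ∀ i, -sdBil i z k = ∑ c, ∑ d, sdForm i c d * k c * z d := by
      intro i
      rw [sdBil, Finset.sum_comm, ← Finset.sum_neg_distrib]
      refine Finset.sum_congr rfl fun c _ => ?_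
      rw [← Finset.sum_neg_distrib]
      refine Finset.sum_congr rfl fun d _ => ?_
      rw [sdForm_antisymm i d c]
      ring
    have h3 : ∀ i, σ i * sdBil i y k * sdBil i z k
        = ∑ a, ∑ b, ∑ c, ∑ d, (y a * k b * k c * z d : ℝ) *
          -(σ i * sdForm i a b * sdForm i c d) := by
      intro i
      rw [← neg_neg (sdBil i z k), h2, sdBil]
      rw [Finset.mul_sum, Finset.sum_mul]
      refine Finset.sum_congr rfl fun a _ => ?_
      rw [Finset.mul_sum, Finset.sum_mul]
      refine Finset.sum_congr rfl fun b _ => ?_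
      rw [← Finset.sum_neg_distrib, Finset.mul_sum]
      refine Finset.sum_congr rfl fun c _ => ?_
      rw [← Finset.sum_neg_distrib, Finset.mul_sum]
      refine Finset.sum_congr rfl fun d _ => ?_
      push_cast
      ring
    simp only [h3, h1, ← Finset.sum_neg_distrib, Finset.mul_sum]
    symm
    rw [Finset.sum_comm]
    refine Finset.sum_congr rfl fun a _ => ?_
    rw [Finset.sum_comm]
    refine Finset.sum_congr rfl fun b _ => ?_
    rw [Finset.sum_comm]
    refine Finset.sum_congr rfl fun c _ => ?_
    rw [Finset.sum_comm]
  rw [← h]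
  simp only [eval4, Complex.re_sum, Complex.re_ofReal_mul, Complex.neg_re]
  rfl

theorem metricProduct_sub_left (G : Matrix (Fin 4) (Fin 4) ℝ) (a b : ℝ) (x y k : Fin 4 → ℝ) :
    metricProduct G (a • y - b • x) k = a * metricProduct G y k - b * metricProduct G x k := by
  simp only [metricProduct_eq, sub_dotProduct, smul_dotProduct, smul_eq_mul]

theorem metricProduct_eta (x y : Fin 4 → ℝ) :
    metricProduct eta x y = -(x 0 * y 0) + x 1 * y 1 + x 2 * y 2 + x 3 * y 3 := by
  simp [metricProduct, eta, Fin.sum_univ_four]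

/-- Antisymmetrising with k amounts to testing W(·, k, k, ·) on vectors orthogonal to k. -/
theorem isDebever_diagonal_iff (σ : Fin 3 → ℂ) (k : Fin 4 → ℝ) :
    IsDebever eta (ofSd (diagonal σ)) k ↔ k ≠ 0 ∧ metricProduct eta k k = 0 ∧
      ∀ y z, metricProduct eta y k = 0 → metricProduct eta z k = 0 →
        (∑ i, σ i * sdBil i y k * sdBil i z k).re = 0 := by
  rw [isDebever_iff]
  refine and_congr_right fun hk => and_congr_right fun hn => ?_
  simp only [eval4_ofSd_diagonal]
  constructor
  · intro h y z hy hz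
    -- The time vector has product -k⁰ with k, which is nonzero for a nonzero null vector, so it
    -- isolates one of the four terms.
    have h1 := h (Pi.single 0 1) y z (Pi.single 0 1)
    rw [hy, hz, metricProduct_comm eta_transpose, metricProduct_eta_single_zero] at h1
    have h0 : k 0 ≠ 0 := by
      intro h0
      apply hk
      rw [metricProduct_eta, h0] at hn
      have h1 : k 1 = 0 := by nlinarith [mul_self_nonneg (k 1), mul_self_nonneg (k 2), mul_self_nonneg (k 3)]
      have h2 : k 2 = 0 := by nlinarith [mul_self_nonneg (k 1), mul_self_nonneg (k 2), mul_self_nonneg (k 3)]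
      have h3 : k 3 = 0 := by nlinarith [mul_self_nonneg (k 1), mul_self_nonneg (k 2), mul_self_nonneg (k 3)]
      ext i
      fin_cases i <;> simp [h0, h1, h2, h3]
    have h2 : k 0 * k 0 * (∑ i, σ i * sdBil i y k * sdBil i z k).re = 0 := by linarith
    exact (mul_eq_zero.1 h2).resolve_left (mul_ne_zero h0 h0)
  · intro h x y z w
    -- These combinations are orthogonal to k, and expanding the product in them gives the four
    -- terms of the antisymmetrised condition.
    have h1 := h (metricProduct eta x k • y - metricProduct eta y k • x)
      (metricProduct eta w k • z - metricProduct eta z k • w)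
      (by rw [metricProduct_sub_left]; ring) (by rw [metricProduct_sub_left]; ring)
    simp only [sdBil_sub_left] at h1
    rw [← h1]
    simp only [← Complex.re_ofReal_mul, ← Complex.re_mul_ofReal, ← Complex.sub_re, ← Complex.add_re]
    congr 1
    simp only [Fin.sum_univ_three]
    ring

theorem IsDebever.smul {σ : Fin 3 → ℂ} {k : Fin 4 → ℝ} (h : IsDebever eta (ofSd (diagonal σ)) k)
    {c : ℝ} (hc : c ≠ 0) : IsDebever eta (ofSd (diagonal σ)) (c • k) := by
  rw [isDebever_diagonal_iff] at h ⊢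
  have hm : ∀ x, metricProduct eta x (c • k) = c * metricProduct eta x k := fun x => by
    rw [metricProduct_eq, metricProduct_eq, Matrix.mulVec_smul, dotProduct_smul, smul_eq_mul]
  refine ⟨smul_ne_zero hc h.1, ?_, fun y z hy hz => ?_⟩
  · rw [hm, metricProduct_comm eta_transpose, hm, h.2.1]
    simp
  · rw [hm] at hy hz
    have h1 := h.2.2 y z ((mul_eq_zero.1 hy).resolve_left hc) ((mul_eq_zero.1 hz).resolve_left hc)
    have h2 : ∑ i, σ i * sdBil i y (c • k) * sdBil i z (c • k)
        = ((c * c : ℝ) : ℂ) * ∑ i, σ i * sdBil i y k * sdBil i z k := by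
      simp only [sdBil_smul_right, Fin.sum_univ_three]
      push_cast
      ring
    rw [h2, Complex.re_ofReal_mul, h1, mul_zero]

/-- The null vector associated with an isotropic complex vector. -/
noncomputable def nullVec (u : Fin 3 → ℂ) : Fin 4 → ℝ :=
  ![∑ i, Complex.normSq (u i), 2 * (u 2 * conj (u 1)).im, 2 * (u 0 * conj (u 2)).im,
    2 * (u 1 * conj (u 0)).im]

theorem nullVec_zero_pos {u : Fin 3 → ℂ} (hu : u ≠ 0) : 0 < nullVec u 0 := by
  obtain ⟨i, hi⟩ := Function.ne_iff.1 hu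
  exact Finset.sum_pos' (fun i _ => Complex.normSq_nonneg _)
    ⟨i, Finset.mem_univ i, Complex.normSq_pos.2 hi⟩

theorem nullVec_cast (u : Fin 3 → ℂ) :
    (nullVec u 0 : ℂ) = u 0 * conj (u 0) + u 1 * conj (u 1) + u 2 * conj (u 2) ∧
    (nullVec u 1 : ℂ) = Complex.I * (u 1 * conj (u 2) - u 2 * conj (u 1)) ∧
    (nullVec u 2 : ℂ) = Complex.I * (u 2 * conj (u 0) - u 0 * conj (u 2)) ∧
    (nullVec u 3 : ℂ) = Complex.I * (u 0 * conj (u 1) - u 1 * conj (u 0)) := by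
  refine ⟨?_, ?_, ?_, ?_⟩
  · simp only [nullVec, Matrix.cons_val, Fin.sum_univ_three, Complex.mul_conj]
    push_cast
    rfl
  all_goals
    simp only [nullVec, Matrix.cons_val]
    apply Complex.ext <;> simp <;> ring

theorem metricProduct_nullVec {u : Fin 3 → ℂ} (hu : u 0 * u 0 + u 1 * u 1 + u 2 * u 2 = 0) :
    metricProduct eta (nullVec u) (nullVec u) = 0 := by
  have h : ((metricProduct eta (nullVec u) (nullVec u) : ℝ) : ℂ) = 0 := by
    obtain ⟨h0, h1, h2, h3⟩ := nullVec_cast u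
    have hI : Complex.I * Complex.I = -1 := Complex.I_mul_I
    rw [metricProduct_eta]
    push_cast
    rw [h0, h1, h2, h3]
    set N0 := u 1 * conj (u 2) - u 2 * conj (u 1) with hN0
    set N1 := u 2 * conj (u 0) - u 0 * conj (u 2) with hN1
    set N2 := u 0 * conj (u 1) - u 1 * conj (u 0) with hN2
    linear_combination (N0 * N0 + N1 * N1 + N2 * N2) * hI
      - (conj (u 0) * conj (u 0) + conj (u 1) * conj (u 1) + conj (u 2) * conj (u 2)) * hu
  exact_mod_cast h

/-- For y orthogonal to k = `nullVec u`, the self-dual part of the bivector y ∧ k is a multiple of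
u. The identity is proved after multiplication by k⁰, which allows y⁰ to be eliminated by
orthogonality. -/
theorem sdBil_nullVec {u : Fin 3 → ℂ} (hu0 : u ≠ 0)
    (hu : u 0 * u 0 + u 1 * u 1 + u 2 * u 2 = 0) {y : Fin 4 → ℝ}
    (hy : metricProduct eta y (nullVec u) = 0) (i : Fin 3) :
    sdBil i y (nullVec u)
      = 2 * u i * (y 1 * conj (u 0) + y 2 * conj (u 1) + y 3 * conj (u 2)) := by
  have hK0 : (nullVec u 0 : ℂ) ≠ 0 := by exact_mod_cast (nullVec_zero_pos hu0).ne'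
  have hI : Complex.I * Complex.I = -1 := Complex.I_mul_I
  have hv := congrArg conj hu
  simp only [map_add, map_mul, map_zero] at hv
  obtain ⟨h0, h1, h2, h3⟩ := nullVec_cast u
  have hg : -((y 0 : ℂ) * nullVec u 0) + y 1 * nullVec u 1 + y 2 * nullVec u 2
      + y 3 * nullVec u 3 = 0 := by
    rw [metricProduct_eta] at hy
    exact_mod_cast hy
  apply mul_left_cancel₀ hK0
  rw [sdBil_eq]
  rw [h0, h1, h2, h3] at hg
  set v0 := conj (u 0)
  set v1 := conj (u 1)
  set v2 := conj (u 2)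
  set N0 := u 1 * v2 - u 2 * v1 with hN0
  set N1 := u 2 * v0 - u 0 * v2 with hN1
  set N2 := u 0 * v1 - u 1 * v0 with hN2
  set K := u 0 * v0 + u 1 * v1 + u 2 * v2 with hK
  set yN := (y 1 : ℂ) * N0 + y 2 * N1 + y 3 * N2 with hyN
  fin_cases i <;>
    simp only [Fin.zero_eta, Fin.mk_one, Fin.reduceFinMk, Matrix.cons_val, h0, h1, h2, h3]
  · linear_combination Complex.I * N0 * hg
      - (N0 * yN + K * ((y 2 : ℂ) * N2 - (y 3 : ℂ) * N1)) * hI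
      + ((y 1 : ℂ) * (v0 * v0 + v1 * v1 + v2 * v2) - v0 * (y 1 * v0 + y 2 * v1 + y 3 * v2)) * hu
      - u 0 * (y 1 * u 0 + y 2 * u 1 + y 3 * u 2) * hv
  · linear_combination Complex.I * N1 * hg
      - (N1 * yN + K * ((y 3 : ℂ) * N0 - (y 1 : ℂ) * N2)) * hI
      + ((y 2 : ℂ) * (v0 * v0 + v1 * v1 + v2 * v2) - v1 * (y 1 * v0 + y 2 * v1 + y 3 * v2)) * hu
      - u 1 * (y 1 * u 0 + y 2 * u 1 + y 3 * u 2) * hv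
  · linear_combination Complex.I * N2 * hg
      - (N2 * yN + K * ((y 1 : ℂ) * N1 - (y 2 : ℂ) * N0)) * hI
      + ((y 3 : ℂ) * (v0 * v0 + v1 * v1 + v2 * v2) - v2 * (y 1 * v0 + y 2 * v1 + y 3 * v2)) * hu
      - u 2 * (y 1 * u 0 + y 2 * u 1 + y 3 * u 2) * hv

/-- On vectors orthogonal to k the Debever form is the real part of 4 λ(y) λ(z) ∑ σᵢ uᵢ², with λ
complex linear in the spatial part. Suitable y and z then recover both parts of the sum. -/
theorem isDebever_nullVec_iff (σ : Fin 3 → ℂ) {u : Fin 3 → ℂ} (hu0 : u ≠ 0)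
    (hu : u 0 * u 0 + u 1 * u 1 + u 2 * u 2 = 0) :
    IsDebever eta (ofSd (diagonal σ)) (nullVec u) ↔ ∑ i, σ i * u i ^ 2 = 0 := by
  rw [isDebever_diagonal_iff]
  have hpos := nullVec_zero_pos hu0
  have hne : nullVec u ≠ 0 := fun h => by
    rw [h] at hpos
    exact lt_irrefl _ hpos
  have key : ∀ y z, metricProduct eta y (nullVec u) = 0 → metricProduct eta z (nullVec u) = 0 →
      ∑ i, σ i * sdBil i y (nullVec u) * sdBil i z (nullVec u)
      = 4 * (y 1 * conj (u 0) + y 2 * conj (u 1) + y 3 * conj (u 2))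
        * (z 1 * conj (u 0) + z 2 * conj (u 1) + z 3 * conj (u 2)) * ∑ i, σ i * u i ^ 2 := by
    intro y z hy hz
    simp only [sdBil_nullVec hu0 hu hy, sdBil_nullVec hu0 hu hz, Fin.sum_univ_three]
    ring
  constructor
  · rintro ⟨-, -, h⟩
    have hre := congrArg Complex.re hu
    have him := congrArg Complex.im hu
    simp only [Complex.add_re, Complex.mul_re, Complex.add_im, Complex.mul_im, Complex.zero_re,
      Complex.zero_im] at hre him
    set A : ℝ := (u 0).re * (u 0).re + (u 1).re * (u 1).re + (u 2).re * (u 2).re with hA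
    have hA0 : A ≠ 0 := by
      have : nullVec u 0 = 2 * A := by
        simp only [nullVec, Matrix.cons_val, Fin.sum_univ_three, Complex.normSq_apply]
        linear_combination -hre
      intro h0
      rw [this, h0] at hpos
      linarith
    -- The real and imaginary parts of u span the screen space of k, as k is spatially along their
    -- cross product. They are orthogonal of equal length, so λ takes the values A and -iA on them.
    let a : Fin 4 → ℝ := ![0, (u 0).re, (u 1).re, (u 2).re]
    let b : Fin 4 → ℝ := ![0, (u 0).im, (u 1).im, (u 2).im]
    have ha : metricProduct eta a (nullVec u) = 0 := by
      rw [metricProduct_eta]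
      simp [a, nullVec]
      ring
    have hb : metricProduct eta b (nullVec u) = 0 := by
      rw [metricProduct_eta]
      simp [b, nullVec]
      ring
    have ea : (a 1 : ℂ) * conj (u 0) + a 2 * conj (u 1) + a 3 * conj (u 2) = A := by
      apply Complex.ext
      · simp [a, hA]
      · simp [a]
        linear_combination (-1 / 2 : ℝ) * him
    have eb : (b 1 : ℂ) * conj (u 0) + b 2 * conj (u 1) + b 3 * conj (u 2) = -(A * Complex.I) := by
      apply Complex.ext
      · simp [b]
        linear_combination (1 / 2 : ℝ) * him
      · simp [b, hA]
        linear_combination hre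
    have h1 := h a a ha ha
    have h2 := h a b ha hb
    rw [key a a ha ha, ea] at h1
    rw [key a b ha hb, ea, eb] at h2
    have e1 : (4 * (A : ℂ) * A * ∑ i, σ i * u i ^ 2).re = 4 * A * A * (∑ i, σ i * u i ^ 2).re := by
      rw [← Complex.re_ofReal_mul]
      push_cast
      rfl
    have e2 : (4 * (A : ℂ) * -(A * Complex.I) * ∑ i, σ i * u i ^ 2).re
        = 4 * A * A * (∑ i, σ i * u i ^ 2).im := by
      have : 4 * (A : ℂ) * -(A * Complex.I) * ∑ i, σ i * u i ^ 2
          = ((4 * A * A : ℝ) : ℂ) * (-Complex.I * ∑ i, σ i * u i ^ 2) := by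
        push_cast
        ring
      rw [this, Complex.re_ofReal_mul]
      simp
    have h4 : 4 * A * A ≠ 0 := by positivity
    rw [e1] at h1
    rw [e2] at h2
    apply Complex.ext
    · exact (mul_eq_zero.1 h1).resolve_left h4
    · exact (mul_eq_zero.1 h2).resolve_left h4
  · intro h
    refine ⟨hne, metricProduct_nullVec hu, fun y z hy hz => ?_⟩
    rw [key y z hy hz, h]
    simp

theorem exists_nullVec {k : Fin 4 → ℝ} (hk : k ≠ 0) (hn : metricProduct eta k k = 0) :
    ∃ (u : Fin 3 → ℂ) (c : ℝ), u ≠ 0 ∧ u 0 * u 0 + u 1 * u 1 + u 2 * u 2 = 0 ∧ c ≠ 0 ∧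
      nullVec u = c • k := by
  rw [metricProduct_eta] at hn
  have key : ∀ e : Fin 3 → ℝ, k 0 * (k 0 * k 0 * (e 0 * e 0 + e 1 * e 1 + e 2 * e 2)
      - (k 1 * e 0 + k 2 * e 1 + k 3 * e 2) ^ 2) ≠ 0 → ∃ (u : Fin 3 → ℂ) (c : ℝ), u ≠ 0 ∧
      u 0 * u 0 + u 1 * u 1 + u 2 * u 2 = 0 ∧ c ≠ 0 ∧ nullVec u = c • k := by
    intro e he
    set s := k 1 * e 0 + k 2 * e 1 + k 3 * e 2 with hs
    set N := e 0 * e 0 + e 1 * e 1 + e 2 * e 2 with hN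
    -- The vector u is (k⁰)² e - (k·e) k + i k⁰ (k × e), for k the spatial part: k⁰ squared times
    -- the part of e transverse to k, plus i times its quarter turn. It is nonzero when e is not
    -- parallel to k.
    let u : Fin 3 → ℂ := ![⟨k 0 * k 0 * e 0 - k 1 * s, k 0 * (k 2 * e 2 - k 3 * e 1)⟩,
      ⟨k 0 * k 0 * e 1 - k 2 * s, k 0 * (k 3 * e 0 - k 1 * e 2)⟩,
      ⟨k 0 * k 0 * e 2 - k 3 * s, k 0 * (k 1 * e 1 - k 2 * e 0)⟩]
    have hu : nullVec u = (2 * (k 0 * (k 0 * k 0 * N - s ^ 2))) • k := by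
      ext i
      fin_cases i
      · simp [nullVec, Fin.sum_univ_three, u, Complex.normSq_apply]
        clear_value u
        grind
      all_goals
        simp [nullVec, u]
        clear_value u
        grind
    have hc : 2 * (k 0 * (k 0 * k 0 * N - s ^ 2)) ≠ 0 := mul_ne_zero two_ne_zero he
    refine ⟨u, _, ?_, ?_, hc, hu⟩
    · intro h0
      rw [h0] at hu
      have : nullVec 0 = 0 := by
        ext i
        fin_cases i <;> simp [nullVec]
      rw [this] at hu
      exact smul_ne_zero hc hk hu.symm
    · apply Complex.ext
      · simp [u]
        grind
      · simp [u]
        grind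
  have h0 : k 0 ≠ 0 := by
    intro h0
    apply hk
    rw [h0] at hn
    have h1 : k 1 = 0 := by nlinarith [mul_self_nonneg (k 1), mul_self_nonneg (k 2), mul_self_nonneg (k 3)]
    have h2 : k 2 = 0 := by nlinarith [mul_self_nonneg (k 1), mul_self_nonneg (k 2), mul_self_nonneg (k 3)]
    have h3 : k 3 = 0 := by nlinarith [mul_self_nonneg (k 1), mul_self_nonneg (k 2), mul_self_nonneg (k 3)]
    ext i
    fin_cases i <;> simp [h0, h1, h2, h3]
  have hp : 0 < k 0 * k 0 := mul_self_pos.2 h0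
  -- The auxiliary vector e is the first axis, unless k is spatially along it, in which case the
  -- second axis is used.
  by_cases h1 : k 0 * k 0 - k 1 * k 1 = 0
  · apply key ![0, 1, 0]
    simp
    refine ⟨h0, ?_⟩
    intro h2
    nlinarith [mul_self_nonneg (k 3)]
  · apply key ![1, 0, 0]
    simp
    refine ⟨h0, ?_⟩
    rwa [pow_two]

theorem nullVec_smul (t : ℂ) (u : Fin 3 → ℂ) : nullVec (t • u) = Complex.normSq t • nullVec u := by
  have h : ∀ z w : ℂ, (t * z * conj (t * w)).im = Complex.normSq t * (z * conj w).im := by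
    intro z w
    rw [← Complex.im_ofReal_mul, ← Complex.mul_conj, map_mul]
    congr 1
    ring
  ext i
  fin_cases i <;> simp only [nullVec, Fin.zero_eta, Fin.mk_one, Fin.reduceFinMk, Matrix.cons_val,
    Pi.smul_apply, smul_eq_mul, h, Complex.normSq_mul, Finset.mul_sum] <;> ring

/-- The spatial components of the null vector of `s`. -/
noncomputable def rootIm (s : Fin 3 → ℂ) : Fin 3 → ℝ :=
  ![2 * (s 2 * conj (s 1)).im, 2 * (s 0 * conj (s 2)).im, 2 * (s 1 * conj (s 0)).im]

/-- Four null vectors with opposite pairs of spatial components. -/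
noncomputable def debeverVec (s : Fin 3 → ℂ) : Fin 4 → Fin 4 → ℝ :=
  ![![∑ i, Complex.normSq (s i), rootIm s 0, rootIm s 1, rootIm s 2],
    ![∑ i, Complex.normSq (s i), rootIm s 0, -rootIm s 1, -rootIm s 2],
    ![∑ i, Complex.normSq (s i), -rootIm s 0, rootIm s 1, -rootIm s 2],
    ![∑ i, Complex.normSq (s i), -rootIm s 0, -rootIm s 1, rootIm s 2]]

/-- Changing the sign of one square root reverses two spatial components, and a common change of
sign does nothing. The eight sign choices therefore give four null vectors. -/
theorem debeverVec_eq (s : Fin 3 → ℂ) : debeverVec s = ![nullVec ![s 0, s 1, s 2],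
    nullVec ![-s 0, s 1, s 2], nullVec ![s 0, -s 1, s 2], nullVec ![s 0, s 1, -s 2]] := by
  ext i j
  fin_cases i <;> fin_cases j <;>
    (simp only [debeverVec, nullVec, rootIm, Fin.zero_eta, Fin.mk_one, Fin.reduceFinMk,
      Matrix.cons_val, Fin.sum_univ_three, map_neg, Complex.normSq_neg]
     try simp
     try ring)

theorem exists_debeverVec_of_sq {s u : Fin 3 → ℂ} {t : ℂ} (h : ∀ i, u i ^ 2 = (t * s i) ^ 2) :
    ∃ i, nullVec u = Complex.normSq t • debeverVec s i := by
  have h0 := sq_eq_sq_iff_eq_or_eq_neg.1 (h 0)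
  have h1 := sq_eq_sq_iff_eq_or_eq_neg.1 (h 1)
  have h2 := sq_eq_sq_iff_eq_or_eq_neg.1 (h 2)
  have hv : ∀ {x y z : ℂ} (r : ℂ), Complex.normSq r = Complex.normSq t → u 0 = r * x → u 1 = r * y →
      u 2 = r * z → nullVec u = Complex.normSq t • nullVec ![x, y, z] := by
    intro x y z r hr e0 e1 e2
    rw [← hr, ← nullVec_smul]
    congr 1
    ext i
    fin_cases i <;> simp [e0, e1, e2]
  have hn : Complex.normSq (-t) = Complex.normSq t := Complex.normSq_neg t
  rw [debeverVec_eq]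
  rcases h0 with e0 | e0 <;> rcases h1 with e1 | e1 <;> rcases h2 with e2 | e2
  · exact ⟨0, hv t rfl e0 e1 e2⟩
  · exact ⟨3, hv t rfl e0 e1 (by rw [e2]; ring)⟩
  · exact ⟨2, hv t rfl e0 (by rw [e1]; ring) e2⟩
  · exact ⟨1, hv (-t) hn (by rw [e0]; ring) (by rw [e1]; ring) (by rw [e2]; ring)⟩
  · exact ⟨1, hv t rfl (by rw [e0]; ring) e1 e2⟩
  · exact ⟨2, hv (-t) hn (by rw [e0]; ring) (by rw [e1]; ring) (by rw [e2]; ring)⟩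
  · exact ⟨3, hv (-t) hn (by rw [e0]; ring) (by rw [e1]; ring) (by rw [e2]; ring)⟩
  · exact ⟨0, hv (-t) hn (by rw [e0]; ring) (by rw [e1]; ring) (by rw [e2]; ring)⟩

theorem isDebever_debeverVec {σ : Fin 3 → ℂ} (hi : Function.Injective σ) {s : Fin 3 → ℂ}
    (hs : ∀ i, s i ^ 2 = triSide σ i) (i : Fin 4) :
    IsDebever eta (ofSd (diagonal σ)) (debeverVec s i) := by
  have h : ∀ u : Fin 3 → ℂ, (∀ j, u j ^ 2 = triSide σ j) →
      IsDebever eta (ofSd (diagonal σ)) (nullVec u) := by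
    intro u hu
    have e0 := hu 0
    have e1 := hu 1
    have e2 := hu 2
    simp only [triSide, Matrix.cons_val] at e0 e1 e2
    rw [isDebever_nullVec_iff]
    · rw [Fin.sum_univ_three, e0, e1, e2]
      ring
    · intro h0
      apply triSide_ne_zero hi 0
      rw [← hu, h0]
      simp
    · linear_combination e0 + e1 + e2
  rw [debeverVec_eq]
  have h0 := hs 0
  have h1 := hs 1
  have h2 := hs 2
  fin_cases i <;> refine h _ fun j => ?_ <;> fin_cases j <;> simpa

/-- The equations ∑ uᵢ² = 0 and ∑ σᵢ uᵢ² = 0 are linear in the squares. Their solutions form the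
line spanned by the sides, since the σᵢ are distinct. -/
theorem IsDebever.exists_debeverVec {σ : Fin 3 → ℂ} (hi : Function.Injective σ) {s : Fin 3 → ℂ}
    (hs : ∀ i, s i ^ 2 = triSide σ i) {k : Fin 4 → ℝ}
    (h : IsDebever eta (ofSd (diagonal σ)) k) :
    ∃ i, ∃ c : ℝ, c ≠ 0 ∧ k = c • debeverVec s i := by
  obtain ⟨u, c, hu0, hu, hc, huk⟩ := exists_nullVec h.1 h.2.1
  have h1 := h.smul hc
  rw [← huk, isDebever_nullVec_iff σ hu0 hu, Fin.sum_univ_three] at h1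
  have hd := triSide_ne_zero hi
  have hd0 := hd 0
  obtain ⟨t, ht⟩ := IsAlgClosed.exists_pow_nat_eq (u 0 ^ 2 / triSide σ 0) two_pos
  have e0 : u 0 ^ 2 = t ^ 2 * triSide σ 0 := by
    rw [ht]
    field_simp
  have e1 : u 1 ^ 2 = t ^ 2 * triSide σ 1 := by
    apply mul_left_cancel₀ hd0
    have : triSide σ 0 * u 1 ^ 2 = triSide σ 1 * u 0 ^ 2 := by
      simp only [triSide, Matrix.cons_val]
      linear_combination h1 - σ 2 * hu
    rw [this, e0]
    ring
  have e2 : u 2 ^ 2 = t ^ 2 * triSide σ 2 := by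
    have := sum_triSide σ
    linear_combination hu - e0 - e1 - t ^ 2 * this
  obtain ⟨i, hi⟩ := exists_debeverVec_of_sq (s := s) (u := u) (t := t) (fun i => by
    rw [mul_pow, hs]
    fin_cases i
    exacts [e0, e1, e2])
  refine ⟨i, c⁻¹ * Complex.normSq t, ?_, ?_⟩
  · have ht0 : t ≠ 0 := by
      rintro rfl
      apply hu0
      ext i
      fin_cases i
      · simpa using e0
      · simpa using e1
      · simpa using e2
    exact mul_ne_zero (inv_ne_zero hc) (Complex.normSq_pos.2 ht0).ne'
  · rw [mul_smul, ← hi, huk, smul_smul, inv_mul_cancel₀ hc, one_smul]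

/-- From s₀² = -(s₁² + s₂²) one gets |s₀|⁴ = (|s₁|² + |s₂|²)² - 4 Im(s₂ conj s₁)², and |sᵢ|² is the
length of the side dᵢ. -/
theorem rootIm_sq {σ s : Fin 3 → ℂ} (hs : ∀ i, s i ^ 2 = triSide σ i) :
    ∑ i, Complex.normSq (s i) = ‖triSide σ 0‖ + ‖triSide σ 1‖ + ‖triSide σ 2‖ ∧
    rootIm s 0 ^ 2 = (‖triSide σ 1‖ + ‖triSide σ 2‖ - ‖triSide σ 0‖)
      * (‖triSide σ 0‖ + ‖triSide σ 1‖ + ‖triSide σ 2‖) ∧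
    rootIm s 1 ^ 2 = (‖triSide σ 2‖ + ‖triSide σ 0‖ - ‖triSide σ 1‖)
      * (‖triSide σ 0‖ + ‖triSide σ 1‖ + ‖triSide σ 2‖) ∧
    rootIm s 2 ^ 2 = (‖triSide σ 0‖ + ‖triSide σ 1‖ - ‖triSide σ 2‖)
      * (‖triSide σ 0‖ + ‖triSide σ 1‖ + ‖triSide σ 2‖) := by
  have hn : ∀ i, ‖triSide σ i‖ = (s i).re * (s i).re + (s i).im * (s i).im := fun i => by
    rw [← Complex.normSq_apply, ← hs, norm_pow, Complex.normSq_eq_norm_sq]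
  have h0 : s 0 ^ 2 + s 1 ^ 2 + s 2 ^ 2 = 0 := by
    rw [hs, hs, hs, sum_triSide]
  have hre := congrArg Complex.re h0
  have him := congrArg Complex.im h0
  simp only [pow_two, Complex.add_re, Complex.mul_re, Complex.add_im, Complex.mul_im, Complex.zero_re,
    Complex.zero_im] at hre him
  simp only [hn, rootIm, Matrix.cons_val, Fin.sum_univ_three, Complex.normSq_apply, Complex.mul_im,
    Complex.conj_re, Complex.conj_im]
  refine ⟨trivial, ?_, ?_, ?_⟩ <;> grind

/-- The square of this identity is Heron's formula. -/
theorem rootIm_prod {σ s : Fin 3 → ℂ} (hσ : ∑ i, σ i = 0) (hs : ∀ i, s i ^ 2 = triSide σ i) :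
    rootIm s 0 * rootIm s 1 * rootIm s 2
      = 6 * (‖triSide σ 0‖ + ‖triSide σ 1‖ + ‖triSide σ 2‖) * triArea σ := by
  have hA : 3 * triArea σ = (s 1 ^ 2 * conj (s 2 ^ 2)).im := by
    rw [hs, hs]
    simp only [triSide, triArea, Matrix.cons_val, eq_neg_of_sum_eq_zero hσ, Complex.mul_im,
      Complex.conj_re, Complex.conj_im, Complex.sub_re, Complex.sub_im, Complex.neg_re,
      Complex.neg_im]
    ring
  have h0 : s 0 ^ 2 + s 1 ^ 2 + s 2 ^ 2 = 0 := by
    rw [hs, hs, hs, sum_triSide]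
  have hre := congrArg Complex.re h0
  have him := congrArg Complex.im h0
  rw [← (rootIm_sq hs).1]
  simp only [pow_two, Complex.add_re, Complex.mul_re, Complex.add_im, Complex.mul_im, Complex.zero_re,
    Complex.zero_im] at hre him
  have hA' : 6 * (∑ i, Complex.normSq (s i)) * triArea σ
      = 2 * (∑ i, Complex.normSq (s i)) * (3 * triArea σ) := by ring
  rw [hA', hA]
  simp only [pow_two, rootIm, Matrix.cons_val, Fin.sum_univ_three, Complex.normSq_apply,
    Complex.mul_im, Complex.mul_re, Complex.conj_re, Complex.conj_im]
  linear_combination 4 * ((s 2).im * (s 1).re - (s 2).re * (s 1).im) *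
    (((s 1).re * (s 2).re - (s 1).im * (s 2).im) * hre
      + ((s 1).re * (s 2).im + (s 1).im * (s 2).re) * him)

theorem det_debeverVec (s : Fin 3 → ℂ) : (Matrix.of (debeverVec s)).det
    = -16 * (∑ i, Complex.normSq (s i)) * (rootIm s 0 * rootIm s 1 * rootIm s 2) := by
  have h : Matrix.of (debeverVec s) = !![∑ i, Complex.normSq (s i), rootIm s 0, rootIm s 1, rootIm s 2;
    ∑ i, Complex.normSq (s i), rootIm s 0, -rootIm s 1, -rootIm s 2;
    ∑ i, Complex.normSq (s i), -rootIm s 0, rootIm s 1, -rootIm s 2;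
    ∑ i, Complex.normSq (s i), -rootIm s 0, -rootIm s 1, rootIm s 2] := rfl
  rw [h]
  generalize ∑ i, Complex.normSq (s i) = S
  generalize rootIm s 0 = p
  generalize rootIm s 1 = q
  generalize rootIm s 2 = r
  rw [Matrix.det_succ_row_zero]
  simp [Fin.sum_univ_four, Matrix.det_fin_three, Fin.succAbove, Matrix.submatrix]
  ring

/-- Complementary pairs of Debever vectors have equal products, each proportional to one side of the
triangle. -/
theorem metricProduct_debeverVec {σ s : Fin 3 → ℂ} (hs : ∀ i, s i ^ 2 = triSide σ i) (i j : Fin 4) :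
    metricProduct eta (debeverVec s i) (debeverVec s j)
      = -4 * (‖triSide σ 0‖ + ‖triSide σ 1‖ + ‖triSide σ 2‖) *
        ![![0, ‖triSide σ 0‖, ‖triSide σ 1‖, ‖triSide σ 2‖],
          ![‖triSide σ 0‖, 0, ‖triSide σ 2‖, ‖triSide σ 1‖],
          ![‖triSide σ 1‖, ‖triSide σ 2‖, 0, ‖triSide σ 0‖],
          ![‖triSide σ 2‖, ‖triSide σ 1‖, ‖triSide σ 0‖, 0]] i j := by
  obtain ⟨hS, h0, h1, h2⟩ := rootIm_sq hs
  rw [metricProduct_eta]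
  fin_cases i <;> fin_cases j <;>
    simp only [debeverVec, Fin.zero_eta, Fin.mk_one, Fin.reduceFinMk, Matrix.cons_val, hS] <;>
    grind

/-- Proportional null vectors have product zero, but the product of two of these is a nonzero
multiple of a side. -/
theorem debeverVec_ne_smul {σ s : Fin 3 → ℂ} (hi : Function.Injective σ)
    (hs : ∀ i, s i ^ 2 = triSide σ i) {i j : Fin 4} (hij : i ≠ j) (c : ℝ) :
    debeverVec s i ≠ c • debeverVec s j := by
  intro h
  have hpos : ∀ i, 0 < ‖triSide σ i‖ := fun i => norm_pos_iff.2 (triSide_ne_zero hi i)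
  have h1 : metricProduct eta (debeverVec s i) (debeverVec s j) = 0 := by
    rw [h, metricProduct_eq, smul_dotProduct, ← metricProduct_eq, metricProduct_debeverVec hs]
    fin_cases j <;> simp
  rw [metricProduct_debeverVec hs] at h1
  have hS : -4 * (‖triSide σ 0‖ + ‖triSide σ 1‖ + ‖triSide σ 2‖) ≠ 0 := by
    have h0 := hpos 0
    have h1 := hpos 1
    have h2 := hpos 2
    exact mul_ne_zero (by norm_num) (by positivity)
  have h2 := (mul_eq_zero.1 h1).resolve_left hS
  have e0 := (hpos 0).ne'
  have e1 := (hpos 1).ne'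
  have e2 := (hpos 2).ne'
  fin_cases i <;> fin_cases j <;>
    simp only [Fin.zero_eta, Fin.mk_one, Fin.reduceFinMk, Matrix.cons_val] at h2 hij <;>
    first
    | exact hij rfl
    | exact e0 h2
    | exact e1 h2
    | exact e2 h2

/-! ### Frames of Debever vectors -/

theorem isFrame_iff_det_ne_zero (v : Fin 4 → Fin 4 → ℝ) : IsFrame v ↔ (Matrix.of v).det ≠ 0 := by
  have h : LinearIndependent ℝ v ↔ (Matrix.of v).det ≠ 0 := by
    rw [← isUnit_iff_ne_zero, ← Matrix.isUnit_iff_isUnit_det, ← Matrix.linearIndependent_rows_iff_isUnit]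
    rfl
  rw [← h, IsFrame, and_iff_left_iff_imp]
  intro hv
  exact hv.span_eq_top_of_card_eq_finrank (by simp)

theorem isFrame_smul_iff {v : Fin 4 → Fin 4 → ℝ} {c : Fin 4 → ℝ} (hc : ∀ i, c i ≠ 0) :
    IsFrame (fun i => c i • v i) ↔ IsFrame v := by
  rw [isFrame_iff_det_ne_zero, isFrame_iff_det_ne_zero]
  have : Matrix.of (fun i => c i • v i) = Matrix.of fun i j => c i * Matrix.of v i j := rfl
  rw [this, Matrix.det_mul_column]
  have hp : ∏ i, c i ≠ 0 := Finset.prod_ne_zero_iff.2 fun i _ => hc i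
  simp [hp]

theorem isFrame_perm_iff {v : Fin 4 → Fin 4 → ℝ} (π : Equiv.Perm (Fin 4)) :
    IsFrame (fun i => v (π i)) ↔ IsFrame v := by
  rw [isFrame_iff_det_ne_zero, isFrame_iff_det_ne_zero]
  have : Matrix.of (fun i => v (π i)) = (Matrix.of v).submatrix π id := rfl
  rw [this, Matrix.det_permute]
  rcases Int.units_eq_one_or (Equiv.Perm.sign π) with h | h <;> simp [h]

theorem isFrame_mulVec_iff {v : Fin 4 → Fin 4 → ℝ} {L : Matrix (Fin 4) (Fin 4) ℝ}
    (hL : L.det ≠ 0) : IsFrame (fun i => L *ᵥ v i) ↔ IsFrame v := by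
  rw [isFrame_iff_det_ne_zero, isFrame_iff_det_ne_zero]
  have : Matrix.of (fun i => L *ᵥ v i) = Matrix.of v * Lᵀ := by
    ext i j
    simp [Matrix.mul_apply, Matrix.mulVec, dotProduct, mul_comm]
  rw [this, Matrix.det_mul, Matrix.det_transpose]
  simp [hL]

theorem isWeylEigenvalue_diagonal (σ : Fin 3 → ℂ) (i : Fin 3) :
    IsWeylEigenvalue eta (ofSd (diagonal σ)) (σ i) := by
  rw [isWeylEigenvalue_ofSd]
  refine ⟨Pi.single i 1, by simp, ?_⟩
  ext j
  by_cases hij : j = i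
  · subst hij
    simp [Matrix.mulVec_diagonal]
  · simp [Matrix.mulVec_diagonal, hij]

/-- A Weyl tensor in diagonal form in the orthonormal frame given by the columns of `L`. -/
structure IsPrincipalFrame (G : Matrix (Fin 4) (Fin 4) ℝ) (W : Tensor4)
    (L : Matrix (Fin 4) (Fin 4) ℝ) (σ : Fin 3 → ℂ) : Prop where
  det_pos : 0 < L.det
  metric : Lᵀ * G * L = eta
  injective : Function.Injective σ
  sum_eq_zero : ∑ i, σ i = 0
  pull_eq : pull L W = ofSd (diagonal σ)

/-! ### The invariants of a type I Weyl tensor read in a principal frame -/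

namespace IsPrincipalFrame

variable {G : Matrix (Fin 4) (Fin 4) ℝ} {W : Tensor4} {L : Matrix (Fin 4) (Fin 4) ℝ}
  {σ : Fin 3 → ℂ}

theorem isDebever_iff (h : IsPrincipalFrame G W L σ) (k : Fin 4 → ℝ) :
    IsDebever eta (ofSd (diagonal σ)) k ↔ IsDebever G W (L *ᵥ k) := by
  rw [← h.metric, ← h.pull_eq, isDebever_congr h.det_pos.ne']

theorem metricProduct_mulVec (h : IsPrincipalFrame G W L σ) (v w : Fin 4 → ℝ) :
    metricProduct G (L *ᵥ v) (L *ᵥ w) = metricProduct eta v w := by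
  rw [← h.metric, metricProduct_congr]

theorem isDebever (h : IsPrincipalFrame G W L σ) {s : Fin 3 → ℂ}
    (hs : ∀ i, s i ^ 2 = triSide σ i) (i : Fin 4) : IsDebever G W (L *ᵥ debeverVec s i) :=
  (h.isDebever_iff _).1 (isDebever_debeverVec h.injective hs i)

theorem exists_of_isDebever (h : IsPrincipalFrame G W L σ) {s : Fin 3 → ℂ}
    (hs : ∀ i, s i ^ 2 = triSide σ i) {k : Fin 4 → ℝ} (hk : IsDebever G W k) :
    ∃ i, ∃ c : ℝ, c ≠ 0 ∧ k = c • L *ᵥ debeverVec s i := by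
  have hinv : L *ᵥ (L⁻¹ *ᵥ k) = k := by
    rw [Matrix.mulVec_mulVec, Matrix.mul_nonsing_inv _ h.det_pos.ne'.isUnit, Matrix.one_mulVec]
  obtain ⟨i, c, hc, hk'⟩ := IsDebever.exists_debeverVec h.injective hs
    ((h.isDebever_iff _).2 (hinv.symm ▸ hk))
  refine ⟨i, c, hc, ?_⟩
  rw [← Matrix.mulVec_smul, ← hk', hinv]

theorem ne_smul (h : IsPrincipalFrame G W L σ) {s : Fin 3 → ℂ}
    (hs : ∀ i, s i ^ 2 = triSide σ i) {i j : Fin 4} (hij : i ≠ j) (c : ℝ) :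
    L *ᵥ debeverVec s i ≠ c • L *ᵥ debeverVec s j := by
  rw [← Matrix.mulVec_smul]
  intro he
  have hinj : Function.Injective L.mulVec :=
    Matrix.mulVec_injective_of_isUnit ((Matrix.isUnit_iff_isUnit_det _).2 h.det_pos.ne'.isUnit)
  exact debeverVec_ne_smul h.injective hs hij c (hinj he)

theorem areDebeverVectors (h : IsPrincipalFrame G W L σ) {s : Fin 3 → ℂ}
    (hs : ∀ i, s i ^ 2 = triSide σ i) :
    AreDebeverVectors G W fun i => L *ᵥ debeverVec s i := by
  refine ⟨h.isDebever hs, fun i j hij => ?_, fun v hv => ?_⟩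
  · rintro ⟨c, hc⟩
    exact h.ne_smul hs hij c hc
  · obtain ⟨i, c, -, hc⟩ := h.exists_of_isDebever hs hv
    exact ⟨i, c, hc⟩

/-- Any four representatives are the standard ones up to order and scale: each is a multiple of a
standard one, and no two are multiples of the same. -/
theorem exists_perm (h : IsPrincipalFrame G W L σ) {s : Fin 3 → ℂ}
    (hs : ∀ i, s i ^ 2 = triSide σ i) {k : Fin 4 → Fin 4 → ℝ} (hk : AreDebeverVectors G W k) :
    ∃ (π : Equiv.Perm (Fin 4)) (c : Fin 4 → ℝ), (∀ i, c i ≠ 0) ∧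
      (fun i => c i • k i) = fun i => L *ᵥ debeverVec s (π i) := by
  choose p c hc hp using fun i => h.exists_of_isDebever hs (hk.1 i)
  have hinj : Function.Injective p := by
    intro i j hij
    by_contra hne
    apply hk.2.1 i j hne
    refine ⟨c i * (c j)⁻¹, ?_⟩
    rw [hp i, hp j, hij, smul_smul, mul_assoc, inv_mul_cancel₀ (hc j), mul_one]
  refine ⟨Equiv.ofBijective p (Finite.injective_iff_bijective.1 hinj), fun i => (c i)⁻¹,
    fun i => inv_ne_zero (hc i), ?_⟩
  funext i
  rw [hp i, smul_smul, inv_mul_cancel₀ (hc i), one_smul]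
  rfl

theorem isFrame_debeverVec_iff (h : IsPrincipalFrame G W L σ) {s : Fin 3 → ℂ}
    (hs : ∀ i, s i ^ 2 = triSide σ i) : IsFrame (debeverVec s) ↔ triArea σ ≠ 0 := by
  have hS : ‖triSide σ 0‖ + ‖triSide σ 1‖ + ‖triSide σ 2‖ ≠ 0 := by
    have h0 := norm_pos_iff.2 (triSide_ne_zero h.injective 0)
    positivity
  rw [isFrame_iff_det_ne_zero, det_debeverVec, rootIm_prod h.sum_eq_zero hs, (rootIm_sq hs).1]
  simp [hS]

theorem isFrame_iff (h : IsPrincipalFrame G W L σ) {k : Fin 4 → Fin 4 → ℝ}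
    (hk : AreDebeverVectors G W k) : IsFrame k ↔ triArea σ ≠ 0 := by
  choose s hs using fun i => IsAlgClosed.exists_pow_nat_eq (triSide σ i) two_pos
  obtain ⟨π, c, hc, hkc⟩ := h.exists_perm hs hk
  rw [← isFrame_smul_iff hc, hkc, isFrame_perm_iff (v := fun i => L *ᵥ debeverVec s i) π,
    isFrame_mulVec_iff h.det_pos.ne', h.isFrame_debeverVec_iff hs]

theorem isSymmetricFrame (h : IsPrincipalFrame G W L σ) (hA : triArea σ ≠ 0)
    (h01 : ‖triSide σ 0‖ = ‖triSide σ 1‖) (h12 : ‖triSide σ 1‖ = ‖triSide σ 2‖)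
    {k : Fin 4 → Fin 4 → ℝ} (hk : AreDebeverVectors G W k) :
    ∃ c : Fin 4 → ℝ, (∀ i, c i ≠ 0) ∧ IsSymmetricFrame G (fun i => c i • k i) := by
  choose s hs using fun i => IsAlgClosed.exists_pow_nat_eq (triSide σ i) two_pos
  obtain ⟨π, c, hc, hkc⟩ := h.exists_perm hs hk
  refine ⟨c, hc, ?_, fun τ i j => ?_⟩
  · rw [isFrame_smul_iff hc, h.isFrame_iff hk]
    exact hA
  · have hkc' : ∀ i, c i • k i = L *ᵥ debeverVec s (π i) := fun i => congrFun hkc i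
    have key : ∀ i j, metricProduct G (c i • k i) (c j • k j)
        = if i = j then 0 else
          -4 * (‖triSide σ 0‖ + ‖triSide σ 1‖ + ‖triSide σ 2‖) * ‖triSide σ 2‖ := by
      intro i j
      rw [hkc', hkc', h.metricProduct_mulVec, metricProduct_debeverVec hs]
      simp only [← π.injective.eq_iff (a := i)]
      generalize π i = a
      generalize π j = b
      rw [h01, h12]
      fin_cases a <;> fin_cases b <;> simp
    simp only [key, τ.injective.eq_iff]

theorem isPartiallySymmetricFrame (h : IsPrincipalFrame G W L σ) (hA : triArea σ ≠ 0)
    (heq : ‖triSide σ 0‖ = ‖triSide σ 1‖ ∨ ‖triSide σ 1‖ = ‖triSide σ 2‖ ∨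
      ‖triSide σ 2‖ = ‖triSide σ 0‖)
    (hne : ¬ (‖triSide σ 0‖ = ‖triSide σ 1‖ ∧ ‖triSide σ 1‖ = ‖triSide σ 2‖))
    {k : Fin 4 → Fin 4 → ℝ} (hk : AreDebeverVectors G W k) :
    ∃ c : Fin 4 → ℝ, (∀ i, c i ≠ 0) ∧ IsPartiallySymmetricFrame G (fun i => c i • k i) := by
  choose s hs using fun i => IsAlgClosed.exists_pow_nat_eq (triSide σ i) two_pos
  obtain ⟨π, c, hc, hkc⟩ := h.exists_perm hs hk
  have hS : -4 * (‖triSide σ 0‖ + ‖triSide σ 1‖ + ‖triSide σ 2‖) ≠ 0 := by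
    have h0 := norm_pos_iff.2 (triSide_ne_zero h.injective 0)
    exact mul_ne_zero (by norm_num) (by positivity)
  refine ⟨c, hc, ?_, ?_⟩
  · rw [isFrame_smul_iff hc, h.isFrame_iff hk]
    exact hA
  have hkc' : ∀ i, c i • k i = L *ᵥ debeverVec s (π i) := fun i => congrFun hkc i
  have key : ∀ i j, metricProduct G (c (π.symm i) • k (π.symm i)) (c (π.symm j) • k (π.symm j))
      = metricProduct eta (debeverVec s i) (debeverVec s j) := by
    intro i j
    rw [hkc', hkc', h.metricProduct_mulVec, Equiv.apply_symm_apply, Equiv.apply_symm_apply]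
  have hdiag : ∀ i, metricProduct G (c i • k i) (c i • k i) = 0 := by
    intro i
    rw [hkc', h.metricProduct_mulVec, metricProduct_debeverVec hs]
    generalize π i = a
    fin_cases a <;> simp
  set S := -4 * (‖triSide σ 0‖ + ‖triSide σ 1‖ + ‖triSide σ 2‖) with hSdef
  -- The exceptional side gives q and the two equal sides give r, so the exceptional side decides
  -- which of the three splittings into pairs is used. The transposition brings that splitting to
  -- the positions {0, 1}, {2, 3}.
  rcases heq with e | e | e
  · refine ⟨(Equiv.swap 1 3).trans π.symm, 0, S * ‖triSide σ 2‖, S * ‖triSide σ 1‖, ?_, hdiag, ?_⟩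
    · intro h0
      have h1 := mul_left_cancel₀ hS h0
      exact hne ⟨e, h1.symm⟩
    · have e0 : (Equiv.swap 1 3 : Equiv.Perm (Fin 4)) 0 = 0 := by decide
      have e1 : (Equiv.swap 1 3 : Equiv.Perm (Fin 4)) 1 = 3 := by decide
      have e2 : (Equiv.swap 1 3 : Equiv.Perm (Fin 4)) 2 = 2 := by decide
      have e3 : (Equiv.swap 1 3 : Equiv.Perm (Fin 4)) 3 = 1 := by decide
      simp only [Equiv.trans_apply, e0, e1, e2, e3, key, metricProduct_debeverVec hs,
        Matrix.cons_val, hSdef, e, and_self]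
  · refine ⟨π.symm, 0, S * ‖triSide σ 0‖, S * ‖triSide σ 1‖, ?_, hdiag, ?_⟩
    · intro h0
      have h1 := mul_left_cancel₀ hS h0
      exact hne ⟨h1, e⟩
    · simp only [key, metricProduct_debeverVec hs, Matrix.cons_val, hSdef, e, and_self]
  · refine ⟨(Equiv.swap 1 2).trans π.symm, 0, S * ‖triSide σ 1‖, S * ‖triSide σ 0‖, ?_, hdiag, ?_⟩
    · intro h0
      have h1 := mul_left_cancel₀ hS h0
      exact hne ⟨h1.symm, by rw [h1, e]⟩
    · have e0 : (Equiv.swap 1 2 : Equiv.Perm (Fin 4)) 0 = 0 := by decide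
      have e1 : (Equiv.swap 1 2 : Equiv.Perm (Fin 4)) 1 = 2 := by decide
      have e2 : (Equiv.swap 1 2 : Equiv.Perm (Fin 4)) 2 = 1 := by decide
      have e3 : (Equiv.swap 1 2 : Equiv.Perm (Fin 4)) 3 = 3 := by decide
      simp only [Equiv.trans_apply, e0, e1, e2, e3, key, metricProduct_debeverVec hs,
        Matrix.cons_val, hSdef, e, and_self]

theorem weylA_eq (h : IsPrincipalFrame G W L σ) : weylA G W = ∑ i, σ i ^ 2 := by
  rw [← weylA_pull G h.det_pos, h.metric, h.pull_eq, weylA, trace_weylEndo_ofSd_pow _ 1,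
    Matrix.diagonal_pow, Matrix.trace_diagonal]
  rfl

theorem weylB_eq (h : IsPrincipalFrame G W L σ) : weylB G W = ∑ i, σ i ^ 3 := by
  rw [← weylB_pull G h.det_pos, h.metric, h.pull_eq, weylB, trace_weylEndo_ofSd_pow _ 2,
    Matrix.diagonal_pow, Matrix.trace_diagonal]
  rfl

theorem weylM_eq (h : IsPrincipalFrame G W L σ) :
    weylM G W = (∑ i, σ i ^ 2) ^ 3 / (∑ i, σ i ^ 3) ^ 2 - 6 := by
  rw [weylM, h.weylA_eq, h.weylB_eq]

theorem isSuperEnergyRadiative_iff (h : IsPrincipalFrame G W L σ) (hW : IsWeylTensor G W) :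
    IsSuperEnergyRadiative G W ↔ triArea σ ≠ 0 := by
  rw [← isSuperEnergyRadiative_congr h.det_pos, h.metric, h.pull_eq, ← not_iff_not, not_not]
  have hW' := hW.pull h.det_pos.ne'
  rw [h.metric, h.pull_eq] at hW'
  constructor
  · intro h1
    exact im_mul_conj_of_not_radiative hW' (isWeylEigenvalue_diagonal σ 0)
      (isWeylEigenvalue_diagonal σ 1) h1
  · intro h0
    apply not_radiative_of_im_mul_conj
    intro i j
    rw [(mul_conj_re_im h.sum_eq_zero i j).1, h0]
    fin_cases i <;> fin_cases j <;> simp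

theorem belRobinsonEigenvalues_eq (h : IsPrincipalFrame G W L σ) :
    belRobinsonEigenvalues G W = Set.range fun p : Fin 3 × Fin 3 => σ p.1 * conj (σ p.2) := by
  rw [← belRobinsonEigenvalues_pull h.det_pos, h.metric, h.pull_eq,
    belRobinsonEigenvalues_ofSd_diagonal]

end IsPrincipalFrame

theorem exists_isPrincipalFrame {G : Matrix (Fin 4) (Fin 4) ℝ} {W : Tensor4}
    {L : Matrix (Fin 4) (Fin 4) ℝ} (hd : 0 < L.det) (hL : Lᵀ * G * L = eta)
    (hW : IsWeylTensor G W) (hI : IsTypeI G W) : ∃ L σ, IsPrincipalFrame G W L σ := by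
  have hW' := hW.pull hd.ne'
  rw [hL] at hW'
  obtain ⟨Q, hQ, htr, hWQ⟩ := hW'.exists_ofSd
  obtain ⟨ρ, hρ, hev⟩ := hI
  obtain ⟨N, σ, hN, hNL, hσ, hsum, hpull⟩ := exists_principal_frame hQ htr hρ fun i => by
    rw [← hWQ, ← hL]
    exact (isWeylEigenvalue_pull hd).2 (hev i)
  refine ⟨L * N, σ, ?_, ?_, hσ, hsum, ?_⟩
  · rw [Matrix.det_mul]
    exact mul_pos hd hN
  · rw [Matrix.transpose_mul]
    calc _ = Nᵀ * (Lᵀ * G * L) * N := by simp only [Matrix.mul_assoc]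
      _ = _ := by rw [hL, hNL]
  · rw [← pull_pull, hWQ, hpull]

end SuperEnergy

/-! ### The proposition -/

theorem mainTheorem7 {M : Type*} [TopologicalSpace M] [ChartedSpace Coord M]
    [IsManifold (𝓡 4) ∞ M] (g : LorentzianMetric M)
    (φ : OpenPartialHomeomorph M Coord) (hφ : φ ∈ IsManifold.maximalAtlas (𝓡 4) ∞ M)
    (p : M) (hp : p ∈ φ.source)
    (hI : IsTypeI (g.metricAt φ p) (g.weylAt φ p)) :
    (∃ k : Fin 4 → Fin 4 → ℝ, AreDebeverVectors (g.metricAt φ p) (g.weylAt φ p) k) ∧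
    ∀ k : Fin 4 → Fin 4 → ℝ, AreDebeverVectors (g.metricAt φ p) (g.weylAt φ p) k →
      (IsSuperEnergyRadiative (g.metricAt φ p) (g.weylAt φ p) ↔ IsFrame k) ∧
      (IsTypeIM6 (g.metricAt φ p) (g.weylAt φ p) →
        ∃ c : Fin 4 → ℝ, (∀ i, c i ≠ 0) ∧
          IsSymmetricFrame (g.metricAt φ p) (fun i => c i • k i)) ∧
      (IsTypeIMneg (g.metricAt φ p) (g.weylAt φ p) →
        ∃ c : Fin 4 → ℝ, (∀ i, c i ≠ 0) ∧
          IsPartiallySymmetricFrame (g.metricAt φ p) (fun i => c i • k i)) ∧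
      (IsSuperEnergyRadiative (g.metricAt φ p) (g.weylAt φ p) →
        ¬ IsTypeIM6 (g.metricAt φ p) (g.weylAt φ p) →
        ¬ IsTypeIMneg (g.metricAt φ p) (g.weylAt φ p) →
        IsTypeIr (g.metricAt φ p) (g.weylAt φ p)) := by
  have hW := isWeylTensor_weylAt g hφ hp
  obtain ⟨L₀, hd, hL₀⟩ := exists_orthonormal_frame g hφ hp
  obtain ⟨L, σ, h⟩ := exists_isPrincipalFrame hd hL₀ hW hI
  have hσ := h.sum_eq_zero
  refine ⟨?_, fun k hk => ⟨?_, ?_, ?_, ?_⟩⟩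
  · choose s hs using fun i => IsAlgClosed.exists_pow_nat_eq (triSide σ i) two_pos
    exact ⟨_, h.areDebeverVectors hs⟩
  · rw [h.isSuperEnergyRadiative_iff hW, h.isFrame_iff hk]
  · rintro ⟨-, hb, hM⟩
    rw [h.weylB_eq] at hb
    rw [h.weylM_eq] at hM
    have hA := (triArea_ne_zero_of_neg hσ hb (m := -6) (by norm_num)
      (by rw [hM]; push_cast; rfl)).1
    -- M = -6 means a = 0, hence an equilateral triangle.
    have ha : ∑ i, σ i ^ 2 = 0 := by
      have h1 : (∑ i, σ i ^ 2) ^ 3 / (∑ i, σ i ^ 3) ^ 2 = 0 := by linear_combination hM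
      rcases div_eq_zero_iff.1 h1 with h2 | h2
      · exact pow_eq_zero_iff three_ne_zero |>.1 h2
      · exact absurd (pow_eq_zero_iff two_ne_zero |>.1 h2) hb
    obtain ⟨h01, h12⟩ := (norm_triSide_eq_iff hσ h.injective).2 ha
    exact h.isSymmetricFrame hA h01 h12 hk
  · rintro ⟨-, hb, m, hm, hm6, hM⟩
    rw [h.weylB_eq] at hb
    rw [h.weylM_eq] at hM
    obtain ⟨hA, hn⟩ := triArea_ne_zero_of_neg hσ hb hm hM
    refine h.isPartiallySymmetricFrame hA (norm_triSide_eq_of_mul_eq_zero hσ hn) ?_ hk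
    -- An equilateral triangle would have a = 0, hence M = -6, which is excluded.
    intro h0
    rw [(norm_triSide_eq_iff hσ h.injective).1 h0] at hM
    apply hm6
    have : (m : ℂ) = ((-6 : ℝ) : ℂ) := by
      rw [← hM]
      push_cast
      ring
    exact_mod_cast this
  · intro hr h6 hneg
    rw [h.isSuperEnergyRadiative_iff hW] at hr
    -- The types `IM^{-6}` and `IM^-` together exhaust the negative real values of M.
    have hno : ∑ i, σ i ^ 3 ≠ 0 →
        ¬ ∃ m : ℝ, m < 0 ∧ (∑ i, σ i ^ 2) ^ 3 / (∑ i, σ i ^ 3) ^ 2 - 6 = (m : ℂ) := by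
      rintro hb ⟨m, hm, hM⟩
      rw [← h.weylB_eq] at hb
      rw [← h.weylM_eq] at hM
      by_cases hm6 : m = -6
      · exact h6 ⟨hI, hb, by rw [hM, hm6]; push_cast; rfl⟩
      · exact hneg ⟨hI, hb, m, hm, hm6, hM⟩
    obtain ⟨hb, him, hn⟩ := regular_of_triArea_ne_zero hσ hr hno
    obtain ⟨h9, h3⟩ := ncard_range_mul_conj hσ hr hn
    refine ⟨hI, ?_, ?_, ?_, ?_⟩
    · rwa [h.weylB_eq]
    · rwa [h.weylM_eq]
    · rwa [h.belRobinsonEigenvalues_eq]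
    · rwa [h.belRobinsonEigenvalues_eq]
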